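/- Let $M$ be a smooth (Hausdorff, finite-dimensional) manifold with a sub-Riemannian structure $(\mathcal H,g_{\mathcal H})$ of rank $n$: $\mathcal H\subseteq TM$ is a smooth subbundle of rank $n$ with a smooth positive definite fibre metric $g_{\mathcal H}$. Write $$\langle\alpha,\beta\rangle_{g^*_{\mathcal H}}=\sum_{i=1}^n\alpha(v_i)\beta(v_i),\qquad \operatorname{tr}_{\mathcal H}\xi(\times,\times)=\sum_{i=1}^n\xi(v_i,v_i)$$ for covectors $\alpha,\beta\in T^*_xM$ and bilinear maps $\xi$ on $T_xM$, where $v_1,\dots,v_n$ is any orthonormal basis of $\mathcal H_x$. Let $\nabla$ be an arbitrary smooth affine connection on $M$ with torsion $T$, let $\hat\nabla_XY=\nabla_XY-T(X,Y)$ be its adjoint connection, with curvature $\hat R(X,Y)=\hat\nabla_X\hat\nabla_Y-\hat\nabla_Y\hat\nabla_X-\hat\nabla_{[X,Y]}$ on vector fields and $(\hat R(v,w)\alpha)(u)=-\alpha(\hat R(v,w)u)$ on covectors, and assume that $\hat\nabla g^*_{\mathcal H}=0$, i.e. $Z\langle\alpha,\beta\rangle_{g^*_{\mathcal H}}=\langle\hat\nabla_Z\alpha,\beta\rangle_{g^*_{\mathcal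 H}}+\langle\alpha,\hat\nabla_Z\beta\rangle_{g^*_{\mathcal H}}$ for all vector fields $Z$ and one-forms $\alpha,\beta$. On the exterior algebra $\Omega(M)$ of smooth differential forms let $\nabla^2_{X,Y}=\nabla_X\nabla_Y-\nabla_{\nabla_XY}$ and $$L_{\mathcal H}=\operatorname{tr}_{\mathcal H}\nabla^2_{\times,\times},\qquad \delta_{\mathcal H}\eta=-\operatorname{tr}_{\mathcal H}(\nabla_\times\eta)(\times,\,\cdot\,),\qquad \Delta_{\mathcal H}=-d\,\delta_{\mathcal H}-\delta_{\mathcal H}\,d .$$ Let $\Psi_{(i,j)}$ be the space of smooth sections of $\wedge^iT^*M\otimes\wedge^jTM$. For a section $\nu$ of $\wedge^\bullet T^*M\otimes\wedge^\bullet TM$ let $C_\nu$ be the operator of order zero on forms that depends linearly on $\nu$ and satisfies $C_1=\mathrm{id}$, $C_\alpha=\alpha\wedge\cdot$ for a form $\alpha$, $C_X=\iota_X$ for a vector $X$, $C_{X\wedge\chi}=C_\chi C_X$ for a vector $X$ and a multivector $\chi$, and $C_{\alpha\otimes\chi}=C_\alpha C_\chi$. Evaluate and pair by determinants: $(\alpha\wedge\beta)(v,w)=\alpha(v)\beta(w)-\alpha(w)\beta(v)$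 and $(\alpha\wedge\beta)(X\wedge Y)=\alpha(X)\beta(Y)-\alpha(Y)\beta(X)$. Then the operators $\delta_{\mathcal H}$ and $\Delta_{\mathcal H}$ map smooth forms to smooth forms, and the following hold. (I) $\Delta_{\mathcal H}f=L_{\mathcal H}f$ for every smooth function $f$. (II) $\Delta_{\mathcal H}\,d\eta=d\,\Delta_{\mathcal H}\eta$ for every smooth form $\eta$ (of any, possibly mixed, degree). (III) There are unique $\operatorname{Ric}_{1,1}\in\Psi_{(1,1)}$ and $\operatorname{Ric}_{2,2}\in\Psi_{(2,2)}$ such that, for all tangent vectors $v,w$ and covectors $\alpha,\beta$ at the same point, $$\operatorname{Ric}_{1,1}(v)=-\operatorname{tr}_{\mathcal H}\hat R(\times,v)\times,\qquad (\alpha\wedge\beta)\operatorname{Ric}_{2,2}(v,w)=2\langle\hat R(v,w)\alpha,\beta\rangle_{g^*_{\mathcal H}},$$ and with $\operatorname{Ric}=\operatorname{Ric}_{1,1}+\operatorname{Ric}_{2,2}$ the Weitzenböck identity $$\Delta_{\mathcal H}=L_{\mathcal H}-C_{\operatorname{Ric}}$$ holds on $\Omega(M)$. -/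

import Mathlib

open Bundle
open scoped Manifold ContDiff TensorProduct

/-! ## Exterior algebra on a finite-dimensional real vector space -/

section FiberAlgebra

variable {V : Type*} [AddCommGroup V] [Module ℝ V] [TopologicalSpace V]
  [IsTopologicalAddGroup V] [ContinuousSMul ℝ V] [T2Space V] [FiniteDimensional ℝ V] {k : ℕ}

theorem altContinuous (f : V [⋀^Fin k]→ₗ[ℝ] ℝ) : Continuous f := by
  classical
  let b := Module.finBasis ℝ V
  have h : (f : (Fin k → V) → ℝ) = fun v => ∑ r : Fin k → Fin (Module.finrank ℝ V),
      (∏ i, b.repr (v i) (r i)) • f (fun i => b (r i)) := by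
    funext v
    conv_lhs => rw [show v = fun i => ∑ j, b.repr (v i) j • b j from
      funext fun i => (b.sum_repr (v i)).symm]
    change f.toMultilinearMap _ = _
    rw [MultilinearMap.map_sum]
    exact Finset.sum_congr rfl fun r _ => f.toMultilinearMap.map_smul_univ _ _
  rw [h]
  refine continuous_finsetSum _ fun r _ => Continuous.fun_smul
    (continuous_finsetProd _ fun i _ => ?_) continuous_const
  exact (LinearMap.continuous_of_finiteDimensional (b.coord (r i))).comp (continuous_apply i)

/-- An alternating form on a finite-dimensional space, bundled with its continuity. -/
def altToCont (f : V [⋀^Fin k]→ₗ[ℝ] ℝ) : V [⋀^Fin k]→L[ℝ] ℝ :=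
  { f with cont := altContinuous f }

/-- Contraction `ι_X η = η(X, ·, …, ·)`. -/
def contractForm (X : V) (η : V [⋀^Fin (k + 1)]→L[ℝ] ℝ) : V [⋀^Fin k]→L[ℝ] ℝ :=
  altToCont (η.toAlternatingMap.curryLeft X)

/-- Exterior product of a covector with a form:
`(α ∧ η)(v₀, …, v_k) = ∑ i, (-1)^i α(v_i) η(v₀, …, v̂_i, …, v_k)`. -/
noncomputable def wedgeForm (α : Module.Dual ℝ V) (η : V [⋀^Fin k]→L[ℝ] ℝ) :
    V [⋀^Fin (k + 1)]→L[ℝ] ℝ :=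
  altToCont (AlternatingMap.alternatizeUncurryFin (α.smulRight η.toAlternatingMap))

/-- An endomorphism `A` acting on forms by
`(v₁, …, v_k) ↦ ∑ i, η(v₁, …, A v_i, …, v_k)`. -/
noncomputable def endAct (A : V →ₗ[ℝ] V) : {k : ℕ} → (V [⋀^Fin k]→L[ℝ] ℝ) → V [⋀^Fin k]→L[ℝ] ℝ
  | 0, _ => 0
  | _ + 1, η =>
    altToCont (AlternatingMap.alternatizeUncurryFin (η.toAlternatingMap.curryLeft ∘ₗ A))

theorem contractForm_apply (X : V) (η : V [⋀^Fin (k + 1)]→L[ℝ] ℝ) (v : Fin k → V) :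
    contractForm X η v = η (Matrix.vecCons X v) := rfl

theorem wedgeForm_apply (α : Module.Dual ℝ V) (η : V [⋀^Fin k]→L[ℝ] ℝ) (v : Fin (k + 1) → V) :
    wedgeForm α η v = ∑ i : Fin (k + 1), (-1) ^ (i : ℕ) • (α (v i) * η (i.removeNth v)) :=
  AlternatingMap.alternatizeUncurryFin_apply _ _

theorem endAct_apply (A : V →ₗ[ℝ] V) (η : V [⋀^Fin k]→L[ℝ] ℝ) (v : Fin k → V) :
    endAct A η v = ∑ i, η (Function.update v i (A (v i))) := by
  cases k with
  | zero => simp [endAct]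
  | succ k =>
    change AlternatingMap.alternatizeUncurryFin (η.toAlternatingMap.curryLeft ∘ₗ A) v = _
    rw [AlternatingMap.alternatizeUncurryFin_apply]
    refine Finset.sum_congr rfl fun i _ => ?_
    change (-1) ^ (i : ℕ) • η.toAlternatingMap (Matrix.vecCons (A (v i)) (i.removeNth v)) =
      η.toAlternatingMap _
    rw [← AlternatingMap.neg_one_pow_smul_map_insertNth η.toAlternatingMap i,
      smul_smul, ← pow_add, Even.neg_one_pow ⟨_, rfl⟩, one_smul]
    congr 1
    exact Fin.insertNth_removeNth i _ v

/-- The covector `w ↦ α(w)` of a form `α` of degree one. -/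
def covector (α : V [⋀^Fin 1]→L[ℝ] ℝ) : Module.Dual ℝ V :=
  ((ContinuousAlternatingMap.ofSubsingleton ℝ V ℝ (0 : Fin 1)).symm α).toLinearMap

theorem covector_apply (α : V [⋀^Fin 1]→L[ℝ] ℝ) (w : V) : covector α w = α ![w] :=
  congrArg α (funext fun _ => by simp)

variable (V) in
/-- The exterior algebra `⨁ₖ Λᵏ V*`, a form of mixed degree being the family of its homogeneous
components (those of degree above `dim V` vanish). -/
abbrev MixedForm : Type _ := ∀ k : ℕ, V [⋀^Fin k]→L[ℝ] ℝ

/-- The creation operator `α ∧ ·`. -/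
noncomputable def wedgeEnd : Module.Dual ℝ V →ₗ[ℝ] Module.End ℝ (MixedForm V) :=
  LinearMap.mk₂ ℝ (fun α η k => match k with
      | 0 => 0
      | k + 1 => wedgeForm α (η k))
    (fun α β η => by
      funext k; cases k
      · simp
      · ext v; simp [wedgeForm_apply, add_mul, Finset.sum_add_distrib])
    (fun c α η => by
      funext k; cases k
      · simp
      · ext v; simp [wedgeForm_apply, Finset.mul_sum, mul_assoc, mul_left_comm])
    (fun α η θ => by
      funext k; cases k
      · simp
      · ext v; simp [wedgeForm_apply, mul_add, Finset.sum_add_distrib])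
    (fun c α η => by
      funext k; cases k
      · simp
      · ext v; simp [wedgeForm_apply, Finset.mul_sum, mul_left_comm])

/-- The annihilation operator `ι_X`. -/
def contractEnd : V →ₗ[ℝ] Module.End ℝ (MixedForm V) :=
  LinearMap.mk₂ ℝ (fun X η k => contractForm X (η (k + 1)))
    (fun X Y η => by
      funext k; ext v; exact (η (k + 1)).vecCons_add v X Y)
    (fun c X η => by
      funext k; ext v; exact (η (k + 1)).vecCons_smul v c X)
    (fun X η θ => by funext k; ext v; rfl)
    (fun c X η => by funext k; ext v; rfl)

theorem wedgeEnd_sq (α : Module.Dual ℝ V) : wedgeEnd (V := V) α * wedgeEnd α = 0 := by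
  refine LinearMap.ext fun η => funext fun k => ?_
  match k with
  | 0 => rfl
  | 1 =>
    ext v
    change wedgeForm α (0 : V [⋀^Fin 0]→L[ℝ] ℝ) v = 0
    simp [wedgeForm_apply]
  | k + 2 =>
    ext v
    have h := AlternatingMap.alternatizeUncurryFin_alternatizeUncurryFinLM_comp_of_symmetric
      (f := α.smulRight (α.smulRight (η k).toAlternatingMap))
      (fun x y => by simp [smul_smul, mul_comm])
    have h' := congrArg (fun g => g v) h
    refine Eq.trans ?_ h'
    change AlternatingMap.alternatizeUncurryFin
      (α.smulRight (wedgeForm α (η k)).toAlternatingMap) v = _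
    congr 2
    ext x w
    change α x * wedgeForm α (η k) w = AlternatingMap.alternatizeUncurryFin _ w
    rw [wedgeForm_apply, AlternatingMap.alternatizeUncurryFin_apply, Finset.mul_sum]
    refine Finset.sum_congr rfl fun i _ => ?_
    change _ = (-1) ^ (i : ℕ) • (α x * (α (w i) * η k (i.removeNth w)))
    exact mul_smul_comm _ _ _

theorem contractEnd_sq (X : V) : contractEnd X * contractEnd X = 0 := by
  refine LinearMap.ext fun η => funext fun k => ?_
  ext v
  exact (η (k + 1 + 1)).map_eq_zero_of_eq _ (i := 0) (j := 1) (by simp) Fin.zero_ne_one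

/-- `C_α = α ∧ ·` for `α ∈ Λ V*`. -/
noncomputable def creation : ExteriorAlgebra ℝ (Module.Dual ℝ V) →ₐ[ℝ] Module.End ℝ (MixedForm V) :=
  ExteriorAlgebra.lift ℝ ⟨wedgeEnd, wedgeEnd_sq⟩

/-- `C_χ` for `χ ∈ Λ V`, with `C_X = ι_X` and `C_{X ∧ χ} = C_χ C_X`; the order of composition is
reversed, whence the opposite algebra. -/
noncomputable def annihilation :
    ExteriorAlgebra ℝ V →ₐ[ℝ] (Module.End ℝ (MixedForm V))ᵐᵒᵖ :=
  ExteriorAlgebra.lift ℝ ⟨(MulOpposite.opLinearEquiv ℝ).toLinearMap ∘ₗ contractEnd, fun X => by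
    change MulOpposite.op (contractEnd X) * MulOpposite.op (contractEnd X) = 0
    rw [← MulOpposite.op_mul, contractEnd_sq, MulOpposite.op_zero]⟩

/-- The linear map `ν ↦ C_ν` with `C_{α ⊗ χ} = C_α C_χ`. -/
noncomputable def fermion :
    ExteriorAlgebra ℝ (Module.Dual ℝ V) ⊗[ℝ] ExteriorAlgebra ℝ V →ₗ[ℝ]
      Module.End ℝ (MixedForm V) :=
  TensorProduct.lift ((LinearMap.mul ℝ (Module.End ℝ (MixedForm V))).compl₁₂
    creation.toLinearMap
    ((MulOpposite.opLinearEquiv ℝ).symm.toLinearMap ∘ₗ annihilation.toLinearMap))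

theorem fermion_tmul (α : ExteriorAlgebra ℝ (Module.Dual ℝ V)) (χ : ExteriorAlgebra ℝ V) :
    fermion (α ⊗ₜ χ) = creation α * (annihilation χ).unop := rfl

variable (V) in
/-- The fibre `Λⁱ V* ⊗ Λʲ V` of the bundle whose sections form `Ψ_(i,j)`. -/
abbrev PsiFiber (i j : ℕ) : Type _ := ⋀[ℝ]^i (Module.Dual ℝ V) ⊗[ℝ] ⋀[ℝ]^j V

/-- The inclusion `Λⁱ V* ⊗ Λʲ V ⊆ Λ V* ⊗ Λ V`. -/
noncomputable def psiIncl {i j : ℕ} :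
    PsiFiber V i j →ₗ[ℝ] ExteriorAlgebra ℝ (Module.Dual ℝ V) ⊗[ℝ] ExteriorAlgebra ℝ V :=
  TensorProduct.map (⋀[ℝ]^i (Module.Dual ℝ V)).subtype (⋀[ℝ]^j V).subtype

/-- `(α₁ ∧ … ∧ α_j) ν(v₁, …, v_i)`: evaluation of `ν ∈ Λⁱ V* ⊗ Λʲ V`, regarded as an `i`-form with
values in `Λʲ V`, followed by the (determinant) pairing with covectors. -/
noncomputable def psiEval {i j : ℕ} (ν : PsiFiber V i j) (v : Fin i → V)
    (α : Fin j → Module.Dual ℝ V) : ℝ :=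
  LinearMap.mul' ℝ ℝ (TensorProduct.map
    ((exteriorPower.pairingDual ℝ V i).flip (exteriorPower.ιMulti ℝ i v))
    (exteriorPower.pairingDual ℝ V j (exteriorPower.ιMulti ℝ j α)) ν)

end FiberAlgebra

section Geometry

variable {E : Type*} [NormedAddCommGroup E] [NormedSpace ℝ E]
  {M : Type*} [TopologicalSpace M] [ChartedSpace E M]

instance tangentFiniteDimensional [FiniteDimensional ℝ E] (x : M) :
    FiniteDimensional ℝ (TangentSpace 𝓘(ℝ, E) x) :=
  inferInstanceAs (FiniteDimensional ℝ E)

instance tangentT2 (x : M) : T2Space (TangentSpace 𝓘(ℝ, E) x) :=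
  inferInstanceAs (T2Space E)

variable (E M) in
/-- Vector fields (not necessarily smooth). -/
abbrev VField : Type _ := Π x : M, TangentSpace 𝓘(ℝ, E) x

variable (E M) in
/-- Differential `k`-forms (not necessarily smooth). -/
abbrev KForm (k : ℕ) : Type _ := Π x : M, TangentSpace 𝓘(ℝ, E) x [⋀^Fin k]→L[ℝ] ℝ

variable (E M) in
/-- Differential forms of mixed degree (not necessarily smooth). -/
abbrev DForm : Type _ := Π x : M, MixedForm (TangentSpace 𝓘(ℝ, E) x)

variable [FiniteDimensional ℝ E] [IsManifold 𝓘(ℝ, E) ∞ M] {k : ℕ}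

/-- A `k`-form as a section of the bundle of alternating forms on `TM`. -/
noncomputable def formSection (η : KForm E M k) (x : M) : TotalSpace (E [⋀^Fin k]→L[ℝ] ℝ)
    (fun x : M => TangentSpace 𝓘(ℝ, E) x [⋀^Fin k]→L[ℝ] Trivial M ℝ x) :=
  ⟨x, η x⟩

def SmoothFormAt (η : KForm E M k) (x : M) : Prop :=
  ContMDiffAt 𝓘(ℝ, E) (𝓘(ℝ, E).prod 𝓘(ℝ, E [⋀^Fin k]→L[ℝ] ℝ)) ∞ (formSection η) x

/-- `η ∈ Ω(M)`. -/
def SmoothForm (η : DForm E M) : Prop := ∀ k x, SmoothFormAt (fun y => η y k) x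

/-- A smooth function as a differential form (of degree `0`). -/
noncomputable def ofFun (f : M → ℝ) : DForm E M
  | x, 0 => ContinuousAlternatingMap.constOfIsEmpty ℝ (TangentSpace 𝓘(ℝ, E) x) (Fin 0) (f x)
  | _, _ + 1 => 0

/-- The derivative `T_x M → E` at `x` of the preferred chart at `x`. -/
noncomputable def chartDeriv (x : M) : TangentSpace 𝓘(ℝ, E) x →L[ℝ] E :=
  (trivializationAt E (TangentSpace 𝓘(ℝ, E)) x).continuousLinearMapAt ℝ x

/-- The expression of `η` in the preferred chart at `x₀` (its pullback by the inverse chart). -/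
noncomputable def formInChart (x₀ : M) (η : KForm E M k) (e : E) : E [⋀^Fin k]→L[ℝ] ℝ :=
  (η ((chartAt E x₀).symm e)).compContinuousLinearMap
    ((trivializationAt E (TangentSpace 𝓘(ℝ, E)) x₀).symmL ℝ ((chartAt E x₀).symm e))

/-- The exterior derivative of a `k`-form, computed in charts. -/
noncomputable def extDerivForm (η : KForm E M k) : KForm E M (k + 1) := fun x =>
  (extDeriv (formInChart x η) (chartAt E x x)).compContinuousLinearMap (chartDeriv x)

/-- The exterior derivative `d`. -/
noncomputable def dForm (η : DForm E M) : DForm E M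
  | _, 0 => 0
  | x, k + 1 => extDerivForm (fun y => η y k) x

variable (E M) in
/-- Affine connections on `M`. -/
abbrev Connection : Type _ :=
  CovariantDerivative 𝓘(ℝ, E) E (TangentSpace 𝓘(ℝ, E) : M → Type _)

theorem cov_extend_add (cov : Connection E M) (x : M) (v w : TangentSpace 𝓘(ℝ, E) x) :
    cov (FiberBundle.extend E (v + w)) x =
      cov (FiberBundle.extend E v) x + cov (FiberBundle.extend E w) x := by
  have hd (u : TangentSpace 𝓘(ℝ, E) x) := FiberBundle.mdifferentiableAt_extend 𝓘(ℝ, E) E u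
  rw [← cov.isCovariantDerivativeOnUniv.add (hd v) (hd w)]
  refine cov.isCovariantDerivativeOnUniv.congr_of_eventuallyEq (hd _)
    (mdifferentiableAt_add_section (hd v) (hd w)) Filter.univ_mem ?_
  have hx := FiberBundle.mem_baseSet_trivializationAt' (F := E)
    (E := (TangentSpace 𝓘(ℝ, E) : M → Type _)) x
  filter_upwards [(trivializationAt E (TangentSpace 𝓘(ℝ, E)) x).open_baseSet.mem_nhds hx]
    with y hy
  have hs := (trivializationAt E (TangentSpace 𝓘(ℝ, E)) x).symmL_apply (R := ℝ) hy
  simp only [FiberBundle.extend, Pi.add_apply,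
    ← Trivialization.continuousLinearMapAt_apply_of_mem ℝ _ hx, map_add]
  simp only [FiberBundle.trivializationAt', ← hs, map_add]

theorem cov_extend_smul (cov : Connection E M) (x : M) (c : ℝ) (v : TangentSpace 𝓘(ℝ, E) x) :
    cov (FiberBundle.extend E (c • v)) x = c • cov (FiberBundle.extend E v) x := by
  have hd (u : TangentSpace 𝓘(ℝ, E) x) := FiberBundle.mdifferentiableAt_extend 𝓘(ℝ, E) E u
  rw [← cov.isCovariantDerivativeOnUniv.smul_const c (hd v)]
  refine cov.isCovariantDerivativeOnUniv.congr_of_eventuallyEq (hd _)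
    (mdifferentiableAt_const.smul_section (hd v)) Filter.univ_mem ?_
  have hx := FiberBundle.mem_baseSet_trivializationAt' (F := E)
    (E := (TangentSpace 𝓘(ℝ, E) : M → Type _)) x
  filter_upwards [(trivializationAt E (TangentSpace 𝓘(ℝ, E)) x).open_baseSet.mem_nhds hx]
    with y hy
  have hs := (trivializationAt E (TangentSpace 𝓘(ℝ, E)) x).symmL_apply (R := ℝ) hy
  simp only [FiberBundle.extend, Pi.smul_apply,
    ← Trivialization.continuousLinearMapAt_apply_of_mem ℝ _ hx, map_smul]
  simp only [FiberBundle.trivializationAt', ← hs, map_smul]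

/-- The Christoffel symbols `w ↦ ∇_v W` of a connection in the preferred chart at `x`, where `W` is
the vector field with constant coordinates in this chart such that `W(x) = w`. -/
noncomputable def christoffel (cov : Connection E M) (x : M) (v : TangentSpace 𝓘(ℝ, E) x) :
    TangentSpace 𝓘(ℝ, E) x →ₗ[ℝ] TangentSpace 𝓘(ℝ, E) x where
  toFun w := cov (FiberBundle.extend E w) x v
  map_add' w w' := by
    rw [cov_extend_add]
    rfl
  map_smul' c w := by
    rw [cov_extend_smul]
    rfl

/-- The induced covariant derivative `∇_v η` of a `k`-form at `x`. -/
noncomputable def covForm (cov : Connection E M) (η : KForm E M k) (x : M)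
    (v : TangentSpace 𝓘(ℝ, E) x) : TangentSpace 𝓘(ℝ, E) x [⋀^Fin k]→L[ℝ] ℝ :=
  (fderiv ℝ (formInChart x η) (chartAt E x x) (chartDeriv x v)).compContinuousLinearMap
    (chartDeriv x) - endAct (christoffel cov x v) (η x)

/-- The adjoint connection `∇̂_X Y = ∇_X Y - T(X, Y)`, where `T` is the torsion of `∇`. -/
noncomputable def adjointConnection (cov : Connection E M) : Connection E M :=
  cov.addOneForm cov.torsion

theorem adjointConnection_apply (cov : Connection E M) (Y : VField E M) (x : M)
    (v : TangentSpace 𝓘(ℝ, E) x) :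
    adjointConnection cov Y x v = cov Y x v - cov.torsion x v (Y x) := by
  rw [cov.torsion_antisymm, sub_neg_eq_add]
  rfl

/-- The curvature `R(u, v)w = ∇_U ∇_V W - ∇_V ∇_U W - ∇_[U, V] W` at `x`, where `U`, `V`, `W` are
local vector fields extending `u`, `v`, `w`. -/
noncomputable def curvature (cov : Connection E M) (x : M) (u v w : TangentSpace 𝓘(ℝ, E) x) :
    TangentSpace 𝓘(ℝ, E) x :=
  let U : VField E M := FiberBundle.extend E u
  let V : VField E M := FiberBundle.extend E v
  let W : VField E M := FiberBundle.extend E w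
  cov (fun y => cov W y (V y)) x u - cov (fun y => cov W y (U y)) x v -
    cov W x (VectorField.mlieBracket 𝓘(ℝ, E) U V x)

/-- The induced covariant derivative `∇_v η` of a form of mixed degree. -/
noncomputable def nabla (cov : Connection E M) (η : DForm E M) (x : M)
    (v : TangentSpace 𝓘(ℝ, E) x) : MixedForm (TangentSpace 𝓘(ℝ, E) x) :=
  fun k => covForm cov (fun y => η y k) x v

/-- The Hessian `∇²_{v,w} η = ∇_v ∇_W η - ∇_{∇_v W} η`, where `W` is a local vector field extending
`w`. -/
noncomputable def hessian (cov : Connection E M) (η : DForm E M) (x : M)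
    (v w : TangentSpace 𝓘(ℝ, E) x) : MixedForm (TangentSpace 𝓘(ℝ, E) x) :=
  nabla cov (fun y => nabla cov η y (FiberBundle.extend E w y)) x v -
    nabla cov η x (cov (FiberBundle.extend E w) x v)

variable (E M) in
/-- A sub-Riemannian structure `(H, g_H)` of rank `n` on `M`: a smooth subbundle `H` of `TM` with a
smooth positive definite fibre metric. -/
structure SubRiemannian (n : ℕ) where
  /-- the horizontal bundle -/
  H : Π x : M, Submodule ℝ (TangentSpace 𝓘(ℝ, E) x)
  /-- the inner products on the fibres -/
  metric : Π x : M, InnerProductSpace.Core ℝ (H x)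
  exists_frame : ∀ x₀ : M, ∃ U : Set M, IsOpen U ∧ x₀ ∈ U ∧ ∃ X : Fin n → Π x : M, H x,
    (∀ i, CMDiff[U] ∞ (T% (fun x => (X i x : TangentSpace 𝓘(ℝ, E) x)))) ∧
    ∀ x ∈ U, LinearIndependent ℝ (fun i => X i x) ∧
      Submodule.span ℝ (Set.range fun i => X i x) = ⊤
  smooth_metric : ∀ U : Set M, IsOpen U → ∀ X Y : Π x : M, H x,
    CMDiff[U] ∞ (T% (fun x => (X x : TangentSpace 𝓘(ℝ, E) x))) →
    CMDiff[U] ∞ (T% (fun x => (Y x : TangentSpace 𝓘(ℝ, E) x))) →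
    CMDiff[U] ∞ (fun x => (metric x).inner (X x) (Y x))

namespace SubRiemannian

variable {n : ℕ} (S : SubRiemannian E M n)

/-- A basis of `H_x` is orthonormal. -/
def IsOrthonormal (x : M) {ι : Type*} [DecidableEq ι] (b : Module.Basis ι ℝ (S.H x)) : Prop :=
  ∀ i j, (S.metric x).inner (b i) (b j) = if i = j then 1 else 0

theorem exists_orthonormal (x : M) :
    ∃ b : Module.Basis (Fin (Module.finrank ℝ (S.H x))) ℝ (S.H x), S.IsOrthonormal x b := by
  let : NormedAddCommGroup (S.H x) := (S.metric x).toNormedAddCommGroup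
  let : InnerProductSpace ℝ (S.H x) := InnerProductSpace.ofCore (S.metric x).toCore
  have h := (stdOrthonormalBasis ℝ (S.H x)).orthonormal
  exact ⟨(stdOrthonormalBasis ℝ (S.H x)).toBasis, fun i j => by
    simpa using orthonormal_iff_ite.1 h i j⟩

/-- An orthonormal basis of `H_x`. -/
noncomputable def frame (x : M) : Module.Basis (Fin (Module.finrank ℝ (S.H x))) ℝ (S.H x) :=
  (S.exists_orthonormal x).choose

theorem frame_orthonormal (x : M) : S.IsOrthonormal x (S.frame x) :=
  (S.exists_orthonormal x).choose_spec

/-- The horizontal trace `tr_H ξ(×, ×) = ∑ ξ(v_i, v_i)` over an orthonormal basis `v_i` of `H_x`. -/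
noncomputable def trace (x : M) {W : Type*} [AddCommGroup W]
    (ξ : TangentSpace 𝓘(ℝ, E) x → TangentSpace 𝓘(ℝ, E) x → W) : W :=
  ∑ i, ξ (S.frame x i) (S.frame x i)

/-- The horizontal trace of a bilinear map does not depend on the orthonormal basis. -/
theorem trace_eq_sum (x : M) {W : Type*} [AddCommGroup W] [Module ℝ W]
    (ξ : TangentSpace 𝓘(ℝ, E) x →ₗ[ℝ] TangentSpace 𝓘(ℝ, E) x →ₗ[ℝ] W)
    {ι : Type*} [Fintype ι] [DecidableEq ι] (b : Module.Basis ι ℝ (S.H x))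
    (hb : S.IsOrthonormal x b) : S.trace x (fun v w => ξ v w) = ∑ i, ξ (b i) (b i) := by
  let : NormedAddCommGroup (S.H x) := (S.metric x).toNormedAddCommGroup
  let : InnerProductSpace ℝ (S.H x) := InnerProductSpace.ofCore (S.metric x).toCore
  have hf : Orthonormal ℝ (S.frame x) := orthonormal_iff_ite.2 (S.frame_orthonormal x)
  have hb' : Orthonormal ℝ b := orthonormal_iff_ite.2 hb
  let f := (S.frame x).toOrthonormalBasis hf
  let c := b.toOrthonormalBasis hb'
  let g : S.H x →ₗ[ℝ] S.H x →ₗ[ℝ] W := ξ.compl₁₂ (S.H x).subtype (S.H x).subtype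
  have h1 : ∀ i, f i = S.frame x i := fun i => by simp [f]
  have h2 : ∀ i, c i = b i := fun i => by simp [c]
  have key : ∑ i, g (f i) (f i) = ∑ i, g (c i) (c i) := by
    have e : ∀ i, g (c i) (c i) = ∑ j, ∑ l, (inner ℝ (f j) (c i) * inner ℝ (c i) (f l)) •
        g (f j) (f l) := fun i => by
      conv_lhs => rw [← f.sum_repr' (c i)]
      simp only [map_sum, map_smul, LinearMap.sum_apply, LinearMap.smul_apply, Finset.smul_sum,
        smul_smul]
      rw [Finset.sum_comm]
      refine Finset.sum_congr rfl fun j _ => Finset.sum_congr rfl fun l _ => ?_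
      rw [real_inner_comm (c i) (f l), mul_comm]
    simp only [e]
    rw [Finset.sum_comm]
    refine Finset.sum_congr rfl fun j _ => ?_
    rw [Finset.sum_comm]
    simp only [← Finset.sum_smul, c.sum_inner_mul_inner, orthonormal_iff_ite.1 f.orthonormal,
      ite_smul, one_smul, zero_smul, Finset.sum_ite_eq, Finset.mem_univ, if_true]
  simp only [h1, h2] at key
  exact key

/-- The cometric `⟨α, β⟩_{g_H^*} = ∑ α(v_i) β(v_i)`. -/
noncomputable def cometric (x : M) (α β : TangentSpace 𝓘(ℝ, E) x → ℝ) : ℝ :=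
  S.trace x fun v w => α v * β w

/-- `∇ g_H^* = 0`: the cometric is parallel for the covariant derivative induced on one-forms. -/
def IsParallelCometric (cov : Connection E M) : Prop :=
  ∀ (x : M) (α β : KForm E M 1), SmoothFormAt α x → SmoothFormAt β x →
    ∀ v : TangentSpace 𝓘(ℝ, E) x,
      mvfderiv 𝓘(ℝ, E) (fun y => S.cometric y (covector (α y)) (covector (β y))) x v =
        S.cometric x (covector (covForm cov α x v)) (covector (β x)) +
          S.cometric x (covector (α x)) (covector (covForm cov β x v))

variable (cov : Connection E M)

/-- `L_H = tr_H ∇²_{×,×}`. -/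
noncomputable def horizontalLaplacian (η : DForm E M) : DForm E M := fun x =>
  S.trace x (hessian cov η x)

/-- `δ_H η = - tr_H (∇_× η)(×, ·)`. -/
noncomputable def codiff (η : DForm E M) : DForm E M := fun x =>
  -S.trace x fun v w => contractEnd w (nabla cov η x v)

/-- `Δ_H = - d δ_H - δ_H d`. -/
noncomputable def formLaplacian (η : DForm E M) : DForm E M :=
  -dForm (S.codiff cov η) - S.codiff cov (dForm η)

/-- `Ric_{1,1}(v) = - tr_H R(×, v)×`, for a field `ρ` of elements of `T^*M ⊗ TM`; here `R` is the
curvature of `cov`. -/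
def IsRic₁₁ (ρ : Π x : M, PsiFiber (TangentSpace 𝓘(ℝ, E) x) 1 1) : Prop :=
  ∀ (x : M) (v : TangentSpace 𝓘(ℝ, E) x) (α : Module.Dual ℝ (TangentSpace 𝓘(ℝ, E) x)),
    psiEval (ρ x) ![v] ![α] = α (-S.trace x fun u u' => curvature cov x u v u')

/-- `(α ∧ β) Ric_{2,2}(v, w) = 2 ⟨R(v, w) α, β⟩_{g_H^*}`, for a field `ρ` of elements of
`Λ² T^*M ⊗ Λ² TM`; here `R` is the curvature of `cov`, acting on covectors by
`(R(v, w) α)(u) = - α(R(v, w) u)`. -/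
def IsRic₂₂ (ρ : Π x : M, PsiFiber (TangentSpace 𝓘(ℝ, E) x) 2 2) : Prop :=
  ∀ (x : M) (v w : TangentSpace 𝓘(ℝ, E) x) (α β : Module.Dual ℝ (TangentSpace 𝓘(ℝ, E) x)),
    psiEval (ρ x) ![v, w] ![α, β] =
      2 * S.cometric x (fun u => -α (curvature cov x v w u)) β

end SubRiemannian

/-- A field of elements of `Λⁱ T^*M ⊗ Λʲ TM` is smooth (so that it belongs to `Ψ_(i,j)`): its values
on smooth local vector fields and one-forms are smooth. -/
def SmoothPsi {i j : ℕ} (ρ : Π x : M, PsiFiber (TangentSpace 𝓘(ℝ, E) x) i j) : Prop :=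
  ∀ U : Set M, IsOpen U → ∀ (Y : Fin i → VField E M) (θ : Fin j → KForm E M 1),
    (∀ a, CMDiff[U] ∞ (T% (Y a))) → (∀ b, ∀ x ∈ U, SmoothFormAt (θ b) x) →
    CMDiff[U] ∞ (fun x => psiEval (ρ x) (fun a => Y a x) (fun b => covector (θ b x)))

end Geometry

/-! Work in a chart with standard basis e_a of the model space. Let Γ(v)w = ∇_v w be the Christoffel
symbols, F the chart expression of η, and G_a = Σ_c g^{ac} e_c the rows of the cometric, so that a
horizontal trace becomes Σ_a ξ(e_a, G_a) (`trace_eq_sum_cometricRow`). Then d = Σ_c e^c ∧ ∂_c and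
∇_v = ∂_v − Γ(v)·, where an endomorphism acts as a derivation, and δ = −Σ_a ι_{e_a} ∇_{G_a}. Since
coordinate fields commute, passing to the adjoint connection transposes the symbols: Γ̂(v)w = Γ(w)v
(`chris_adjointConnection`). Parallelism of the cometric therefore reads ∂_v G_a = −Γ(G_a)v − Σ_d
e^a(Γ(e_d)v) G_d (`IsParallelCometric.fderiv_cometricRow`).

Expand −dδ − δd. The relation ι_X(α ∧ ·) + α ∧ ι_X = α(X) moves the contractions ι_{e_a} past the
exterior derivative, and parallelism eliminates the derivatives of the cometric. What appears is tr
∇² plus the remainder Σ_a ι_{e_a} Σ_c e^c ∧ (K_a(e_c)·F), with K_a(u) = ∂_uΓ(G_a) − Γ(Γ(G_a)u)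
(`weitzenboeck_pointwise`). Under Σ_c e^c ∧ only the antisymmetric part of K_a survives, and K_a(u)v
− K_a(v)u = R̂(u,v)G_a. Carrying out ι_{e_a} (`contractEnd_wedgeSum_endActEnd`) gives a term with
one creation operator, which is −Ric_{1,1}, and a term with two, which is −Ric_{2,2}. The torsion
needs no restriction, because d involves partial derivatives only and the transposition absorbs it.

An element of Λ^i V* ⊗ Λ^j V is determined by its values, which gives uniqueness. Existence of
Ric_{2,2} requires ⟨R̂(v,w)α,β⟩ to be skew in α, β; this follows by differentiating the parallelism
equation once more and using the symmetry of second derivatives (`curvModel_cometricRow`). Part (II)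
is d² = 0, and part (I) is the Weitzenböck identity on functions, where every contraction vanishes.

The operators are defined at each point through the preferred chart there, while differentiating
them requires one chart on a neighbourhood. Hence each object is shown to have the expected
expression in every chart containing the point. Smoothness can then be read off from these
expressions. -/

set_option linter.unusedSectionVars false

/-! ### Creation and annihilation operators and derivations of the exterior algebra. -/

section FiberAlgebra

variable {V : Type*} [AddCommGroup V] [Module ℝ V] [TopologicalSpace V]
  [IsTopologicalAddGroup V] [ContinuousSMul ℝ V] [T2Space V] [FiniteDimensional ℝ V]
  {W : Type*} [AddCommGroup W] [Module ℝ W] [TopologicalSpace W]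
  [IsTopologicalAddGroup W] [ContinuousSMul ℝ W] [T2Space W] [FiniteDimensional ℝ W]
  {ι : Type*} [Fintype ι]

theorem wedgeEnd_apply_zero (α : Module.Dual ℝ V) (η : MixedForm V) : wedgeEnd α η 0 = 0 := rfl

theorem wedgeEnd_apply_succ (α : Module.Dual ℝ V) (η : MixedForm V) (k : ℕ) :
    wedgeEnd α η (k + 1) = wedgeForm α (η k) := rfl

/-- In the expansion of α ∧ η on (X, v_1, …) the summand that removes X is α(X)η. Every other
summand differs by one sign from the corresponding summand of α ∧ ι_X η. All later commutations rest
on this relation. -/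
theorem contractEnd_wedgeEnd (X : V) (α : Module.Dual ℝ V) (η : MixedForm V) :
    contractEnd X (wedgeEnd α η) = α X • η - wedgeEnd α (contractEnd X η) := by
  funext k
  ext v
  have h1 : contractEnd X (wedgeEnd α η) k v =
      α X * η k v - ∑ i : Fin k, (-1) ^ (i : ℕ) • (α (v i) *
        η k (i.succ.removeNth (Matrix.vecCons X v : Fin (k + 1) → V))) := by
    change wedgeForm α (η k) (Matrix.vecCons X v) = _
    rw [wedgeForm_apply, Fin.sum_univ_succ, sub_eq_add_neg, ← Finset.sum_neg_distrib]
    congr 1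
    · simp
    · refine Finset.sum_congr rfl fun i _ => ?_
      simp [pow_succ]
  have h2 : wedgeEnd α (contractEnd X η) k v = ∑ i : Fin k, (-1) ^ (i : ℕ) • (α (v i) *
        η k (i.succ.removeNth (Matrix.vecCons X v : Fin (k + 1) → V))) := by
    cases k with
    | zero => rfl
    | succ k =>
      change wedgeForm α (contractForm X (η (k + 1))) v = _
      rw [wedgeForm_apply]
      refine Finset.sum_congr rfl fun i _ => ?_
      rw [contractForm_apply]
      congr 3
      funext j
      refine Fin.cases ?_ (fun j => ?_) j <;> simp [Fin.removeNth]
  rw [h1, ← h2]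
  rfl

/-- Polarization of `wedgeEnd_sq`. -/
theorem wedgeEnd_comm (α β : Module.Dual ℝ V) (η : MixedForm V) :
    wedgeEnd α (wedgeEnd β η) = -wedgeEnd β (wedgeEnd α η) := by
  have h := LinearMap.congr_fun (wedgeEnd_sq (α + β)) η
  have hX := LinearMap.congr_fun (wedgeEnd_sq α) η
  have hY := LinearMap.congr_fun (wedgeEnd_sq β) η
  simp only [Module.End.mul_apply, map_add, LinearMap.add_apply, LinearMap.zero_apply] at h hX hY
  rw [hX, hY, zero_add, add_zero] at h
  exact eq_neg_of_add_eq_zero_right h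

/-- The derivation of the exterior algebra (dual convention) induced by an endomorphism. -/
noncomputable def endActEnd : (V →ₗ[ℝ] V) →ₗ[ℝ] Module.End ℝ (MixedForm V) :=
  LinearMap.mk₂ ℝ (fun A η k => endAct A (η k))
    (fun A B η => by
      funext k; ext v
      simp [endAct_apply, Finset.sum_add_distrib])
    (fun c A η => by
      funext k; ext v
      simp [endAct_apply, Finset.mul_sum])
    (fun A η θ => by
      funext k; ext v
      simp [endAct_apply, Finset.sum_add_distrib])
    (fun c A η => by
      funext k; ext v
      simp [endAct_apply, Finset.mul_sum])

theorem endActEnd_apply (A : V →ₗ[ℝ] V) (η : MixedForm V) (k : ℕ) :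
    endActEnd A η k = endAct A (η k) := rfl

/-- Expanding A v_i in the basis turns the derivation into a sum of creation-annihilation products.
Its commutators then follow from `contractEnd_wedgeEnd`. -/
theorem endActEnd_eq_sum (b : Module.Basis ι ℝ V) (A : V →ₗ[ℝ] V) (η : MixedForm V) :
    endActEnd A η = ∑ a, wedgeEnd (b.coord a ∘ₗ A) (contractEnd (b a) η) := by
  funext k
  rw [Finset.sum_apply]
  ext v
  rw [ContinuousAlternatingMap.sum_apply]
  cases k with
  | zero =>
    simp only [endActEnd_apply, endAct_apply, wedgeEnd_apply_zero]
    simp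
  | succ k =>
    change AlternatingMap.alternatizeUncurryFin ((η (k + 1)).toAlternatingMap.curryLeft ∘ₗ A) v = _
    rw [AlternatingMap.alternatizeUncurryFin_apply]
    simp only [wedgeEnd_apply_succ, wedgeForm_apply]
    rw [Finset.sum_comm]
    refine Finset.sum_congr rfl fun i _ => ?_
    rw [← Finset.smul_sum]
    congr 1
    have h : ∀ X : V, (η (k + 1)).toAlternatingMap.curryLeft X (i.removeNth v) =
      ∑ a, b.repr X a * (η (k + 1)).toAlternatingMap.curryLeft (b a) (i.removeNth v) := fun X => by
      let f : V →ₗ[ℝ] ℝ :=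
        { toFun := fun X => (η (k + 1)).toAlternatingMap.curryLeft X (i.removeNth v)
          map_add' := fun X Y => by rw [map_add]; rfl
          map_smul' := fun c X => by rw [map_smul]; rfl }
      change f X = ∑ a, b.repr X a * f (b a)
      conv_lhs => rw [← b.sum_repr X]
      rw [map_sum]
      exact Finset.sum_congr rfl fun a _ => by rw [map_smul, smul_eq_mul]
    exact h _

theorem comp_eq_sum_coord (b : Module.Basis ι ℝ V) (α : Module.Dual ℝ V) (A : V →ₗ[ℝ] V) :
    α ∘ₗ A = ∑ a, α (b a) • (b.coord a ∘ₗ A) := by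
  ext v
  conv_lhs => rw [LinearMap.comp_apply, ← b.sum_repr (A v)]
  rw [LinearMap.sum_apply, map_sum]
  exact Finset.sum_congr rfl fun a _ => by simp [mul_comm]

/-- Moving α ∧ through a summand (e^a ∘ A) ∧ ι_{e_a} leaves the defect α(e_a)(e^a ∘ A) ∧, and these
defects add up to (α ∘ A) ∧. -/
theorem endActEnd_wedgeEnd (A : V →ₗ[ℝ] V) (α : Module.Dual ℝ V) (η : MixedForm V) :
    endActEnd A (wedgeEnd α η) = wedgeEnd α (endActEnd A η) + wedgeEnd (α ∘ₗ A) η := by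
  let b := Module.finBasis ℝ V
  rw [endActEnd_eq_sum b, endActEnd_eq_sum b, comp_eq_sum_coord b, map_sum, map_sum,
    LinearMap.sum_apply, ← Finset.sum_add_distrib]
  refine Finset.sum_congr rfl fun a _ => ?_
  rw [contractEnd_wedgeEnd, map_sub, map_smul, wedgeEnd_comm _ α, map_smul, LinearMap.smul_apply]
  abel

/-- Pull-back of forms of mixed degree. -/
noncomputable def mixedPull (S : W →L[ℝ] V) : MixedForm V →ₗ[ℝ] MixedForm W where
  toFun η k := (η k).compContinuousLinearMap S
  map_add' _ _ := rfl
  map_smul' _ _ := rfl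

theorem mixedPull_apply (S : W →L[ℝ] V) (η : MixedForm V) (k : ℕ) :
    mixedPull S η k = (η k).compContinuousLinearMap S := rfl

theorem mixedPull_injective (S : W ≃L[ℝ] V) :
    Function.Injective (mixedPull (S : W →L[ℝ] V)) := by
  intro η θ h
  funext k
  ext v
  have := congrArg (fun f => f (fun i => S.symm (v i))) (congrFun h k)
  simpa [mixedPull_apply, Function.comp_def] using this

theorem mixedPull_wedgeEnd (S : W →L[ℝ] V) (α : Module.Dual ℝ V) (η : MixedForm V) :
    mixedPull S (wedgeEnd α η) = wedgeEnd (α ∘ₗ S.toLinearMap) (mixedPull S η) := by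
  funext k
  cases k with
  | zero => rfl
  | succ k =>
    ext v
    change wedgeForm α (η k) (S ∘ v) = wedgeForm (α ∘ₗ S.toLinearMap) (mixedPull S η k) v
    rw [wedgeForm_apply, wedgeForm_apply]
    rfl

theorem mixedPull_contractEnd (S : W →L[ℝ] V) (w : W) (η : MixedForm V) :
    mixedPull S (contractEnd (S w) η) = contractEnd w (mixedPull S η) := by
  funext k
  ext v
  change η (k + 1) (Matrix.vecCons (S w) (S ∘ v)) = η (k + 1) (S ∘ Matrix.vecCons w v)
  congr 1
  funext j
  refine Fin.cases ?_ (fun j => ?_) j <;> simp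

/-! ### Bases, values and operators for elements of Λ^i V* ⊗ Λ^j V. -/

/-- The exterior algebra expansion of an element of degree one. -/
theorem iota_eq_sum {M : Type*} [AddCommGroup M] [Module ℝ M] (b : Module.Basis ι ℝ M) (x : M) :
    ExteriorAlgebra.ι ℝ x = ∑ a, b.repr x a • ExteriorAlgebra.ι ℝ (b a) := by
  conv_lhs => rw [← b.sum_repr x]
  simp only [map_sum, map_smul]

theorem iMulti_one_eq_sum {M : Type*} [AddCommGroup M] [Module ℝ M] (b : Module.Basis ι ℝ M)
    (x : Fin 1 → M) :
    exteriorPower.ιMulti ℝ 1 x = ∑ a, b.repr (x 0) a • exteriorPower.ιMulti ℝ 1 ![b a] := by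
  apply Subtype.ext
  rw [Submodule.coe_sum]
  simp only [Submodule.coe_smul, exteriorPower.ιMulti_apply_coe, ExteriorAlgebra.ιMulti_apply]
  simp [iota_eq_sum b (x 0)]

/-- The naive double expansion is averaged with its swap, so that the coefficients become 2 × 2
determinants, as produced by the determinant pairing. The factor 1/2 compensates for counting both
orders. -/
theorem iMulti_two_eq_sum {M : Type*} [AddCommGroup M] [Module ℝ M] (b : Module.Basis ι ℝ M)
    (x : Fin 2 → M) :
    exteriorPower.ιMulti ℝ 2 x = (2⁻¹ : ℝ) • ∑ a, ∑ c,
      (b.repr (x 0) a * b.repr (x 1) c - b.repr (x 0) c * b.repr (x 1) a) •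
        exteriorPower.ιMulti ℝ 2 ![b a, b c] := by
  have hx : exteriorPower.ιMulti ℝ 2 x = ∑ a, ∑ c,
      (b.repr (x 0) a * b.repr (x 1) c) • exteriorPower.ιMulti ℝ 2 ![b a, b c] := by
    apply Subtype.ext
    simp only [Submodule.coe_sum, Submodule.coe_smul, exteriorPower.ιMulti_apply_coe,
      ExteriorAlgebra.ιMulti_apply]
    simp [iota_eq_sum b (x 0), iota_eq_sum b (x 1), Finset.sum_mul_sum, smul_smul, mul_comm]
  have hsw : ∀ a c, exteriorPower.ιMulti ℝ 2 ![b a, b c] =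
      (-1 : ℝ) • exteriorPower.ιMulti ℝ 2 ![b c, b a] := fun a c => by
    apply Subtype.ext
    rw [Submodule.coe_smul]
    simp only [exteriorPower.ιMulti_apply_coe, ExteriorAlgebra.ιMulti_apply]
    have h := ExteriorAlgebra.ι_add_mul_swap (R := ℝ) (b a) (b c)
    simpa using eq_neg_of_add_eq_zero_left h
  have hx' : exteriorPower.ιMulti ℝ 2 x = ∑ a, ∑ c,
      (-(b.repr (x 0) c * b.repr (x 1) a)) • exteriorPower.ιMulti ℝ 2 ![b a, b c] := by
    rw [hx, Finset.sum_comm]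
    refine Finset.sum_congr rfl fun a _ => Finset.sum_congr rfl fun c _ => ?_
    rw [hsw c a, smul_smul, mul_neg_one]
  simp only [sub_eq_add_neg, add_smul, Finset.sum_add_distrib]
  rw [← hx, ← hx', ← two_smul ℝ, smul_smul]
  norm_num

theorem psiEval_tmul {i j : ℕ} (p : ⋀[ℝ]^i (Module.Dual ℝ V)) (q : ⋀[ℝ]^j V) (v : Fin i → V)
    (α : Fin j → Module.Dual ℝ V) :
    psiEval (p ⊗ₜ q : PsiFiber V i j) v α =
      exteriorPower.pairingDual ℝ V i p (exteriorPower.ιMulti ℝ i v) *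
        exteriorPower.pairingDual ℝ V j (exteriorPower.ιMulti ℝ j α) q := rfl

theorem psiEval_add {i j : ℕ} (ν μ : PsiFiber V i j) (v : Fin i → V)
    (α : Fin j → Module.Dual ℝ V) :
    psiEval (ν + μ) v α = psiEval ν v α + psiEval μ v α := by
  simp [psiEval]

theorem psiEval_smul {i j : ℕ} (c : ℝ) (ν : PsiFiber V i j) (v : Fin i → V)
    (α : Fin j → Module.Dual ℝ V) :
    psiEval (c • ν) v α = c * psiEval ν v α := by
  simp [psiEval]

theorem psiEval_zero {i j : ℕ} (v : Fin i → V) (α : Fin j → Module.Dual ℝ V) :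
    psiEval (0 : PsiFiber V i j) v α = 0 := by
  simp [psiEval]

theorem psiEval_sum {i j : ℕ} {κ : Type*} (s : Finset κ) (ν : κ → PsiFiber V i j) (v : Fin i → V)
    (α : Fin j → Module.Dual ℝ V) :
    psiEval (∑ l ∈ s, ν l) v α = ∑ l ∈ s, psiEval (ν l) v α := by
  simp [psiEval]

theorem psiEval_iMulti {i j : ℕ} (β : Fin i → Module.Dual ℝ V) (u : Fin j → V) (v : Fin i → V)
    (α : Fin j → Module.Dual ℝ V) :
    psiEval (exteriorPower.ιMulti ℝ i β ⊗ₜ exteriorPower.ιMulti ℝ j u : PsiFiber V i j) v α =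
      (Matrix.of fun a b => β b (v a)).det * (Matrix.of fun a b => α b (u a)).det := by
  rw [psiEval_tmul, exteriorPower.pairingDual_ιMulti_ιMulti,
    exteriorPower.pairingDual_ιMulti_ιMulti]

theorem psiFiber_induction {i j : ℕ} {P : PsiFiber V i j → Prop} (h0 : P 0)
    (hadd : ∀ x y, P x → P y → P (x + y)) (hsmul : ∀ (c : ℝ) x, P x → P (c • x))
    (hι : ∀ β u, P (exteriorPower.ιMulti ℝ i β ⊗ₜ exteriorPower.ιMulti ℝ j u)) (ν) : P ν := by
  induction ν using TensorProduct.induction_on with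
  | zero => exact h0
  | add x y hx hy => exact hadd x y hx hy
  | tmul p q =>
    have hp : p ∈ Submodule.span ℝ (Set.range (exteriorPower.ιMulti ℝ (M := Module.Dual ℝ V) i)) := by
      rw [exteriorPower.ιMulti_span]; trivial
    have hq : q ∈ Submodule.span ℝ (Set.range (exteriorPower.ιMulti ℝ (M := V) j)) := by
      rw [exteriorPower.ιMulti_span]; trivial
    induction hp using Submodule.span_induction with
    | zero => simpa using h0
    | add x y _ _ hx hy => rw [TensorProduct.add_tmul]; exact hadd _ _ hx hy
    | smul c x _ hx => rw [← TensorProduct.smul_tmul']; exact hsmul c _ hx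
    | mem x hx =>
      obtain ⟨β, rfl⟩ := hx
      induction hq using Submodule.span_induction with
      | zero => simpa using h0
      | add x y _ _ hx hy => rw [TensorProduct.tmul_add]; exact hadd _ _ hx hy
      | smul c x _ hx => rw [TensorProduct.tmul_smul]; exact hsmul c _ hx
      | mem x hx =>
        obtain ⟨u, rfl⟩ := hx
        exact hι β u

theorem psi_one_one_eq_sum [DecidableEq ι] (b : Module.Basis ι ℝ V) (ν : PsiFiber V 1 1) :
    ν = ∑ c, ∑ h, psiEval ν ![b c] ![b.coord h] •
      (exteriorPower.ιMulti ℝ 1 ![b.coord c] ⊗ₜ exteriorPower.ιMulti ℝ 1 ![b h]) := by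
  induction ν using psiFiber_induction with
  | h0 => simp [psiEval_zero]
  | hadd x y hx hy =>
    simp only [psiEval_add, add_smul, Finset.sum_add_distrib]
    rw [← hx, ← hy]
  | hsmul c x hx =>
    simp only [psiEval_smul, mul_smul, ← Finset.smul_sum]
    rw [← hx]
  | hι β u =>
    conv_lhs => rw [iMulti_one_eq_sum b.dualBasis, iMulti_one_eq_sum b u,
      TensorProduct.sum_tmul]
    refine Finset.sum_congr rfl fun c _ => ?_
    rw [TensorProduct.tmul_sum]
    refine Finset.sum_congr rfl fun h _ => ?_
    rw [psiEval_iMulti, TensorProduct.smul_tmul_smul]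
    simp

/-- By linearity it suffices to treat decomposable elements, where the coefficients of
`iMulti_two_eq_sum` are the determinants in the pairing. The factor 1/4 is one 1/2 for each side of
the tensor product. Uniqueness of Ric_{2,2} and the formula for its operator both follow. -/
theorem psi_two_two_eq_sum [DecidableEq ι] (b : Module.Basis ι ℝ V) (ν : PsiFiber V 2 2) :
    ν = (4⁻¹ : ℝ) • ∑ c, ∑ f, ∑ h, ∑ l, psiEval ν ![b c, b f] ![b.coord h, b.coord l] •
      (exteriorPower.ιMulti ℝ 2 ![b.coord c, b.coord f] ⊗ₜ
        exteriorPower.ιMulti ℝ 2 ![b h, b l]) := by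
  induction ν using psiFiber_induction with
  | h0 => simp [psiEval_zero]
  | hadd x y hx hy =>
    simp only [psiEval_add, add_smul, Finset.sum_add_distrib, smul_add]
    rw [← hx, ← hy]
  | hsmul c x hx =>
    simp only [psiEval_smul, mul_smul, ← Finset.smul_sum]
    rw [smul_comm, ← hx]
  | hι β u =>
    conv_lhs => rw [iMulti_two_eq_sum b.dualBasis, iMulti_two_eq_sum b u,
      TensorProduct.smul_tmul_smul, TensorProduct.sum_tmul]
    rw [show (2⁻¹ : ℝ) * 2⁻¹ = 4⁻¹ by norm_num]
    congr 1
    refine Finset.sum_congr rfl fun c _ => ?_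
    rw [TensorProduct.sum_tmul]
    refine Finset.sum_congr rfl fun f _ => ?_
    rw [TensorProduct.tmul_sum]
    refine Finset.sum_congr rfl fun h _ => ?_
    rw [TensorProduct.tmul_sum]
    refine Finset.sum_congr rfl fun l _ => ?_
    rw [psiEval_iMulti, TensorProduct.smul_tmul_smul]
    simp [Matrix.det_fin_two, mul_comm (β 1 (b c))]

theorem psi_one_one_ext {ν μ : PsiFiber V 1 1}
    (h : ∀ v α, psiEval ν ![v] ![α] = psiEval μ ![v] ![α]) : ν = μ := by
  rw [psi_one_one_eq_sum (Module.finBasis ℝ V) ν, psi_one_one_eq_sum (Module.finBasis ℝ V) μ]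
  simp only [h]

theorem psi_two_two_ext {ν μ : PsiFiber V 2 2}
    (h : ∀ v w α β, psiEval ν ![v, w] ![α, β] = psiEval μ ![v, w] ![α, β]) : ν = μ := by
  rw [psi_two_two_eq_sum (Module.finBasis ℝ V) ν, psi_two_two_eq_sum (Module.finBasis ℝ V) μ]
  simp only [h]

theorem creation_iMulti_one (α : Module.Dual ℝ V) :
    creation (V := V) (exteriorPower.ιMulti ℝ 1 ![α] : ⋀[ℝ]^1 (Module.Dual ℝ V)) = wedgeEnd α := by
  simp [creation, exteriorPower.ιMulti_apply_coe, ExteriorAlgebra.ιMulti_apply]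

theorem creation_iMulti_two (α β : Module.Dual ℝ V) :
    creation (V := V) (exteriorPower.ιMulti ℝ 2 ![α, β] : ⋀[ℝ]^2 (Module.Dual ℝ V)) =
      wedgeEnd α * wedgeEnd β := by
  rw [exteriorPower.ιMulti_apply_coe, ExteriorAlgebra.ιMulti_apply]
  simp [creation]

theorem annihilation_iMulti_one (X : V) :
    (annihilation (exteriorPower.ιMulti ℝ 1 ![X] : ⋀[ℝ]^1 V)).unop = contractEnd X := by
  simp [annihilation, exteriorPower.ιMulti_apply_coe, ExteriorAlgebra.ιMulti_apply]

theorem annihilation_iMulti_two (X Y : V) :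
    (annihilation (exteriorPower.ιMulti ℝ 2 ![X, Y] : ⋀[ℝ]^2 V)).unop =
      contractEnd Y * contractEnd X := by
  rw [exteriorPower.ιMulti_apply_coe, ExteriorAlgebra.ιMulti_apply]
  simp [annihilation]

theorem fermion_psiIncl_tmul {i j : ℕ} (p : ⋀[ℝ]^i (Module.Dual ℝ V)) (q : ⋀[ℝ]^j V)
    (η : MixedForm V) :
    fermion (psiIncl (p ⊗ₜ q : PsiFiber V i j)) η =
      creation (p : ExteriorAlgebra ℝ (Module.Dual ℝ V)) ((annihilation (q : ExteriorAlgebra ℝ V)).unop η) :=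
  rfl

theorem fermion_psiIncl_one_one (b : Module.Basis ι ℝ V) (ν : PsiFiber V 1 1) (η : MixedForm V) :
    fermion (psiIncl ν) η = ∑ c, ∑ h, psiEval ν ![b c] ![b.coord h] •
      wedgeEnd (b.coord c) (contractEnd (b h) η) := by
  classical
  conv_lhs => rw [psi_one_one_eq_sum b ν]
  simp only [map_sum, map_smul, LinearMap.sum_apply, LinearMap.smul_apply]
  refine Finset.sum_congr rfl fun c _ => Finset.sum_congr rfl fun h _ => ?_
  rw [fermion_psiIncl_tmul, creation_iMulti_one, annihilation_iMulti_one]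

theorem fermion_psiIncl_two_two (b : Module.Basis ι ℝ V) (ν : PsiFiber V 2 2) (η : MixedForm V) :
    fermion (psiIncl ν) η = (4⁻¹ : ℝ) • ∑ c, ∑ f, ∑ h, ∑ l,
      psiEval ν ![b c, b f] ![b.coord h, b.coord l] •
        wedgeEnd (b.coord c) (wedgeEnd (b.coord f) (contractEnd (b l) (contractEnd (b h) η))) := by
  classical
  have hterm : ∀ c f h l, fermion (psiIncl (exteriorPower.ιMulti ℝ 2 ![b.coord c, b.coord f] ⊗ₜ
      exteriorPower.ιMulti ℝ 2 ![b h, b l] : PsiFiber V 2 2)) η =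
        wedgeEnd (b.coord c) (wedgeEnd (b.coord f) (contractEnd (b l) (contractEnd (b h) η))) := by
    intro c f h l
    rw [fermion_psiIncl_tmul, creation_iMulti_two, annihilation_iMulti_two]
    rfl
  let F : PsiFiber V 2 2 →ₗ[ℝ] MixedForm V := LinearMap.applyₗ η ∘ₗ fermion ∘ₗ psiIncl
  have hF : ∀ ν, fermion (psiIncl ν) η = F ν := fun _ => rfl
  simp only [hF] at hterm ⊢
  conv_lhs => rw [psi_two_two_eq_sum b ν]
  simp only [map_sum, map_smul, hterm]

/-- A bilinear pairing of vectors and covectors comes from an element of `V* ⊗ V`. -/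
theorem exists_psi_one_one (r : V →ₗ[ℝ] V) :
    ∃ ν : PsiFiber V 1 1, ∀ v α, psiEval ν ![v] ![α] = α (r v) := by
  let b := Module.finBasis ℝ V
  refine ⟨∑ c, exteriorPower.ιMulti ℝ 1 ![b.coord c] ⊗ₜ exteriorPower.ιMulti ℝ 1 ![r (b c)],
    fun v α => ?_⟩
  rw [psiEval_sum]
  simp only [psiEval_iMulti]
  conv_rhs => rw [← b.sum_repr v, map_sum, map_sum]
  simp [-Module.Basis.sum_repr]

/-- Skewness in each pair is exactly what makes the four terms in the product of two determinants
agree up to the right signs. -/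
theorem exists_psi_two_two (r : V →ₗ[ℝ] V →ₗ[ℝ] Module.Dual ℝ V →ₗ[ℝ] Module.Dual ℝ V →ₗ[ℝ] ℝ)
    (h₁ : ∀ v w α β, r v w α β = -r w v α β) (h₂ : ∀ v w α β, r v w α β = -r v w β α) :
    ∃ ν : PsiFiber V 2 2, ∀ v w α β, psiEval ν ![v, w] ![α, β] = r v w α β := by
  let b := Module.finBasis ℝ V
  refine ⟨(4⁻¹ : ℝ) • ∑ l, ∑ h, ∑ f, ∑ c, r (b c) (b f) (b.coord h) (b.coord l) •
      (exteriorPower.ιMulti ℝ 2 ![b.coord c, b.coord f] ⊗ₜ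
        exteriorPower.ιMulti ℝ 2 ![b h, b l]), fun v w α β => ?_⟩
  have key : ∀ v w α β, r v w α β = ∑ l, ∑ h, ∑ f, ∑ c, r (b c) (b f) (b.coord h) (b.coord l) *
      (b.repr v c * b.repr w f * (α (b h) * β (b l))) := by
    intro v w α β
    have hα : ∀ α : Module.Dual ℝ V, α = ∑ h, α (b h) • b.coord h := fun α => by
      conv_lhs => rw [← LinearMap.comp_id α, comp_eq_sum_coord b]
      rfl
    conv_lhs => rw [← b.sum_repr v, ← b.sum_repr w, hα α, hα β]
    simp only [map_sum, map_smul, LinearMap.sum_apply, LinearMap.smul_apply, smul_eq_mul,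
      Finset.mul_sum]
    refine Finset.sum_congr rfl fun l _ => Finset.sum_congr rfl fun h _ =>
      Finset.sum_congr rfl fun f _ => Finset.sum_congr rfl fun c _ => ?_
    ring
  have e1 := key v w α β
  have e2 := key w v α β
  have e3 := key v w β α
  have e4 := key w v β α
  rw [psiEval_smul, psiEval_sum]
  simp only [psiEval_sum, psiEval_smul, psiEval_iMulti, Matrix.det_fin_two, Matrix.of_apply,
    Matrix.cons_val_zero, Matrix.cons_val_one, Module.Basis.coord_apply]
  -- Evaluating the witness produces the alternation of r over both pairs, which by skewness is four
  -- times r.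
  have : (4 : ℝ) * r v w α β = r v w α β - r w v α β - r v w β α + r w v β α := by
    rw [h₁ w v β α, h₂ v w β α, h₁ w v α β]; ring
  rw [inv_mul_eq_iff_eq_mul₀ (by norm_num), this, e1, e2, e3, e4]
  simp only [← Finset.sum_sub_distrib, ← Finset.sum_add_distrib]
  refine Finset.sum_congr rfl fun c _ => Finset.sum_congr rfl fun f _ =>
    Finset.sum_congr rfl fun h _ => Finset.sum_congr rfl fun l _ => ?_
  ring

end FiberAlgebra

/-! ### The pointwise Weitzenböck identity as linear algebra. -/

section WeitzenboeckAlgebra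

variable {V : Type*} [AddCommGroup V] [Module ℝ V] [TopologicalSpace V]
  [IsTopologicalAddGroup V] [ContinuousSMul ℝ V] [T2Space V] [FiniteDimensional ℝ V]
  {ι : Type*} [Fintype ι]

theorem mixedForm_sub_smul (r s : ℝ) (η : MixedForm V) : (r - s) • η = r • η - s • η :=
  sub_smul r s η

theorem mixedForm_neg_smul (r : ℝ) (η : MixedForm V) : -r • η = -(r • η) :=
  neg_smul r η

theorem sum_coord_smul {N : Type*} [AddCommGroup N] [Module ℝ N] (b : Module.Basis ι ℝ V)
    (Q : V →ₗ[ℝ] N) (X : V) : ∑ c, b.coord c X • Q (b c) = Q X := by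
  conv_rhs => rw [← b.sum_repr X, map_sum]
  simp only [map_smul, Module.Basis.coord_apply]

/-- `Q ↦ ∑ e^c ∧ Q(e_c)`, the symbol of the exterior derivative. -/
noncomputable def wedgeSum (b : Module.Basis ι ℝ V) :
    (V →ₗ[ℝ] MixedForm V) →ₗ[ℝ] MixedForm V where
  toFun Q := ∑ c, wedgeEnd (b.coord c) (Q (b c))
  map_add' Q Q' := by simp [Finset.sum_add_distrib]
  map_smul' r Q := by simp [Finset.smul_sum]

theorem wedgeSum_apply (b : Module.Basis ι ℝ V) (Q : V →ₗ[ℝ] MixedForm V) :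
    wedgeSum b Q = ∑ c, wedgeEnd (b.coord c) (Q (b c)) := rfl

/-- Sum `contractEnd_wedgeEnd` over the basis: the scalar terms e^c(X) Q(e_c) recombine to Q(X).
This is how a contraction passes the symbol of d. -/
theorem wedgeSum_contractEnd (b : Module.Basis ι ℝ V) (X : V) (Q : V →ₗ[ℝ] MixedForm V) :
    wedgeSum b (contractEnd X ∘ₗ Q) = Q X - contractEnd X (wedgeSum b Q) := by
  rw [eq_sub_iff_add_eq, wedgeSum_apply, wedgeSum_apply, map_sum, ← Finset.sum_add_distrib]
  rw [← sum_coord_smul b Q X]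
  refine Finset.sum_congr rfl fun c _ => ?_
  rw [contractEnd_wedgeEnd, LinearMap.comp_apply]
  abel

theorem dual_eq_sum (b : Module.Basis ι ℝ V) (α : Module.Dual ℝ V) :
    α = ∑ c, α (b c) • b.coord c := by
  classical
  refine b.ext fun c => ?_
  simp

/-- The tensors Σ (e^c ∘ A) ⊗ e_c and Σ e^f ⊗ A e_f both represent A. -/
theorem sum_wedgeEnd_comp (b : Module.Basis ι ℝ V) (A : V →ₗ[ℝ] V) (Q : V →ₗ[ℝ] MixedForm V) :
    ∑ c, wedgeEnd (b.coord c ∘ₗ A) (Q (b c)) = wedgeSum b (Q ∘ₗ A) := by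
  have h1 : ∀ c, wedgeEnd (b.coord c ∘ₗ A) (Q (b c)) =
      ∑ f, b.coord c (A (b f)) • wedgeEnd (b.coord f) (Q (b c)) := fun c => by
    rw [dual_eq_sum b (b.coord c ∘ₗ A)]
    simp only [map_sum, map_smul, LinearMap.sum_apply, LinearMap.smul_apply, LinearMap.comp_apply]
  have h2 : ∀ f, wedgeEnd (b.coord f) ((Q ∘ₗ A) (b f)) =
      ∑ c, b.coord c (A (b f)) • wedgeEnd (b.coord f) (Q (b c)) := fun f => by
    rw [LinearMap.comp_apply, ← sum_coord_smul b Q (A (b f))]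
    simp only [map_sum, map_smul]
  rw [wedgeSum_apply]
  simp only [h1, h2]
  exact Finset.sum_comm

theorem endActEnd_wedgeSum (b : Module.Basis ι ℝ V) (A : V →ₗ[ℝ] V) (Q : V →ₗ[ℝ] MixedForm V) :
    endActEnd A (wedgeSum b Q) = wedgeSum b (endActEnd A ∘ₗ Q) + wedgeSum b (Q ∘ₗ A) := by
  rw [← sum_wedgeEnd_comp, wedgeSum_apply, wedgeSum_apply, map_sum, ← Finset.sum_add_distrib]
  exact Finset.sum_congr rfl fun c _ => endActEnd_wedgeEnd _ _ _

theorem wedgeSum_contractEnd_apply (b : Module.Basis ι ℝ V) (A : V →ₗ[ℝ] V) (η : MixedForm V) :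
    wedgeSum b ((contractEnd (V := V)).flip η ∘ₗ A) = endActEnd A η := by
  rw [endActEnd_eq_sum b, ← sum_wedgeEnd_comp]
  rfl

/-- Both sides pair ξ with the tensor Σ e^c(G_a) e_a ⊗ e_c, which is symmetric. -/
theorem trace_symm {N : Type*} [AddCommGroup N] [Module ℝ N] (b : Module.Basis ι ℝ V) (G : ι → V)
    (hG : ∀ a c, b.coord a (G c) = b.coord c (G a)) (ξ : V →ₗ[ℝ] V →ₗ[ℝ] N) :
    ∑ a, ξ (b a) (G a) = ∑ a, ξ (G a) (b a) := by
  have h1 : ∀ a, ξ (b a) (G a) = ∑ c, b.coord c (G a) • ξ (b a) (b c) := fun a =>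
    (sum_coord_smul b (ξ (b a)) (G a)).symm
  have h2 : ∀ c, ξ (G c) (b c) = ∑ a, b.coord a (G c) • ξ (b a) (b c) := fun c =>
    (sum_coord_smul b (ξ.flip (b c)) (G c)).symm
  simp only [h1, h2]
  rw [Finset.sum_comm]
  simp only [hG]

/-- The pointwise form of the Weitzenböck identity: `F`, `F₁`, `F₂` are the derivatives of a form,
`Γ` and `Γ₁` those of the Christoffel symbols, `G` the cometric and `G₁` its derivative. -/
theorem weitzenboeck_pointwise (b : Module.Basis ι ℝ V) (G : ι → V)
    (hG : ∀ a c, b.coord a (G c) = b.coord c (G a))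
    (Γ : V →ₗ[ℝ] V →ₗ[ℝ] V) (Γ₁ : V →ₗ[ℝ] V →ₗ[ℝ] V →ₗ[ℝ] V) (G₁ : ι → V →ₗ[ℝ] V)
    (hG₁ : ∀ a v, G₁ a v = -Γ (G a) v - ∑ d, b.coord a (Γ (b d) v) • G d)
    (F : MixedForm V) (F₁ : V →ₗ[ℝ] MixedForm V) (F₂ : V →ₗ[ℝ] V →ₗ[ℝ] MixedForm V)
    (hF₂ : ∀ v w, F₂ v w = F₂ w v) :
    (∑ c, wedgeEnd (b.coord c) (∑ a, contractEnd (b a) (F₂ (b c) (G a) + F₁ (G₁ a (b c)) -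
        endActEnd (Γ (G₁ a (b c))) F - endActEnd (Γ₁ (b c) (G a)) F -
        endActEnd (Γ (G a)) (F₁ (b c))))) +
      ∑ a, contractEnd (b a) (∑ c, wedgeEnd (b.coord c) (F₂ (G a) (b c)) -
        endActEnd (Γ (G a)) (∑ c, wedgeEnd (b.coord c) (F₁ (b c)))) =
    ∑ a, (F₂ (b a) (G a) - endActEnd (Γ₁ (b a) (G a)) F - endActEnd (Γ (G a)) (F₁ (b a)) -
        endActEnd (Γ (b a)) (F₁ (G a) - endActEnd (Γ (G a)) F) -
        (F₁ (Γ (b a) (G a)) - endActEnd (Γ (Γ (b a) (G a))) F)) +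
      ∑ a, contractEnd (b a) (∑ c, wedgeEnd (b.coord c)
        (endActEnd (Γ₁ (b c) (G a) - Γ (Γ (G a) (b c))) F)) := by
  let E : V →ₗ[ℝ] Module.End ℝ (MixedForm V) := endActEnd ∘ₗ Γ
  -- D is the covariant derivative of the form at the point.
  let D : V →ₗ[ℝ] MixedForm V := F₁ - E.flip F
  have hD : ∀ v, D v = F₁ v - endActEnd (Γ v) F := fun v => rfl
  have hsym : ∑ a, D (Γ (b a) (G a)) = ∑ a, D (Γ (G a) (b a)) :=
    trace_symm b G hG (Γ.compr₂ D)
  let E₁ : ι → V →ₗ[ℝ] MixedForm V := fun a => (endActEnd.flip F) ∘ₗ Γ₁.flip (G a)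
  have hE₁ : ∀ a v, E₁ a v = endActEnd (Γ₁ v (G a)) F := fun a v => rfl
  -- The only use of parallelism. In the double sum, exchanging the indices transfers Γ(·)v from the
  -- coefficient to the contracted vector.
  have hpar : ∀ v, ∑ a, contractEnd (b a) (D (G₁ a v)) =
      -∑ a, contractEnd (b a) (D (Γ (G a) v)) - ∑ a, contractEnd (Γ (b a) v) (D (G a)) := by
    intro v
    have h : ∀ a, contractEnd (b a) (D (G₁ a v)) = -contractEnd (b a) (D (Γ (G a) v)) -
        ∑ d, b.coord a (Γ (b d) v) • contractEnd (b a) (D (G d)) := fun a => by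
      simp only [hG₁, map_sub, map_neg, map_sum, map_smul]
    have h2 : ∀ d, contractEnd (Γ (b d) v) (D (G d)) =
        ∑ a, b.coord a (Γ (b d) v) • contractEnd (b a) (D (G d)) := fun d =>
      (sum_coord_smul b ((contractEnd (V := V)).flip (D (G d))) _).symm
    simp only [h, h2, Finset.sum_sub_distrib, Finset.sum_neg_distrib]
    congr 1
    exact Finset.sum_comm
  -- The part −dδ, with `hpar` substituted below the exterior product. The two derivatives of G_a in
  -- it combine into D(∂G_a).
  have hfirst : (∑ c, wedgeEnd (b.coord c) (∑ a, contractEnd (b a) (F₂ (b c) (G a) +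
        F₁ (G₁ a (b c)) - endActEnd (Γ (G₁ a (b c))) F - endActEnd (Γ₁ (b c) (G a)) F -
        endActEnd (Γ (G a)) (F₁ (b c))))) =
      ∑ a, (wedgeSum b (contractEnd (b a) ∘ₗ F₂.flip (G a)) -
        wedgeSum b (contractEnd (b a) ∘ₗ D ∘ₗ Γ (G a)) -
        wedgeSum b ((contractEnd (V := V)).flip (D (G a)) ∘ₗ Γ (b a)) -
        wedgeSum b (contractEnd (b a) ∘ₗ E₁ a) -
        wedgeSum b (contractEnd (b a) ∘ₗ endActEnd (Γ (G a)) ∘ₗ F₁)) := by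
    simp only [wedgeSum_apply, ← Finset.sum_sub_distrib, ← map_sub]
    rw [Finset.sum_comm]
    refine Finset.sum_congr rfl fun c _ => ?_
    rw [← map_sum]
    congr 1
    have h := hpar (b c)
    have h' : ∀ a, contractEnd (b a) (F₂ (b c) (G a) + F₁ (G₁ a (b c)) -
        endActEnd (Γ (G₁ a (b c))) F - endActEnd (Γ₁ (b c) (G a)) F -
        endActEnd (Γ (G a)) (F₁ (b c))) = contractEnd (b a) (F₂ (b c) (G a)) +
        contractEnd (b a) (D (G₁ a (b c))) - contractEnd (b a) (E₁ a (b c)) -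
        contractEnd (b a) (endActEnd (Γ (G a)) (F₁ (b c))) := fun a => by
      rw [hD, hE₁]
      simp only [map_sub, map_add]
      abel
    simp only [h', Finset.sum_sub_distrib, Finset.sum_add_distrib, h, LinearMap.comp_apply,
      LinearMap.flip_apply]
    abel
  have hsecond : ∀ a, contractEnd (b a) (∑ c, wedgeEnd (b.coord c) (F₂ (G a) (b c)) -
        endActEnd (Γ (G a)) (∑ c, wedgeEnd (b.coord c) (F₁ (b c)))) =
      contractEnd (b a) (wedgeSum b (F₂.flip (G a))) -
        contractEnd (b a) (wedgeSum b (endActEnd (Γ (G a)) ∘ₗ F₁)) -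
        contractEnd (b a) (wedgeSum b (F₁ ∘ₗ Γ (G a))) := fun a => by
    rw [← wedgeSum_apply, ← wedgeSum_apply, endActEnd_wedgeSum, map_sub, map_add, sub_sub]
    congr 2
    simp only [wedgeSum_apply, LinearMap.flip_apply, hF₂ (G a)]
  have hlast : ∀ a, contractEnd (b a) (∑ c, wedgeEnd (b.coord c)
        (endActEnd (Γ₁ (b c) (G a) - Γ (Γ (G a) (b c))) F)) =
      contractEnd (b a) (wedgeSum b (E₁ a)) + contractEnd (b a) (wedgeSum b (D ∘ₗ Γ (G a))) -
        contractEnd (b a) (wedgeSum b (F₁ ∘ₗ Γ (G a))) := fun a => by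
    rw [← map_add, ← map_sub, ← map_add, ← map_sub, wedgeSum_apply]
    refine congrArg _ (Finset.sum_congr rfl fun c _ => congrArg _ ?_)
    simp only [LinearMap.add_apply, LinearMap.sub_apply, LinearMap.comp_apply, hD, hE₁, map_sub]
    abel
  have hhess : ∀ a, (F₂ (b a) (G a) - endActEnd (Γ₁ (b a) (G a)) F - endActEnd (Γ (G a)) (F₁ (b a)) -
        endActEnd (Γ (b a)) (F₁ (G a) - endActEnd (Γ (G a)) F) -
        (F₁ (Γ (b a) (G a)) - endActEnd (Γ (Γ (b a) (G a))) F)) =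
      (F₂ (b a) (G a) - E₁ a (b a) - endActEnd (Γ (G a)) (F₁ (b a)) -
        endActEnd (Γ (b a)) (D (G a))) - D (Γ (b a) (G a)) := fun a => rfl
  rw [hfirst, Finset.sum_congr rfl fun a _ => hsecond a, Finset.sum_congr rfl fun a _ => hlast a,
    Finset.sum_congr rfl fun a _ => hhess a, Finset.sum_sub_distrib _ (fun a => D (Γ (b a) (G a))),
    hsym, ← Finset.sum_sub_distrib, ← Finset.sum_add_distrib, ← Finset.sum_add_distrib]
  refine Finset.sum_congr rfl fun a _ => ?_
  -- Each term Σ e^c ∧ ι_{e_a} Q(e_c) splits into Q(e_a) and −ι_{e_a} Σ e^c ∧ Q(e_c). The values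
  -- Q(e_a) assemble the Hessian, together with the action of Γ(e_a) on D(G_a) from the term with
  -- contracted vector Γ(e_a)e_c. The contracted sums, added to those in `hsecond`, leave the
  -- remainder.
  rw [wedgeSum_contractEnd, wedgeSum_contractEnd, wedgeSum_contractEnd, wedgeSum_contractEnd,
    wedgeSum_contractEnd_apply]
  simp only [LinearMap.comp_apply, LinearMap.flip_apply]
  abel

/-- Since e^c ∧ e^f is skew, only the antisymmetrization of K(e_c)e_f contributes, and 1/2 is the
weight of the average over the two orders. -/
theorem wedgeSum_endActEnd (b : Module.Basis ι ℝ V) (K : V →ₗ[ℝ] V →ₗ[ℝ] V) (F : MixedForm V) :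
    ∑ c, wedgeEnd (b.coord c) (endActEnd (K (b c)) F) =
      (2⁻¹ : ℝ) • ∑ c, ∑ f, ∑ h, b.coord h (K (b c) (b f) - K (b f) (b c)) •
        wedgeEnd (b.coord c) (wedgeEnd (b.coord f) (contractEnd (b h) F)) := by
  have h1 : ∑ c, wedgeEnd (b.coord c) (endActEnd (K (b c)) F) = ∑ c, ∑ f, ∑ h,
      b.coord h (K (b c) (b f)) •
        wedgeEnd (b.coord c) (wedgeEnd (b.coord f) (contractEnd (b h) F)) := by
    refine Finset.sum_congr rfl fun c _ => ?_
    rw [← wedgeSum_contractEnd_apply b, wedgeSum_apply, map_sum]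
    refine Finset.sum_congr rfl fun f _ => ?_
    rw [LinearMap.comp_apply, ← sum_coord_smul b _ (K (b c) (b f)), map_sum, map_sum]
    simp only [map_smul, LinearMap.flip_apply]
  have h2 : ∑ c, wedgeEnd (b.coord c) (endActEnd (K (b c)) F) = -∑ c, ∑ f, ∑ h,
      b.coord h (K (b f) (b c)) •
        wedgeEnd (b.coord c) (wedgeEnd (b.coord f) (contractEnd (b h) F)) := by
    rw [h1, Finset.sum_comm, ← Finset.sum_neg_distrib]
    refine Finset.sum_congr rfl fun c _ => ?_
    rw [← Finset.sum_neg_distrib]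
    refine Finset.sum_congr rfl fun f _ => ?_
    rw [← Finset.sum_neg_distrib]
    refine Finset.sum_congr rfl fun h _ => ?_
    rw [wedgeEnd_comm, smul_neg]
  have h3 : (∑ c, ∑ f, ∑ h, b.coord h (K (b c) (b f) - K (b f) (b c)) •
      wedgeEnd (b.coord c) (wedgeEnd (b.coord f) (contractEnd (b h) F))) =
      (2 : ℝ) • ∑ c, wedgeEnd (b.coord c) (endActEnd (K (b c)) F) := by
    simp only [map_sub, mixedForm_sub_smul, Finset.sum_sub_distrib]
    rw [two_smul]
    nth_rw 1 [← h1]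
    rw [h2]
    abel
  rw [h3, smul_smul]
  norm_num

/-- The contraction meets e^c, then e^f, then the form. The first two contributions coincide by
skewness and cancel the factor 1/2. When the antisymmetrization of K is R̂(·,·)G_a, the two sums on
the right are the a-th parts of −Ric_{1,1} and −Ric_{2,2}. -/
theorem contractEnd_wedgeSum_endActEnd [DecidableEq ι] (b : Module.Basis ι ℝ V)
    (K : V →ₗ[ℝ] V →ₗ[ℝ] V) (F : MixedForm V) (a : ι) :
    contractEnd (b a) (∑ c, wedgeEnd (b.coord c) (endActEnd (K (b c)) F)) =
      (∑ c, ∑ h, b.coord h (K (b a) (b c) - K (b c) (b a)) •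
        wedgeEnd (b.coord c) (contractEnd (b h) F)) +
      (2⁻¹ : ℝ) • ∑ c, ∑ f, ∑ h, b.coord h (K (b c) (b f) - K (b f) (b c)) •
        wedgeEnd (b.coord c) (wedgeEnd (b.coord f) (contractEnd (b a) (contractEnd (b h) F))) := by
  have hδ : ∀ c, b.coord c (b a) = if c = a then (1 : ℝ) else 0 := fun c => by
    simp [Finsupp.single_apply, eq_comm]
  have hterm : ∀ c f (X : MixedForm V), contractEnd (b a) (wedgeEnd (b.coord c)
      (wedgeEnd (b.coord f) X)) = b.coord c (b a) • wedgeEnd (b.coord f) X -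
        b.coord f (b a) • wedgeEnd (b.coord c) X +
        wedgeEnd (b.coord c) (wedgeEnd (b.coord f) (contractEnd (b a) X)) := fun c f X => by
    rw [contractEnd_wedgeEnd, contractEnd_wedgeEnd, map_sub, map_smul]
    abel
  rw [wedgeSum_endActEnd]
  simp only [map_smul, map_sum, hterm, smul_add, smul_sub, Finset.sum_add_distrib,
    Finset.sum_sub_distrib, hδ, ite_smul, one_smul, zero_smul, smul_ite, smul_zero]
  congr 1
  have e1 : (∑ c, ∑ f, ∑ h, if c = a then b.coord h (K (b c) (b f) - K (b f) (b c)) •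
      wedgeEnd (b.coord f) (contractEnd (b h) F) else 0) =
      ∑ c, ∑ h, b.coord h (K (b a) (b c) - K (b c) (b a)) •
        wedgeEnd (b.coord c) (contractEnd (b h) F) := by
    rw [Finset.sum_eq_single a (fun c _ hc => by simp [hc]) (by simp)]
    simp
  have e2 : (∑ c, ∑ f, ∑ h, if f = a then b.coord h (K (b c) (b f) - K (b f) (b c)) •
      wedgeEnd (b.coord c) (contractEnd (b h) F) else 0) =
      -∑ c, ∑ h, b.coord h (K (b a) (b c) - K (b c) (b a)) •
        wedgeEnd (b.coord c) (contractEnd (b h) F) := by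
    rw [← Finset.sum_neg_distrib]
    refine Finset.sum_congr rfl fun c _ => ?_
    rw [Finset.sum_eq_single a (fun f _ hf => by simp [hf]) (by simp), ← Finset.sum_neg_distrib]
    refine Finset.sum_congr rfl fun h _ => ?_
    rw [if_pos rfl, ← mixedForm_neg_smul, ← map_neg, neg_sub]
  rw [e1, e2, ← smul_sub, sub_neg_eq_add, ← two_smul ℝ, smul_smul]
  norm_num

end WeitzenboeckAlgebra

/-! ### Tangent vectors, functions and forms in an arbitrary preferred chart. -/

section Charts

open Topology

variable {E : Type*} [NormedAddCommGroup E] [NormedSpace ℝ E]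
  {M : Type*} [TopologicalSpace M] [ChartedSpace E M]
  [FiniteDimensional ℝ E] [IsManifold 𝓘(ℝ, E) ∞ M]
  {F : Type*} [NormedAddCommGroup F] [NormedSpace ℝ F] {k : ℕ}

/-- The coordinates of a tangent vector in the preferred chart at `x₀`. -/
noncomputable def toModel (x₀ y : M) : TangentSpace 𝓘(ℝ, E) y →L[ℝ] E :=
  (trivializationAt E (TangentSpace 𝓘(ℝ, E)) x₀).continuousLinearMapAt ℝ y

/-- The tangent vector with given coordinates in the preferred chart at `x₀`. -/
noncomputable def ofModel (x₀ y : M) : E →L[ℝ] TangentSpace 𝓘(ℝ, E) y :=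
  (trivializationAt E (TangentSpace 𝓘(ℝ, E)) x₀).symmL ℝ y

theorem toModel_ofModel {x₀ y : M} (hy : y ∈ (chartAt E x₀).source) (w : E) :
    toModel x₀ y (ofModel x₀ y w) = w :=
  (trivializationAt E (TangentSpace 𝓘(ℝ, E)) x₀).continuousLinearMapAt_symmL hy w

theorem ofModel_toModel {x₀ y : M} (hy : y ∈ (chartAt E x₀).source) (v : TangentSpace 𝓘(ℝ, E) y) :
    ofModel x₀ y (toModel x₀ y v) = v :=
  (trivializationAt E (TangentSpace 𝓘(ℝ, E)) x₀).symmL_continuousLinearMapAt hy v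

/-- `toModel` and `ofModel` as mutually inverse isomorphisms. -/
noncomputable def modelEquiv {x₀ y : M} (hy : y ∈ (chartAt E x₀).source) :
    E ≃L[ℝ] TangentSpace 𝓘(ℝ, E) y :=
  ContinuousLinearEquiv.equivOfInverse (ofModel x₀ y) (toModel x₀ y) (toModel_ofModel hy)
    (ofModel_toModel hy)

/-- The coordinate expression of a vector field. -/
noncomputable def fieldInChart (x₀ : M) (W : VField E M) (e : E) : E :=
  toModel x₀ ((chartAt E x₀).symm e) (W ((chartAt E x₀).symm e))

/-- The vector field with constant coordinates `w`. -/
noncomputable def coordField (x₀ : M) (w : E) : VField E M := fun y => ofModel x₀ y w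

theorem formInChart_apply (x₀ : M) (η : KForm E M k) (e : E) (v : Fin k → E) :
    formInChart x₀ η e v =
      η ((chartAt E x₀).symm e) (fun i => ofModel x₀ ((chartAt E x₀).symm e) (v i)) := rfl

/-- The chart is centred at x₀, not at y, so that regularity at all points near x₀ can be tested in
one and the same chart. -/
theorem contMDiffAt_iff_comp_symm {n : ℕ∞} {x₀ y : M} (hy : y ∈ (chartAt E x₀).source)
    (f : M → F) : ContMDiffAt 𝓘(ℝ, E) 𝓘(ℝ, F) n f y ↔
      ContDiffAt ℝ n (fun e => f ((chartAt E x₀).symm e)) (chartAt E x₀ y) := by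
  have hm : IsManifold 𝓘(ℝ, E) n M := IsManifold.of_le (n := ∞) (by exact_mod_cast le_top)
  rw [← contMDiffAt_iff_contDiffAt]
  constructor
  · intro h
    have h2 : ContMDiffAt 𝓘(ℝ, E) 𝓘(ℝ, E) n (chartAt E x₀).symm (chartAt E x₀ y) :=
      contMDiffAt_symm_of_mem_maximalAtlas (IsManifold.chart_mem_maximalAtlas x₀)
        ((chartAt E x₀).map_source hy)
    refine ContMDiffAt.comp (chartAt E x₀ y) (g := f) ?_ h2
    rwa [(chartAt E x₀).left_inv hy]
  · intro h
    have h2 : ContMDiffAt 𝓘(ℝ, E) 𝓘(ℝ, E) n (chartAt E x₀) y :=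
      contMDiffAt_of_mem_maximalAtlas (IsManifold.chart_mem_maximalAtlas x₀) hy
    refine (ContMDiffAt.comp y h h2).congr_of_eventuallyEq ?_
    filter_upwards [(chartAt E x₀).open_source.mem_nhds hy] with z hz
    simp [(chartAt E x₀).left_inv hz]

theorem mdifferentiableAt_iff_comp_symm {x₀ y : M} (hy : y ∈ (chartAt E x₀).source)
    (f : M → F) : MDifferentiableAt 𝓘(ℝ, E) 𝓘(ℝ, F) f y ↔
      DifferentiableAt ℝ (fun e => f ((chartAt E x₀).symm e)) (chartAt E x₀ y) := by
  have hm : IsManifold 𝓘(ℝ, E) 1 M := IsManifold.of_le (n := ∞) (by exact_mod_cast le_top)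
  rw [← mdifferentiableAt_iff_differentiableAt]
  constructor
  · intro h
    have h2 : MDifferentiableAt 𝓘(ℝ, E) 𝓘(ℝ, E) (chartAt E x₀).symm (chartAt E x₀ y) :=
      mdifferentiableAt_atlas_symm (chart_mem_atlas E x₀) ((chartAt E x₀).map_source hy)
    refine MDifferentiableAt.comp (chartAt E x₀ y) (g := f) ?_ h2
    rwa [(chartAt E x₀).left_inv hy]
  · intro h
    have h2 : MDifferentiableAt 𝓘(ℝ, E) 𝓘(ℝ, E) (chartAt E x₀) y :=
      mdifferentiableAt_atlas (chart_mem_atlas E x₀) hy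
    refine (MDifferentiableAt.comp y h h2).congr_of_eventuallyEq ?_
    filter_upwards [(chartAt E x₀).open_source.mem_nhds hy] with z hz
    simp [(chartAt E x₀).left_inv hz]

theorem mvfderiv_eq_fderiv {x₀ y : M} (hy : y ∈ (chartAt E x₀).source) {f : M → F}
    (hf : MDifferentiableAt 𝓘(ℝ, E) 𝓘(ℝ, F) f y) (v : TangentSpace 𝓘(ℝ, E) y) :
    mvfderiv 𝓘(ℝ, E) f y v =
      fderiv ℝ (fun e => f ((chartAt E x₀).symm e)) (chartAt E x₀ y) (toModel x₀ y v) := by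
  have h2 : MDifferentiableAt 𝓘(ℝ, E) 𝓘(ℝ, E) (chartAt E x₀) y :=
    mdifferentiableAt_atlas (chart_mem_atlas E x₀) hy
  have h1 : MDifferentiableAt 𝓘(ℝ, E) 𝓘(ℝ, F) (fun e => f ((chartAt E x₀).symm e))
      (chartAt E x₀ y) := ((mdifferentiableAt_iff_comp_symm hy f).1 hf).mdifferentiableAt
  have he : f =ᶠ[𝓝 y] (fun e => f ((chartAt E x₀).symm e)) ∘ chartAt E x₀ := by
    filter_upwards [(chartAt E x₀).open_source.mem_nhds hy] with z hz
    simp [(chartAt E x₀).left_inv hz]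
  have h3 : mfderiv 𝓘(ℝ, E) 𝓘(ℝ, F) f y = _ := he.mfderiv_eq
  rw [mfderiv_comp y h1 h2, mfderiv_eq_fderiv] at h3
  have h4 : toModel x₀ y = mfderiv 𝓘(ℝ, E) 𝓘(ℝ, E) (extChartAt 𝓘(ℝ, E) x₀) y :=
    TangentBundle.continuousLinearMapAt_trivializationAt hy
  have h5 : (extChartAt 𝓘(ℝ, E) x₀ : M → E) = chartAt E x₀ := by
    ext; simp [extChartAt, OpenPartialHomeomorph.extend]
  rw [h5] at h4
  rw [h4]
  change (mfderiv 𝓘(ℝ, E) 𝓘(ℝ, F) f y) v = _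
  rw [h3]
  rfl

theorem trivialization_apply_eq {x₀ y : M} (hy : y ∈ (chartAt E x₀).source) (W : VField E M) :
    (trivializationAt E (TangentSpace 𝓘(ℝ, E)) x₀ ⟨y, W y⟩).2 = toModel x₀ y (W y) :=
  (Trivialization.continuousLinearMapAt_apply_of_mem ℝ _ hy (W y)).symm

theorem mdifferentiableAt_field_iff {x₀ y : M} (hy : y ∈ (chartAt E x₀).source)
    (W : VField E M) :
    MDiffAt (T% W) y ↔ DifferentiableAt ℝ (fieldInChart x₀ W) (chartAt E x₀ y) := by
  have hm : IsManifold 𝓘(ℝ, E) 1 M := IsManifold.of_le (n := ∞) (by exact_mod_cast le_top)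
  rw [Trivialization.mdifferentiableAt_section_iff 𝓘(ℝ, E)
    (trivializationAt E (TangentSpace 𝓘(ℝ, E)) x₀) W hy, mdifferentiableAt_iff_comp_symm hy]
  refine Filter.EventuallyEq.differentiableAt_iff ?_
  filter_upwards [(chartAt E x₀).open_target.mem_nhds ((chartAt E x₀).map_source hy)] with e he
  exact trivialization_apply_eq ((chartAt E x₀).map_target he) W

theorem contMDiffAt_field_iff {x₀ y : M} (hy : y ∈ (chartAt E x₀).source)
    (W : VField E M) :
    CMDiffAt ∞ (T% W) y ↔ ContDiffAt ℝ ∞ (fieldInChart x₀ W) (chartAt E x₀ y) := by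
  rw [Trivialization.contMDiffAt_section_iff
    (trivializationAt E (TangentSpace 𝓘(ℝ, E)) x₀) hy, contMDiffAt_iff_comp_symm hy]
  have : (fun e => (trivializationAt E (TangentSpace 𝓘(ℝ, E)) x₀
      ⟨(chartAt E x₀).symm e, W ((chartAt E x₀).symm e)⟩).2) =ᶠ[𝓝 (chartAt E x₀ y)]
      fieldInChart x₀ W := by
    filter_upwards [(chartAt E x₀).open_target.mem_nhds ((chartAt E x₀).map_source hy)] with e he
    exact trivialization_apply_eq ((chartAt E x₀).map_target he) W
  exact ⟨fun h => h.congr_of_eventuallyEq this.symm, fun h => h.congr_of_eventuallyEq this⟩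

/-- The change of coordinates. -/
noncomputable def transition (x₀ x : M) (e : E) : E := chartAt E x₀ ((chartAt E x).symm e)

theorem contDiffAt_transition {x₀ x y : M} (hy₀ : y ∈ (chartAt E x₀).source)
    (hy : y ∈ (chartAt E x).source) : ContDiffAt ℝ ∞ (transition x₀ x) (chartAt E x y) :=
  (contMDiffAt_iff_comp_symm (n := ⊤) hy _).1
    (contMDiffAt_of_mem_maximalAtlas (IsManifold.chart_mem_maximalAtlas x₀) hy₀)

/-- The coordinates at x₀ of a tangent vector are the derivative of the chart at x₀ along it, and
this derivative may be computed in the chart at x. -/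
theorem toModel_ofModel_eq_fderiv {x₀ x y : M} (hy₀ : y ∈ (chartAt E x₀).source)
    (hy : y ∈ (chartAt E x).source) (w : E) :
    toModel x₀ y (ofModel x y w) = fderiv ℝ (transition x₀ x) (chartAt E x y) w := by
  have hm : IsManifold 𝓘(ℝ, E) 1 M := IsManifold.of_le (n := ∞) (by exact_mod_cast le_top)
  have h := mvfderiv_eq_fderiv hy (f := chartAt E x₀)
    (mdifferentiableAt_atlas (chart_mem_atlas E x₀) hy₀) (ofModel x y w)
  rw [toModel_ofModel hy] at h
  have h4 : toModel x₀ y = mfderiv 𝓘(ℝ, E) 𝓘(ℝ, E) (extChartAt 𝓘(ℝ, E) x₀) y :=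
    TangentBundle.continuousLinearMapAt_trivializationAt hy₀
  have h5 : (extChartAt 𝓘(ℝ, E) x₀ : M → E) = chartAt E x₀ := by
    ext; simp [extChartAt, OpenPartialHomeomorph.extend]
  rw [h5] at h4
  rw [h4]
  exact h

theorem ofModel_eq_ofModel_fderiv {x₀ x y : M} (hy₀ : y ∈ (chartAt E x₀).source)
    (hy : y ∈ (chartAt E x).source) (w : E) :
    ofModel x y w = ofModel x₀ y (fderiv ℝ (transition x₀ x) (chartAt E x y) w) := by
  rw [← toModel_ofModel_eq_fderiv hy₀ hy, ofModel_toModel hy₀]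

theorem eventually_mem_sources {x₀ x y : M} (hy₀ : y ∈ (chartAt E x₀).source)
    (hy : y ∈ (chartAt E x).source) : ∀ᶠ e in 𝓝 (chartAt E x y), e ∈ (chartAt E x).target ∧
      (chartAt E x).symm e ∈ (chartAt E x₀).source := by
  have ht := (chartAt E x).open_target.mem_nhds ((chartAt E x).map_source hy)
  have hc := (chartAt E x).continuousAt_symm ((chartAt E x).map_source hy)
  filter_upwards [ht, hc.preimage_mem_nhds ((chartAt E x₀).open_source.mem_nhds
    (by rwa [(chartAt E x).left_inv hy]))] with e h1 h2
  exact ⟨h1, h2⟩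

theorem formInChart_transition {x₀ x y : M} (hy₀ : y ∈ (chartAt E x₀).source)
    (hy : y ∈ (chartAt E x).source) (η : KForm E M k) :
    formInChart x η =ᶠ[𝓝 (chartAt E x y)] fun e =>
      (formInChart x₀ η (transition x₀ x e)).compContinuousLinearMap
        (fderiv ℝ (transition x₀ x) e) := by
  filter_upwards [eventually_mem_sources hy₀ hy] with e he
  have h0 : chartAt E x ((chartAt E x).symm e) = e := (chartAt E x).right_inv he.1
  ext v
  rw [formInChart_apply, ContinuousAlternatingMap.compContinuousLinearMap_apply,
    formInChart_apply]
  have h1 : (chartAt E x₀).symm (transition x₀ x e) = (chartAt E x).symm e :=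
    (chartAt E x₀).left_inv he.2
  rw [h1]
  congr 1
  funext i
  rw [ofModel_eq_ofModel_fderiv he.2 ((chartAt E x).map_target he.1), h0]
  rfl

end Charts

/-! ### Smoothness of maps into spaces of alternating forms. -/

section FormRegularity

variable {E : Type*} [NormedAddCommGroup E] [NormedSpace ℝ E] [FiniteDimensional ℝ E]
  {F : Type*} [NormedAddCommGroup F] [NormedSpace ℝ F] {k : ℕ}

/-- The values of a form on tuples of basis vectors. -/
noncomputable def formCoords (E : Type*) [NormedAddCommGroup E] [NormedSpace ℝ E]
    [FiniteDimensional ℝ E] (k : ℕ) : (E [⋀^Fin k]→L[ℝ] ℝ) →ₗ[ℝ]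
      ((Fin k → Fin (Module.finrank ℝ E)) → ℝ) where
  toFun η r := η fun i => Module.finBasis ℝ E (r i)
  map_add' _ _ := rfl
  map_smul' _ _ := rfl

theorem formCoords_injective : Function.Injective (formCoords E k) := by
  intro η θ h
  have h' : η.toAlternatingMap = θ.toAlternatingMap :=
    (Module.finBasis ℝ E).ext_alternating fun r _ => congrFun h r
  ext v
  exact congrArg (fun f => f v) h'

instance finiteDimensional_form : FiniteDimensional ℝ (E [⋀^Fin k]→L[ℝ] ℝ) :=
  FiniteDimensional.of_injective _ formCoords_injective

theorem exists_formCoords_leftInverse :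
    ∃ g : ((Fin k → Fin (Module.finrank ℝ E)) → ℝ) →L[ℝ] (E [⋀^Fin k]→L[ℝ] ℝ),
      ∀ η, g (formCoords E k η) = η := by
  obtain ⟨g, hg⟩ := (formCoords E k).exists_leftInverse_of_injective
    (LinearMap.ker_eq_bot.2 formCoords_injective)
  exact ⟨LinearMap.toContinuousLinearMap g, fun η => LinearMap.congr_fun hg η⟩

/-- Evaluation of forms on a tuple of vectors. -/
noncomputable def formEval (v : Fin k → E) : (E [⋀^Fin k]→L[ℝ] ℝ) →L[ℝ] ℝ :=
  LinearMap.toContinuousLinearMap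
    { toFun := fun η => η v, map_add' := fun _ _ => rfl, map_smul' := fun _ _ => rfl }

/-- The values on tuples of basis vectors form an injective linear map into a finite-dimensional
space, and a linear left inverse reconstructs the form from them. -/
theorem contDiffAt_form_iff {n : WithTop ℕ∞} {f : F → E [⋀^Fin k]→L[ℝ] ℝ} {x : F} :
    ContDiffAt ℝ n f x ↔ ∀ v, ContDiffAt ℝ n (fun y => f y v) x := by
  constructor
  · intro h v
    exact (formEval v).contDiff.contDiffAt.comp x h
  · intro h
    obtain ⟨g, hg⟩ := exists_formCoords_leftInverse (E := E) (k := k)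
    have h2 : f = fun y => g (formCoords E k (f y)) := funext fun y => (hg _).symm
    rw [h2]
    exact g.contDiff.contDiffAt.comp x (contDiffAt_pi.2 fun r => h _)

theorem differentiableAt_form_iff {f : F → E [⋀^Fin k]→L[ℝ] ℝ} {x : F} :
    DifferentiableAt ℝ f x ↔ ∀ v, DifferentiableAt ℝ (fun y => f y v) x := by
  constructor
  · intro h v
    exact (formEval v).differentiableAt.comp x h
  · intro h
    obtain ⟨g, hg⟩ := exists_formCoords_leftInverse (E := E) (k := k)
    have h2 : f = fun y => g (formCoords E k (f y)) := funext fun y => (hg _).symm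
    rw [h2]
    exact g.differentiableAt.comp x (differentiableAt_pi.2 fun r => h _)

theorem fderiv_form_apply {f : F → E [⋀^Fin k]→L[ℝ] ℝ} {x : F} (h : DifferentiableAt ℝ f x)
    (u : F) (v : Fin k → E) : fderiv ℝ f x u v = fderiv ℝ (fun y => f y v) x u := by
  have := ((formEval v).hasFDerivAt.comp x h.hasFDerivAt).fderiv
  exact (congrArg (fun g => g u) this).symm

/-- The value of a smooth form on smooth vector fields is smooth. -/
theorem ContDiffAt.form_apply {n : WithTop ℕ∞} {f : F → E [⋀^Fin k]→L[ℝ] ℝ} {X : Fin k → F → E}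
    {x : F} (hf : ContDiffAt ℝ n f x) (hX : ∀ i, ContDiffAt ℝ n (X i) x) :
    ContDiffAt ℝ n (fun y => f y fun i => X i y) x := by
  let b := Module.finBasis ℝ E
  have h : (fun y => f y fun i => X i y) = fun y => ∑ r : Fin k → Fin (Module.finrank ℝ E),
      (∏ i, b.coord (r i) (X i y)) * f y fun i => b (r i) := by
    funext y
    conv_lhs => rw [show (fun i => X i y) = fun i => ∑ j, b.coord j (X i y) • b j from
      funext fun i => (b.sum_repr (X i y)).symm]
    change (f y).toMultilinearMap _ = _
    rw [MultilinearMap.map_sum]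
    exact Finset.sum_congr rfl fun r _ => (f y).toMultilinearMap.map_smul_univ _ _
  rw [h]
  refine ContDiffAt.sum fun r _ => ContDiffAt.mul (contDiffAt_prod fun i _ => ?_)
    (contDiffAt_form_iff.1 hf _)
  exact (LinearMap.toContinuousLinearMap (b.coord (r i))).contDiff.contDiffAt.comp x (hX i)

theorem ContDiffAt.form_comp {n : WithTop ℕ∞} {f : F → E [⋀^Fin k]→L[ℝ] ℝ} {A : F → E →L[ℝ] E}
    {x : F} (hf : ContDiffAt ℝ n f x) (hA : ContDiffAt ℝ n A x) :
    ContDiffAt ℝ n (fun y => (f y).compContinuousLinearMap (A y)) x :=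
  contDiffAt_form_iff.2 fun _ => hf.form_apply fun _ => hA.clm_apply contDiffAt_const

end FormRegularity

/-! ### Chart independence of smoothness and of the exterior derivative; d² = 0. -/

section FormCharts

open Topology

variable {E : Type*} [NormedAddCommGroup E] [NormedSpace ℝ E]
  {M : Type*} [TopologicalSpace M] [ChartedSpace E M]
  [FiniteDimensional ℝ E] [IsManifold 𝓘(ℝ, E) ∞ M] {k : ℕ}

theorem contDiffAt_formInChart_transition {x₀ x y : M} (hy₀ : y ∈ (chartAt E x₀).source)
    (hy : y ∈ (chartAt E x).source) {η : KForm E M k}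
    (h : ContDiffAt ℝ ∞ (formInChart x₀ η) (chartAt E x₀ y)) :
    ContDiffAt ℝ ∞ (formInChart x η) (chartAt E x y) := by
  refine ContDiffAt.congr_of_eventuallyEq ?_ (formInChart_transition hy₀ hy η)
  have ht := contDiffAt_transition hy₀ hy
  refine ContDiffAt.form_comp ?_ (ht.fderiv_right (by exact_mod_cast le_rfl))
  refine ContDiffAt.comp (chartAt E x y) (g := formInChart x₀ η) ?_ ht
  rwa [transition, (chartAt E x).left_inv hy]

theorem smoothFormAt_iff {x₀ x : M} (hx : x ∈ (chartAt E x₀).source) {η : KForm E M k} :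
    SmoothFormAt η x ↔ ContDiffAt ℝ ∞ (formInChart x₀ η) (chartAt E x₀ x) := by
  have hxx := mem_chart_source E x
  have key : SmoothFormAt η x ↔ ContDiffAt ℝ ∞ (formInChart x η) (chartAt E x x) := by
    unfold SmoothFormAt
    have h1 := contMDiffAt_section (IB := 𝓘(ℝ, E)) (n := ∞) (F := E [⋀^Fin k]→L[ℝ] ℝ)
      (E := fun x : M => TangentSpace 𝓘(ℝ, E) x [⋀^Fin k]→L[ℝ] Trivial M ℝ x) (s := η) x
    refine h1.trans ((contMDiffAt_iff_comp_symm (n := ⊤) hxx _).trans (iff_of_eq ?_))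
    congr 1
    funext e
    ext v
    change (trivializationAt ℝ (Trivial M ℝ) x).continuousLinearMapAt ℝ ((chartAt E x).symm e)
      (formInChart x η e v) = _
    -- The values lie in the trivial line bundle, whose trivializations are the identity, so only
    -- the trivialization of the tangent bundle matters.
    have triv : ∀ (t : Trivialization ℝ (TotalSpace.proj : TotalSpace ℝ (Trivial M ℝ) → M))
        [MemTrivializationAtlas t] (y : M) (r : ℝ), t.continuousLinearMapAt ℝ y r = r := by
      intro t _ y r
      obtain rfl := Bundle.Trivial.eq_trivialization M ℝ t
      simp
    exact triv _ _ _
  rw [key]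
  exact ⟨contDiffAt_formInChart_transition hxx hx, contDiffAt_formInChart_transition hx hxx⟩

theorem fderiv_transition_comp {x₀ x y : M} (hy₀ : y ∈ (chartAt E x₀).source)
    (hy : y ∈ (chartAt E x).source) (w : E) :
    fderiv ℝ (transition x₀ x) (chartAt E x y) (toModel x y (ofModel x₀ y w)) = w := by
  rw [← toModel_ofModel_eq_fderiv hy₀ hy, ofModel_toModel hy, toModel_ofModel hy₀]

/-- At y the exterior derivative is computed in the chart at y. The two chart expressions of η are
related by pullback along the transition map, and d commutes with pullback. -/
theorem formInChart_extDerivForm {x₀ y : M} (hy : y ∈ (chartAt E x₀).source) {η : KForm E M k}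
    (h : SmoothFormAt η y) :
    formInChart x₀ (extDerivForm η) (chartAt E x₀ y) =
      extDeriv (formInChart x₀ η) (chartAt E x₀ y) := by
  have hyy := mem_chart_source E y
  have h1 := (formInChart_transition hy hyy η).extDeriv_eq
  have hψ := contDiffAt_transition hy hyy
  have h2 : transition x₀ y (chartAt E y y) = chartAt E x₀ y := by
    rw [transition, (chartAt E y).left_inv hyy]
  have h3 : DifferentiableAt ℝ (formInChart x₀ η) (transition x₀ y (chartAt E y y)) := by
    rw [h2]
    exact ((smoothFormAt_iff hy).1 h).differentiableAt (by simp)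
  rw [extDeriv_pullback h3 hψ (by simp; norm_cast), h2] at h1
  ext v
  rw [formInChart_apply, (chartAt E x₀).left_inv hy]
  change extDeriv (formInChart y η) (chartAt E y y) (fun i => toModel y y (ofModel x₀ y (v i))) = _
  rw [h1]
  change extDeriv _ _ (fun i => fderiv ℝ (transition x₀ y) (chartAt E y y)
    (toModel y y (ofModel x₀ y (v i)))) = _
  simp only [fderiv_transition_comp hy hyy]

theorem formInChart_extDerivForm_eventuallyEq {x₀ y : M} (hy : y ∈ (chartAt E x₀).source)
    {η : KForm E M k} (h : ∀ᶠ z in 𝓝 y, SmoothFormAt η z) :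
    formInChart x₀ (extDerivForm η) =ᶠ[𝓝 (chartAt E x₀ y)] extDeriv (formInChart x₀ η) := by
  have ht := (chartAt E x₀).open_target.mem_nhds ((chartAt E x₀).map_source hy)
  have hc := (chartAt E x₀).continuousAt_symm ((chartAt E x₀).map_source hy)
  rw [← (chartAt E x₀).left_inv hy] at h
  filter_upwards [ht, hc.eventually h] with e he1 he2
  have := formInChart_extDerivForm ((chartAt E x₀).map_target he1) he2
  rwa [(chartAt E x₀).right_inv he1] at this

theorem contDiffAt_extDeriv {f : E → E [⋀^Fin k]→L[ℝ] ℝ} {x : E} (h : ContDiffAt ℝ ∞ f x) :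
    ContDiffAt ℝ ∞ (extDeriv f) x :=
  (ContinuousAlternatingMap.alternatizeUncurryFinCLM ℝ E ℝ).contDiff.contDiffAt.comp x
    (h.fderiv_right (by exact_mod_cast le_rfl))

theorem SmoothForm.dForm {η : DForm E M} (h : SmoothForm η) : SmoothForm (dForm η) := by
  intro k x
  have hx := mem_chart_source E x
  cases k with
  | zero =>
    rw [smoothFormAt_iff hx]
    exact contDiffAt_form_iff.2 fun _ => contDiffAt_const (c := 0)
  | succ k =>
    rw [smoothFormAt_iff hx]
    exact (contDiffAt_extDeriv ((smoothFormAt_iff hx).1 (h k x))).congr_of_eventuallyEq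
      (formInChart_extDerivForm_eventuallyEq hx (Filter.Eventually.of_forall (h k)))

theorem dForm_dForm {η : DForm E M} (h : SmoothForm η) : _root_.dForm (_root_.dForm η) = 0 := by
  funext x k
  match k with
  | 0 => rfl
  | 1 =>
    -- Degree one is separate: the degree-zero part of dη is zero by definition, not an exterior
    -- derivative of anything.
    change extDerivForm (fun y => (0 : KForm E M 0) y) x = 0
    have : formInChart x (0 : KForm E M 0) = fun _ => 0 := rfl
    unfold extDerivForm
    change (extDeriv (formInChart x (0 : KForm E M 0)) _).compContinuousLinearMap _ = 0
    rw [this]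
    ext v
    simp [extDeriv, ContinuousAlternatingMap.alternatizeUncurryFin_apply]
  | k + 2 =>
    change extDerivForm (extDerivForm fun y => η y k) x = 0
    have hx := mem_chart_source E x
    change (extDeriv (formInChart x (extDerivForm fun y => η y k))
      (chartAt E x x)).compContinuousLinearMap (chartDeriv x) = 0
    rw [(formInChart_extDerivForm_eventuallyEq hx (Filter.Eventually.of_forall (h k))).extDeriv_eq,
      extDeriv_extDeriv_apply ((smoothFormAt_iff hx).1 (h k x))
        (by simp; norm_cast)]
    rfl

end FormCharts

/-! ### Christoffel symbols, Lie brackets and the adjoint connection in a chart. -/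

section ConnectionCharts

open Topology

variable {E : Type*} [NormedAddCommGroup E] [NormedSpace ℝ E]
  {M : Type*} [TopologicalSpace M] [ChartedSpace E M]
  [FiniteDimensional ℝ E] [IsManifold 𝓘(ℝ, E) ∞ M] {k : ℕ}

theorem fieldInChart_chartAt {x₀ y : M} (hy : y ∈ (chartAt E x₀).source) (W : VField E M) :
    fieldInChart x₀ W (chartAt E x₀ y) = toModel x₀ y (W y) := by
  unfold fieldInChart
  rw [(chartAt E x₀).left_inv hy]

theorem fieldInChart_coordField {x₀ : M} {e : E} (he : e ∈ (chartAt E x₀).target) (w : E) :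
    fieldInChart x₀ (coordField x₀ w) e = w :=
  toModel_ofModel ((chartAt E x₀).map_target he) w

theorem fieldInChart_coordField_eventuallyEq {x₀ y : M} (hy : y ∈ (chartAt E x₀).source) (w : E) :
    fieldInChart x₀ (coordField x₀ w) =ᶠ[𝓝 (chartAt E x₀ y)] fun _ => w := by
  filter_upwards [(chartAt E x₀).open_target.mem_nhds ((chartAt E x₀).map_source hy)] with e he
  exact fieldInChart_coordField he w

theorem contMDiffAt_coordField {x₀ y : M} (hy : y ∈ (chartAt E x₀).source) (w : E) :
    CMDiffAt ∞ (T% (coordField x₀ w : VField E M)) y :=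
  (contMDiffAt_field_iff hy _).2
    (contDiffAt_const.congr_of_eventuallyEq (fieldInChart_coordField_eventuallyEq hy w))

theorem mdifferentiableAt_coordField {x₀ y : M} (hy : y ∈ (chartAt E x₀).source) (w : E) :
    MDiffAt (T% (coordField x₀ w : VField E M)) y :=
  (contMDiffAt_coordField hy w).mdifferentiableAt (by simp)

theorem mdifferentiableAt_sum_smul_field {ι : Type*} {y : M} (s : Finset ι) (g : ι → M → ℝ)
    (W : ι → VField E M) (hg : ∀ a, MDifferentiableAt 𝓘(ℝ, E) 𝓘(ℝ, ℝ) (g a) y)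
    (hW : ∀ a, MDiffAt (T% (W a)) y) : MDiffAt (T% (∑ a ∈ s, g a • W a : VField E M)) y := by
  classical
  induction s using Finset.induction_on with
  | empty => exact mdifferentiableAt_zeroSection ℝ (TangentSpace 𝓘(ℝ, E))
  | insert a s ha ih =>
    rw [Finset.sum_insert ha]
    exact mdifferentiableAt_add_section ((hg a).smul_section (hW a)) ih

theorem cov_sum_smul {ι : Type*} (cov : Connection E M) {y : M} (s : Finset ι) (g : ι → M → ℝ)
    (W : ι → VField E M) (hg : ∀ a, MDifferentiableAt 𝓘(ℝ, E) 𝓘(ℝ, ℝ) (g a) y)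
    (hW : ∀ a, MDiffAt (T% (W a)) y) (v : TangentSpace 𝓘(ℝ, E) y) :
    cov (∑ a ∈ s, g a • W a) y v =
      ∑ a ∈ s, (g a y • cov (W a) y v + mvfderiv 𝓘(ℝ, E) (g a) y v • W a y) := by
  classical
  induction s using Finset.induction_on with
  | empty => simp
  | insert a s ha ih =>
    rw [Finset.sum_insert ha, Finset.sum_insert ha, cov.isCovariantDerivativeOnUniv.add
      ((hg a).smul_section (hW a)) (mdifferentiableAt_sum_smul_field s g W hg hW),
      cov.isCovariantDerivativeOnUniv.leibniz (hW a) (hg a)]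
    change _ + cov (∑ a ∈ s, g a • W a) y v = _
    rw [ih]
    rfl

variable (E) in
/-- The coordinate functionals of the standard basis of `E`. -/
noncomputable def coordCLM (a : Fin (Module.finrank ℝ E)) : E →L[ℝ] ℝ :=
  LinearMap.toContinuousLinearMap ((Module.finBasis ℝ E).coord a)

theorem coordCLM_apply (a : Fin (Module.finrank ℝ E)) (w : E) :
    coordCLM E a w = (Module.finBasis ℝ E).coord a w := rfl

theorem sum_coordCLM_smul (w : E) : ∑ a, coordCLM E a w • Module.finBasis ℝ E a = w :=
  (Module.finBasis ℝ E).sum_repr w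

/-- The derivative of the coordinate field `w` in the direction `v`, in coordinates. -/
noncomputable def covCoord (cov : Connection E M) (x₀ : M) (w : E) (e : E) : E →L[ℝ] E :=
  toModel x₀ ((chartAt E x₀).symm e) ∘L cov (coordField x₀ w) ((chartAt E x₀).symm e) ∘L
    ofModel x₀ ((chartAt E x₀).symm e)

theorem covCoord_chartAt (cov : Connection E M) {x₀ y : M} (hy : y ∈ (chartAt E x₀).source)
    (w : E) : covCoord cov x₀ w (chartAt E x₀ y) =
      toModel x₀ y ∘L cov (coordField x₀ w) y ∘L ofModel x₀ y := by
  unfold covCoord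
  rw [(chartAt E x₀).left_inv hy]

/-- The Christoffel symbols of a connection in the preferred chart at `x₀`. -/
noncomputable def chris (cov : Connection E M) (x₀ : M) (e : E) : E →L[ℝ] E →L[ℝ] E :=
  ∑ a, ContinuousLinearMap.smulRightL ℝ E E (coordCLM E a) ∘L
    covCoord cov x₀ (Module.finBasis ℝ E a) e

theorem chris_apply (cov : Connection E M) (x₀ : M) (e v w : E) :
    chris cov x₀ e v w =
      ∑ a, coordCLM E a w • covCoord cov x₀ (Module.finBasis ℝ E a) e v := by
  simp [chris]

/-- A connection is local, so near y the field may be replaced by the combination of coordinate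
fields with its components as coefficients. The Leibniz rule then yields ∂_v W + Γ(v)W. -/
theorem toModel_cov (cov : Connection E M) {x₀ y : M} (hy : y ∈ (chartAt E x₀).source)
    {W : VField E M} (hW : MDiffAt (T% W) y) (v : TangentSpace 𝓘(ℝ, E) y) :
    toModel x₀ y (cov W y v) =
      fderiv ℝ (fieldInChart x₀ W) (chartAt E x₀ y) (toModel x₀ y v) +
        chris cov x₀ (chartAt E x₀ y) (toModel x₀ y v) (toModel x₀ y (W y)) := by
  let b := Module.finBasis ℝ E
  let g : Fin (Module.finrank ℝ E) → M → ℝ := fun a z => coordCLM E a (toModel x₀ z (W z))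
  have hWd := (mdifferentiableAt_field_iff hy W).1 hW
  have hg : ∀ a, MDifferentiableAt 𝓘(ℝ, E) 𝓘(ℝ, ℝ) (g a) y := fun a =>
    (mdifferentiableAt_iff_comp_symm hy (g a)).2
      ((coordCLM E a).differentiableAt.comp _ hWd)
  have hc := fun a => mdifferentiableAt_coordField hy (b a)
  have he : ∀ᶠ z in 𝓝 y, W z = (∑ a, g a • coordField x₀ (b a) : VField E M) z := by
    filter_upwards [(chartAt E x₀).open_source.mem_nhds hy] with z hz
    rw [Finset.sum_apply]
    change _ = ∑ a, g a z • ofModel x₀ z (b a)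
    simp only [← map_smul, ← map_sum, g, b, sum_coordCLM_smul, ofModel_toModel hz]
  rw [cov.isCovariantDerivativeOnUniv.congr_of_eventuallyEq hW
    (mdifferentiableAt_sum_smul_field _ g _ hg hc) Filter.univ_mem he,
    cov_sum_smul cov _ g _ hg hc, Finset.sum_add_distrib, map_add, add_comm]
  congr 1
  · have h1 : ∀ a, mvfderiv 𝓘(ℝ, E) (g a) y v =
        coordCLM E a (fderiv ℝ (fieldInChart x₀ W) (chartAt E x₀ y) (toModel x₀ y v)) := by
      intro a
      rw [mvfderiv_eq_fderiv hy (hg a)]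
      exact congrArg (fun L => L (toModel x₀ y v))
        ((coordCLM E a).hasFDerivAt.comp _ hWd.hasFDerivAt).fderiv
    simp only [map_sum, map_smul, h1]
    refine Eq.trans ?_ (sum_coordCLM_smul _)
    exact Finset.sum_congr rfl fun a _ => congrArg _ (toModel_ofModel hy _)
  · rw [chris_apply]
    simp only [map_sum, map_smul]
    refine Finset.sum_congr rfl fun a _ => ?_
    rw [covCoord_chartAt cov hy]
    simp only [ContinuousLinearMap.comp_apply, ofModel_toModel hy]
    rfl

theorem toModel_cov_coordField (cov : Connection E M) {x₀ y : M} (hy : y ∈ (chartAt E x₀).source)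
    (w : E) (v : TangentSpace 𝓘(ℝ, E) y) :
    toModel x₀ y (cov (coordField x₀ w) y v) = chris cov x₀ (chartAt E x₀ y) (toModel x₀ y v) w := by
  rw [toModel_cov cov hy (mdifferentiableAt_coordField hy w),
    (fieldInChart_coordField_eventuallyEq hy w).fderiv_eq, coordField, toModel_ofModel hy]
  simp

/-- Smoothness of the connection is tested on globally smooth fields, whereas a coordinate field is
smooth on the chart domain only. It is multiplied by a bump function supported there and equal to
one near y, which changes nothing near y; the Hausdorff property supplies the bump function. -/
theorem contDiffAt_covCoord [T2Space M] (cov : Connection E M)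
    [CovariantDerivative.ContMDiffCovariantDerivative cov ∞] {x₀ y : M}
    (hy : y ∈ (chartAt E x₀).source) (w : E) :
    ContDiffAt ℝ ∞ (covCoord cov x₀ w) (chartAt E x₀ y) := by
  obtain ⟨f, -, hf⟩ := (SmoothBumpFunction.nhds_basis_tsupport (I := 𝓘(ℝ, E)) y).mem_iff.1
    ((chartAt E x₀).open_source.mem_nhds hy)
  have h1 : CMDiff ∞ (T% ((f : M → ℝ) • coordField x₀ w : VField E M)) :=
    ContMDiffOn.smul_section_of_tsupport (u := (chartAt E x₀).source) f.contMDiff.contMDiffOn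
      (chartAt E x₀).open_source hf fun z hz => (contMDiffAt_coordField hz w).contMDiffWithinAt
  have h2 := (CovariantDerivative.ContMDiffCovariantDerivative.contMDiff
    (cov := cov) (k := ∞)).contMDiff (by exact h1.contMDiffOn)
  have h3 := (h2 y trivial).contMDiffAt Filter.univ_mem
  have h4 := (Trivialization.contMDiffAt_section_iff
    (trivializationAt (E →L[ℝ] E) (fun x : M => TangentSpace 𝓘(ℝ, E) x →L[ℝ]
      TangentSpace 𝓘(ℝ, E) x) x₀) ⟨hy, hy⟩).1 h3
  rw [contMDiffAt_iff_comp_symm (n := ⊤) hy] at h4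
  refine h4.congr_of_eventuallyEq ?_
  have hev : ∀ᶠ z in 𝓝 y, z ∈ (chartAt E x₀).source ∧ ∀ᶠ z' in 𝓝 z, f z' = 1 :=
    Filter.Eventually.and ((chartAt E x₀).open_source.mem_nhds hy)
      (f.eventuallyEq_one).eventually_nhds
  have hc := (chartAt E x₀).continuousAt_symm ((chartAt E x₀).map_source hy)
  rw [ContinuousAt, (chartAt E x₀).left_inv hy] at hc
  filter_upwards [hc.eventually hev] with e he
  have h5 : cov ((f : M → ℝ) • coordField x₀ w) ((chartAt E x₀).symm e) =
      cov (coordField x₀ w) ((chartAt E x₀).symm e) := by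
    refine cov.isCovariantDerivativeOnUniv.congr_of_eventuallyEq
      ((h1 _).mdifferentiableAt (by simp)) (mdifferentiableAt_coordField he.1 w)
      Filter.univ_mem ?_
    filter_upwards [he.2] with z hz
    simp [hz]
  change _ = toModel x₀ ((chartAt E x₀).symm e) ∘L _ ∘L ofModel x₀ ((chartAt E x₀).symm e)
  rw [h5]
  rfl

theorem contDiffAt_chris [T2Space M] (cov : Connection E M)
    [CovariantDerivative.ContMDiffCovariantDerivative cov ∞] {x₀ y : M}
    (hy : y ∈ (chartAt E x₀).source) : ContDiffAt ℝ ∞ (chris cov x₀) (chartAt E x₀ y) := by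
  unfold chris
  exact ContDiffAt.sum fun a _ => contDiffAt_const.clm_comp (contDiffAt_covCoord cov hy _)

/-- The bracket is natural under pullback by the inverse chart, and on the model space it is the
usual difference of derivatives. -/
theorem toModel_mlieBracket {x₀ y : M} (hy : y ∈ (chartAt E x₀).source) {U V : VField E M}
    (hU : MDiffAt (T% U) y) (hV : MDiffAt (T% V) y) :
    toModel x₀ y (VectorField.mlieBracket 𝓘(ℝ, E) U V y) =
      fderiv ℝ (fieldInChart x₀ V) (chartAt E x₀ y) (toModel x₀ y (U y)) -
        fderiv ℝ (fieldInChart x₀ U) (chartAt E x₀ y) (toModel x₀ y (V y)) := by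
  have hm : IsManifold 𝓘(ℝ, E) (minSmoothness ℝ 3) M :=
    IsManifold.of_le (n := ∞) (by simp; exact ENat.LEInfty.out)
  have hm1 : IsManifold 𝓘(ℝ, E) 1 M := IsManifold.of_le (n := ∞) (by exact_mod_cast le_top)
  have hinv : ∀ e ∈ (chartAt E x₀).target, (mfderiv 𝓘(ℝ, E) 𝓘(ℝ, E) (chartAt E x₀).symm e).inverse =
      toModel (E := E) x₀ ((chartAt E x₀).symm e) := by
    intro e he
    have hz := (chartAt E x₀).map_target he
    have h1 : ofModel (E := E) x₀ ((chartAt E x₀).symm e) =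
        mfderivWithin 𝓘(ℝ, E) 𝓘(ℝ, E) (extChartAt 𝓘(ℝ, E) x₀).symm (Set.range 𝓘(ℝ, E))
          (extChartAt 𝓘(ℝ, E) x₀ ((chartAt E x₀).symm e)) :=
      TangentBundle.symmL_trivializationAt hz
    have h2 : mfderiv 𝓘(ℝ, E) 𝓘(ℝ, E) (chartAt E x₀).symm e =
        ofModel (E := E) x₀ ((chartAt E x₀).symm e) := by
      rw [h1]
      have hr := (chartAt E x₀).right_inv he
      simp only [extChartAt, OpenPartialHomeomorph.extend, mfld_simps]
      generalize chartAt E x₀ ((chartAt E x₀).symm e) = e' at hr ⊢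
      subst hr
      rfl
    rw [h2]
    exact ContinuousLinearMap.inverse_equiv (modelEquiv hz)
  have hpb : ∀ (W : VField E M), VectorField.mpullback 𝓘(ℝ, E) 𝓘(ℝ, E) (chartAt E x₀).symm W
      =ᶠ[𝓝 (chartAt E x₀ y)] fieldInChart x₀ W := by
    intro W
    filter_upwards [(chartAt E x₀).open_target.mem_nhds ((chartAt E x₀).map_source hy)] with e he
    rw [VectorField.mpullback_apply, hinv e he]
    rfl
  have hsm : ContMDiffAt 𝓘(ℝ, E) 𝓘(ℝ, E) ∞ (chartAt E x₀).symm (chartAt E x₀ y) :=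
    contMDiffAt_symm_of_mem_maximalAtlas (IsManifold.chart_mem_maximalAtlas x₀)
      ((chartAt E x₀).map_source hy)
  have key := VectorField.mpullback_mlieBracket (I := 𝓘(ℝ, E)) (I' := 𝓘(ℝ, E))
    (f := (chartAt E x₀).symm) (x₀ := chartAt E x₀ y) (V := U) (W := V) (n := ∞)
    (by rwa [(chartAt E x₀).left_inv hy]) (by rwa [(chartAt E x₀).left_inv hy]) hsm
    (by simp; exact ENat.LEInfty.out)
  rw [VectorField.mpullback_apply, hinv _ ((chartAt E x₀).map_source hy),
    (hpb U).mlieBracket_vectorField_eq (hpb V)] at key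
  have hlie : ∀ (P Q : Π e : E, TangentSpace 𝓘(ℝ, E) e) (e : E), VectorField.mlieBracket 𝓘(ℝ, E) P Q e =
      VectorField.lieBracket ℝ P Q e := fun P Q e => by
    have h := congrFun (VectorField.mlieBracketWithin_eq_lieBracketWithin (𝕜 := ℝ) (V := P)
      (W := Q) (s := Set.univ)) e
    rw [VectorField.mlieBracketWithin_univ] at h
    exact h.trans (congrFun (VectorField.lieBracketWithin_univ (𝕜 := ℝ) (V := (P : E → E))
      (W := (Q : E → E))) e)
  have key2 := key.trans (hlie _ _ _)
  rw [(chartAt E x₀).left_inv hy] at key2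
  refine key2.trans ?_
  rw [VectorField.lieBracket, fieldInChart_chartAt hy, fieldInChart_chartAt hy]

/-- The fields with constant coordinates v and w commute, so T(v, w) = Γ(v)w − Γ(w)v, and
subtracting it from Γ(v)w transposes the symbols. -/
theorem chris_adjointConnection (cov : Connection E M) {x₀ y : M}
    (hy : y ∈ (chartAt E x₀).source) (v w : E) :
    chris (adjointConnection cov) x₀ (chartAt E x₀ y) v w = chris cov x₀ (chartAt E x₀ y) w v := by
  have hv := mdifferentiableAt_coordField hy v
  have hw := mdifferentiableAt_coordField hy w
  have h1 := toModel_cov_coordField (adjointConnection cov) hy w (coordField x₀ v y)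
  have h2 : cov.torsion y (coordField x₀ v y) (coordField x₀ w y) = _ :=
    cov.torsion_apply hv hw
  rw [adjointConnection_apply, h2, map_sub, map_sub, map_sub, toModel_cov_coordField cov hy,
    toModel_cov_coordField cov hy, toModel_mlieBracket hy hv hw,
    (fieldInChart_coordField_eventuallyEq hy w).fderiv_eq,
    (fieldInChart_coordField_eventuallyEq hy v).fderiv_eq] at h1
  simp only [coordField, toModel_ofModel hy] at h1
  rw [← h1]
  simp

end ConnectionCharts

/-! ### Covariant derivatives of forms and curvature in a chart. -/

section CurvatureCharts

open Topology

variable {E : Type*} [NormedAddCommGroup E] [NormedSpace ℝ E]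
  {M : Type*} [TopologicalSpace M] [ChartedSpace E M]
  [FiniteDimensional ℝ E] [IsManifold 𝓘(ℝ, E) ∞ M] {k : ℕ}

theorem formInChart_chartAt {x₀ y : M} (hy : y ∈ (chartAt E x₀).source) (η : KForm E M k) :
    formInChart x₀ η (chartAt E x₀ y) = (η y).compContinuousLinearMap (ofModel x₀ y) := by
  unfold formInChart
  rw [(chartAt E x₀).left_inv hy]
  rfl

theorem extend_eq_coordField {x z : M} (hz : z ∈ (chartAt E x).source)
    (v : TangentSpace 𝓘(ℝ, E) x) :
    FiberBundle.extend E v z = coordField x (toModel x x v) z := by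
  have hx := mem_chart_source E x
  simp only [FiberBundle.extend]
  rw [coordField, ofModel, Trivialization.symmL_apply (R := ℝ) _ hz]
  exact congrArg _ (Trivialization.continuousLinearMapAt_apply_of_mem ℝ _ hx v).symm

theorem extend_eventuallyEq {x : M} (v : TangentSpace 𝓘(ℝ, E) x) :
    ∀ᶠ z in 𝓝 x, FiberBundle.extend E v z = coordField x (toModel x x v) z := by
  filter_upwards [(chartAt E x).open_source.mem_nhds (mem_chart_source E x)] with z hz
  exact extend_eq_coordField hz v

theorem contMDiffAt_extend {x : M} (v : TangentSpace 𝓘(ℝ, E) x) :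
    CMDiffAt ∞ (T% (FiberBundle.extend E v : VField E M)) x := by
  refine (contMDiffAt_coordField (mem_chart_source E x) (toModel x x v)).congr_of_eventuallyEq ?_
  filter_upwards [extend_eventuallyEq v] with z hz
  rw [hz]

theorem contMDiffAt_extend_iff_eventually {x : M} (v : TangentSpace 𝓘(ℝ, E) x) :
    ∀ᶠ z in 𝓝 x, CMDiffAt ∞ (T% (FiberBundle.extend E v : VField E M)) z := by
  filter_upwards [(chartAt E x).open_source.mem_nhds (mem_chart_source E x)] with z hz
  refine (contMDiffAt_coordField hz (toModel x x v)).congr_of_eventuallyEq ?_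
  filter_upwards [(chartAt E x).open_source.mem_nhds hz] with z' hz'
  rw [extend_eq_coordField hz']

/-- The definition uses the chart at y. Extend the arguments to fields U_i with constant coordinates
in that chart and differentiate η(U_1, …, U_k) along v in both charts. In the chart at x₀ the
product rule also differentiates the U_i, and these terms cancel against those in the chart formula
for ∇_v U_i. -/
theorem covForm_comp_ofModel (cov : Connection E M) {x₀ y : M} (hy : y ∈ (chartAt E x₀).source)
    {η : KForm E M k} (hη : SmoothFormAt η y) (v : TangentSpace 𝓘(ℝ, E) y) :
    (covForm cov η y v).compContinuousLinearMap (ofModel x₀ y) =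
      fderiv ℝ (formInChart x₀ η) (chartAt E x₀ y) (toModel x₀ y v) -
        endAct (chris cov x₀ (chartAt E x₀ y) (toModel x₀ y v)) (formInChart x₀ η (chartAt E x₀ y)) := by
  have hyy := mem_chart_source E y
  have hd₀ := ((smoothFormAt_iff hy).1 hη).differentiableAt (by simp)
  have hd := ((smoothFormAt_iff hyy).1 hη).differentiableAt (by simp)
  ext w
  let u : Fin k → TangentSpace 𝓘(ℝ, E) y := fun i => ofModel x₀ y (w i)
  have hu : ∀ i, toModel x₀ y (u i) = w i := fun i => toModel_ofModel hy _
  let U : Fin k → VField E M := fun i => FiberBundle.extend E (u i)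
  have hU : ∀ i, CMDiffAt ∞ (T% (U i)) y := fun i => contMDiffAt_extend (u i)
  have hUy : ∀ i, U i y = u i := fun i => FiberBundle.extend_apply_self _ (u i)
  have hUd : ∀ i, DifferentiableAt ℝ (fieldInChart x₀ (U i)) (chartAt E x₀ y) := fun i =>
    ((contMDiffAt_field_iff hy _).1 (hU i)).differentiableAt (by simp)
  let f : M → ℝ := fun z => η z fun i => U i z
  have hf₀ : (fun e => f ((chartAt E x₀).symm e)) =ᶠ[𝓝 (chartAt E x₀ y)]
      fun e => formInChart x₀ η e fun i => fieldInChart x₀ (U i) e := by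
    filter_upwards [(chartAt E x₀).open_target.mem_nhds ((chartAt E x₀).map_source hy)] with e he
    rw [formInChart_apply]
    simp only [fieldInChart, ofModel_toModel ((chartAt E x₀).map_target he)]
    rfl
  have hf : (fun e => f ((chartAt E y).symm e)) =ᶠ[𝓝 (chartAt E y y)]
      fun e => formInChart y η e fun i => toModel y y (u i) := by
    filter_upwards [(chartAt E y).open_target.mem_nhds ((chartAt E y).map_source hyy)] with e he
    rw [formInChart_apply]
    simp only [f, U, extend_eq_coordField ((chartAt E y).map_target he)]
    rfl
  have hfd : MDifferentiableAt 𝓘(ℝ, E) 𝓘(ℝ, ℝ) f y :=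
    (mdifferentiableAt_iff_comp_symm hyy f).2
      ((differentiableAt_form_iff.1 hd _).congr_of_eventuallyEq hf)
  have h1 := mvfderiv_eq_fderiv hy hfd v
  have h2 := mvfderiv_eq_fderiv hyy hfd v
  rw [hf₀.fderiv_eq, fderiv_continuousAlternatingMap_apply_apply hd₀ hUd] at h1
  rw [hf.fderiv_eq, ← fderiv_form_apply hd] at h2
  simp only [fieldInChart_chartAt hy, hUy, hu] at h1
  have h3 : endAct (christoffel cov y v) (η y) u = ∑ i, formInChart x₀ η (chartAt E x₀ y)
      (Function.update w i (fderiv ℝ (fieldInChart x₀ (U i)) (chartAt E x₀ y) (toModel x₀ y v) +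
        chris cov x₀ (chartAt E x₀ y) (toModel x₀ y v) (w i))) := by
    rw [endAct_apply]
    refine Finset.sum_congr rfl fun i _ => ?_
    have h4 : toModel x₀ y (christoffel cov y v (u i)) = _ :=
      toModel_cov cov hy ((hU i).mdifferentiableAt (by simp)) v
    rw [hUy, hu] at h4
    rw [← h4, formInChart_chartAt hy]
    change _ = η y fun j => ofModel x₀ y (Function.update w i _ j)
    congr 1
    funext j
    by_cases hj : j = i
    · subst hj
      simp [ofModel_toModel hy]
    · simp [hj, u]
  change fderiv ℝ (formInChart y η) (chartAt E y y) (toModel y y v) (fun i => toModel y y (u i)) -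
    endAct (christoffel cov y v) (η y) u = _ - endAct _ _ w
  rw [← h2, h1, h3, endAct_apply, add_sub_assoc, sub_eq_add_neg]
  congr 1
  simp only [ContinuousAlternatingMap.map_update_add, Finset.sum_add_distrib]
  rw [neg_add]
  exact add_neg_cancel_left _ _

/-- Every derivative of the extending fields disappears: the second derivatives of W by symmetry,
the first derivatives of U and V against the bracket term, and those of W between the two orders. -/
theorem toModel_curvature (cov : Connection E M) {x₀ y : M} (hy : y ∈ (chartAt E x₀).source)
    (hΓ : ContDiffAt ℝ ∞ (chris cov x₀) (chartAt E x₀ y)) (u v w : TangentSpace 𝓘(ℝ, E) y) :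
    toModel x₀ y (curvature cov y u v w) =
      fderiv ℝ (chris cov x₀) (chartAt E x₀ y) (toModel x₀ y u) (toModel x₀ y v) (toModel x₀ y w) -
      fderiv ℝ (chris cov x₀) (chartAt E x₀ y) (toModel x₀ y v) (toModel x₀ y u) (toModel x₀ y w) +
      chris cov x₀ (chartAt E x₀ y) (toModel x₀ y u)
        (chris cov x₀ (chartAt E x₀ y) (toModel x₀ y v) (toModel x₀ y w)) -
      chris cov x₀ (chartAt E x₀ y) (toModel x₀ y v)
        (chris cov x₀ (chartAt E x₀ y) (toModel x₀ y u) (toModel x₀ y w)) := by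
  let U : VField E M := FiberBundle.extend E u
  let V : VField E M := FiberBundle.extend E v
  let W : VField E M := FiberBundle.extend E w
  have hU' : ContDiffAt ℝ ∞ (fieldInChart x₀ U) (chartAt E x₀ y) :=
    (contMDiffAt_field_iff hy _).1 (contMDiffAt_extend u)
  have hV' : ContDiffAt ℝ ∞ (fieldInChart x₀ V) (chartAt E x₀ y) :=
    (contMDiffAt_field_iff hy _).1 (contMDiffAt_extend v)
  have hW' : ContDiffAt ℝ ∞ (fieldInChart x₀ W) (chartAt E x₀ y) :=
    (contMDiffAt_field_iff hy _).1 (contMDiffAt_extend w)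
  have hU : U y = u := FiberBundle.extend_apply_self _ u
  have hV : V y = v := FiberBundle.extend_apply_self _ v
  have hW : W y = w := FiberBundle.extend_apply_self _ w
  have hcov : ∀ Y : VField E M, fieldInChart x₀ (fun z => cov W z (Y z)) =ᶠ[𝓝 (chartAt E x₀ y)]
      fun e => fderiv ℝ (fieldInChart x₀ W) e (fieldInChart x₀ Y e) +
        chris cov x₀ e (fieldInChart x₀ Y e) (fieldInChart x₀ W e) := by
    intro Y
    have hc := (chartAt E x₀).continuousAt_symm ((chartAt E x₀).map_source hy)
    rw [ContinuousAt, (chartAt E x₀).left_inv hy] at hc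
    filter_upwards [(chartAt E x₀).open_target.mem_nhds ((chartAt E x₀).map_source hy),
      hc.eventually (contMDiffAt_extend_iff_eventually w)] with e he hWe
    have := toModel_cov cov ((chartAt E x₀).map_target he) (hWe.mdifferentiableAt (by simp))
      (Y ((chartAt E x₀).symm e))
    rw [(chartAt E x₀).right_inv he] at this
    exact this
  have hdW : ContDiffAt ℝ ∞ (fderiv ℝ (fieldInChart x₀ W)) (chartAt E x₀ y) :=
    hW'.fderiv_right (by exact_mod_cast le_rfl)
  have hsm : ∀ Y : VField E M, ContDiffAt ℝ ∞ (fieldInChart x₀ Y) (chartAt E x₀ y) →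
      ContDiffAt ℝ ∞ (fieldInChart x₀ (fun z => cov W z (Y z))) (chartAt E x₀ y) := fun Y hY =>
    ((hdW.clm_apply hY).add ((hΓ.clm_apply hY).clm_apply hW')).congr_of_eventuallyEq (hcov Y)
  -- The iterated derivative ∇_Z ∇_Y W at y, fully expanded in coordinates.
  have hmain : ∀ Y Z : VField E M, ContDiffAt ℝ ∞ (fieldInChart x₀ Y) (chartAt E x₀ y) →
      toModel x₀ y (cov (fun z => cov W z (Y z)) y (Z y)) =
      fderiv ℝ (fderiv ℝ (fieldInChart x₀ W)) (chartAt E x₀ y) (toModel x₀ y (Z y))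
        (toModel x₀ y (Y y)) +
      fderiv ℝ (fieldInChart x₀ W) (chartAt E x₀ y)
        (fderiv ℝ (fieldInChart x₀ Y) (chartAt E x₀ y) (toModel x₀ y (Z y))) +
      (fderiv ℝ (chris cov x₀) (chartAt E x₀ y) (toModel x₀ y (Z y)) (toModel x₀ y (Y y))
        (toModel x₀ y w) +
      chris cov x₀ (chartAt E x₀ y)
        (fderiv ℝ (fieldInChart x₀ Y) (chartAt E x₀ y) (toModel x₀ y (Z y))) (toModel x₀ y w) +
      chris cov x₀ (chartAt E x₀ y) (toModel x₀ y (Y y))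
        (fderiv ℝ (fieldInChart x₀ W) (chartAt E x₀ y) (toModel x₀ y (Z y)))) +
      chris cov x₀ (chartAt E x₀ y) (toModel x₀ y (Z y))
        (fderiv ℝ (fieldInChart x₀ W) (chartAt E x₀ y) (toModel x₀ y (Y y)) +
          chris cov x₀ (chartAt E x₀ y) (toModel x₀ y (Y y)) (toModel x₀ y w)) := by
    intro Y Z hY
    have hd1 := hdW.differentiableAt (by simp)
    have hd2 := hY.differentiableAt (by simp)
    have hd3 := hΓ.differentiableAt (by simp)
    have hd4 := hW'.differentiableAt (by simp)
    rw [toModel_cov cov hy ((contMDiffAt_field_iff hy _).2 (hsm Y hY) |>.mdifferentiableAt (by simp)),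
      (hcov Y).fderiv_eq, fderiv_fun_add (hd1.clm_apply hd2) ((hd3.clm_apply hd2).clm_apply hd4),
      fderiv_clm_apply hd1 hd2, fderiv_clm_apply (hd3.clm_apply hd2) hd4, fderiv_clm_apply hd3 hd2,
      ← fieldInChart_chartAt hy (fun z => cov W z (Y z)), (hcov Y).eq_of_nhds]
    simp only [add_apply, ContinuousLinearMap.comp_apply,
      ContinuousLinearMap.flip_apply, fieldInChart_chartAt hy, hW]
    abel
  have h1 := hmain V U hV'
  have h2 := hmain U V hU'
  have h3 := toModel_cov cov hy (W := W) ((contMDiffAt_extend w).mdifferentiableAt (by simp))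
    (VectorField.mlieBracket 𝓘(ℝ, E) U V y)
  rw [toModel_mlieBracket hy (U := U) (V := V)
    ((contMDiffAt_extend u).mdifferentiableAt (by simp))
    ((contMDiffAt_extend v).mdifferentiableAt (by simp))] at h3
  have hsymm := (hW'.isSymmSndFDerivAt (by simp; exact ENat.LEInfty.out)).eq (toModel x₀ y u) (toModel x₀ y v)
  rw [hU, hV] at h1 h2 h3
  rw [hW] at h3
  change toModel x₀ y (cov (fun z => cov W z (V z)) y u - cov (fun z => cov W z (U z)) y v -
    cov W y (VectorField.mlieBracket 𝓘(ℝ, E) U V y)) = _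
  rw [map_sub, map_sub, h1, h2, h3, hsymm]
  simp only [map_sub, map_add, sub_apply]
  abel

theorem chris_adjointConnection_eventuallyEq (cov : Connection E M) {x₀ y : M}
    (hy : y ∈ (chartAt E x₀).source) :
    chris (adjointConnection cov) x₀ =ᶠ[𝓝 (chartAt E x₀ y)] fun e => (chris cov x₀ e).flip := by
  filter_upwards [(chartAt E x₀).open_target.mem_nhds ((chartAt E x₀).map_source hy)] with e he
  ext v w
  have := chris_adjointConnection cov ((chartAt E x₀).map_target he) v w
  rwa [(chartAt E x₀).right_inv he] at this

theorem contDiffAt_flip {F : Type*} [NormedAddCommGroup F] [NormedSpace ℝ F]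
    {A : F → E →L[ℝ] E →L[ℝ] E} {p : F} (hA : ContDiffAt ℝ ∞ A p) :
    ContDiffAt ℝ ∞ (fun e => (A e).flip) p :=
  (ContinuousLinearMap.flipₗᵢ ℝ E E E).contDiff.contDiffAt.comp p hA

theorem fderiv_flip {F : Type*} [NormedAddCommGroup F] [NormedSpace ℝ F]
    {A : F → E →L[ℝ] E →L[ℝ] E} {p : F} (u : F) (v w : E) :
    fderiv ℝ (fun e => (A e).flip) p u v w = fderiv ℝ A p u w v := by
  have h : fderiv ℝ (fun e => (A e).flip) p = _ :=
    (ContinuousLinearMap.flipₗᵢ ℝ E E E).toContinuousLinearEquiv.comp_fderiv (f := A) (x := p)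
  rw [h]
  rfl

/-- The coordinate expression of the curvature of the adjoint connection, up to
antisymmetrization in `u` and `v`. -/
noncomputable def curvSymbol (cov : Connection E M) (x₀ : M) (e w u v : E) : E :=
  fderiv ℝ (chris cov x₀) e u w v - chris cov x₀ e (chris cov x₀ e w u) v

theorem toModel_curvature_adjoint (cov : Connection E M) {x₀ y : M}
    (hy : y ∈ (chartAt E x₀).source) (hΓ : ContDiffAt ℝ ∞ (chris cov x₀) (chartAt E x₀ y))
    (u v w : TangentSpace 𝓘(ℝ, E) y) :
    toModel x₀ y (curvature (adjointConnection cov) y u v w) =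
      curvSymbol cov x₀ (chartAt E x₀ y) (toModel x₀ y w) (toModel x₀ y u) (toModel x₀ y v) -
        curvSymbol cov x₀ (chartAt E x₀ y) (toModel x₀ y w) (toModel x₀ y v) (toModel x₀ y u) := by
  have h := chris_adjointConnection_eventuallyEq cov hy
  rw [toModel_curvature _ hy ((contDiffAt_flip hΓ).congr_of_eventuallyEq h), h.fderiv_eq,
    h.eq_of_nhds]
  simp only [curvSymbol, fderiv_flip, ContinuousLinearMap.flip_apply]
  abel

end CurvatureCharts

/-! ### Smoothness of matrix inversion by Cramer's rule. -/

section MatrixInverse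

variable {F : Type*} [NormedAddCommGroup F] [NormedSpace ℝ F] {m : Type*} [Fintype m]
  [DecidableEq m] {k : WithTop ℕ∞}

theorem contDiffAt_det {A : F → Matrix m m ℝ} {p : F}
    (hA : ∀ i j, ContDiffAt ℝ k (fun e => A e i j) p) : ContDiffAt ℝ k (fun e => (A e).det) p := by
  simp only [Matrix.det_apply]
  exact ContDiffAt.sum fun σ _ => (contDiffAt_prod fun i _ => hA _ _).const_smul _

theorem contDiffAt_matrix_inv {A : F → Matrix m m ℝ} {p : F}
    (hA : ∀ i j, ContDiffAt ℝ k (fun e => A e i j) p) (hp : (A p).det ≠ 0) (i j : m) :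
    ContDiffAt ℝ k (fun e => (A e)⁻¹ i j) p := by
  simp only [Matrix.inv_def, Matrix.smul_apply, Ring.inverse_eq_inv', smul_eq_mul,
    Matrix.adjugate_apply]
  refine ((contDiffAt_det hA).inv hp).mul (contDiffAt_det fun r s => ?_)
  by_cases hr : r = j
  · subst hr
    simpa using contDiffAt_const
  · simpa [Matrix.updateRow_ne hr] using hA r s

end MatrixInverse

/-! ### The cometric in a chart: trace formula, smoothness and parallelism. -/

namespace SubRiemannian

open Topology

variable {E : Type*} [NormedAddCommGroup E] [NormedSpace ℝ E]
  {M : Type*} [TopologicalSpace M] [ChartedSpace E M]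
  [FiniteDimensional ℝ E] [IsManifold 𝓘(ℝ, E) ∞ M] {n : ℕ} (S : SubRiemannian E M n)

/-- The rows of the cometric in the preferred chart at `x₀`. -/
noncomputable def cometricRow (x₀ : M) (a : Fin (Module.finrank ℝ E)) (e : E) : E :=
  S.trace ((chartAt E x₀).symm e) fun v w =>
    coordCLM E a (toModel x₀ ((chartAt E x₀).symm e) v) • toModel x₀ ((chartAt E x₀).symm e) w

theorem cometricRow_chartAt {x₀ y : M} (hy : y ∈ (chartAt E x₀).source)
    (a : Fin (Module.finrank ℝ E)) : S.cometricRow x₀ a (chartAt E x₀ y) =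
      S.trace y fun v w => coordCLM E a (toModel x₀ y v) • toModel x₀ y w := by
  unfold cometricRow
  rw [(chartAt E x₀).left_inv hy]

/-- With G_a = Σ_i e^a(v_i) v_i, the tensors Σ_i v_i ⊗ v_i and Σ_a e_a ⊗ G_a agree. This replaces
orthonormal bases, chosen point by point without any continuity, by data that depend smoothly on the
point. -/
theorem trace_eq_sum_cometricRow {W : Type*} [AddCommGroup W] [Module ℝ W] {x₀ y : M}
    (hy : y ∈ (chartAt E x₀).source)
    (ξ : TangentSpace 𝓘(ℝ, E) y →ₗ[ℝ] TangentSpace 𝓘(ℝ, E) y →ₗ[ℝ] W) :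
    S.trace y (fun v w => ξ v w) = ∑ a, ξ (ofModel x₀ y (Module.finBasis ℝ E a))
      (ofModel x₀ y (S.cometricRow x₀ a (chartAt E x₀ y))) := by
  have h : ∀ v w : TangentSpace 𝓘(ℝ, E) y, ξ v w =
      ∑ a, ξ (ofModel x₀ y (Module.finBasis ℝ E a)) (coordCLM E a (toModel x₀ y v) • w) := by
    intro v w
    conv_lhs => rw [← ofModel_toModel hy v, ← sum_coordCLM_smul (toModel x₀ y v)]
    simp only [map_sum, map_smul, LinearMap.sum_apply, LinearMap.smul_apply]
  simp only [cometricRow_chartAt S hy, trace, map_sum, map_smul, ofModel_toModel hy]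
  rw [Finset.sum_comm]
  refine Finset.sum_congr rfl fun i _ => ?_
  rw [h]
  simp only [map_smul]

theorem coord_cometricRow (x₀ : M) (a c : Fin (Module.finrank ℝ E)) (e : E) :
    (Module.finBasis ℝ E).coord a (S.cometricRow x₀ c e) =
      (Module.finBasis ℝ E).coord c (S.cometricRow x₀ a e) := by
  simp only [cometricRow, trace, map_sum, map_smul, smul_eq_mul, coordCLM_apply, mul_comm]

theorem cometric_eq_sum {x₀ y : M} (hy : y ∈ (chartAt E x₀).source)
    (α β : Module.Dual ℝ (TangentSpace 𝓘(ℝ, E) y)) :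
    S.cometric y α β = ∑ a, α (ofModel x₀ y (Module.finBasis ℝ E a)) *
      β (ofModel x₀ y (S.cometricRow x₀ a (chartAt E x₀ y))) :=
  S.trace_eq_sum_cometricRow hy ((LinearMap.mul ℝ ℝ).compl₁₂ α β)

/-- The horizontal trace in terms of the inverse Gram matrix of a basis. -/
theorem trace_eq_sum_gram (x : M) {W : Type*} [AddCommGroup W] [Module ℝ W]
    (ξ : TangentSpace 𝓘(ℝ, E) x →ₗ[ℝ] TangentSpace 𝓘(ℝ, E) x →ₗ[ℝ] W) {m : Type*} [Fintype m]
    [DecidableEq m] (X : Module.Basis m ℝ (S.H x)) :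
    (Matrix.of fun i j => (S.metric x).inner (X i) (X j)).det ≠ 0 ∧
    S.trace x (fun v w => ξ v w) = ∑ i, ∑ j,
      (Matrix.of fun i j => (S.metric x).inner (X i) (X j))⁻¹ i j • ξ (X i) (X j) := by
  let : NormedAddCommGroup (S.H x) := (S.metric x).toNormedAddCommGroup
  let : InnerProductSpace ℝ (S.H x) := InnerProductSpace.ofCore (S.metric x).toCore
  have hf : Orthonormal ℝ (S.frame x) := orthonormal_iff_ite.2 (S.frame_orthonormal x)
  let f := (S.frame x).toOrthonormalBasis hf
  have hfi : ∀ k, f k = S.frame x k := fun k => by simp [f]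
  let A : Matrix m m ℝ := Matrix.of fun i j => inner ℝ (X i) (X j)
  -- Q holds the components of Σ_k f_k ⊗ f_k in the basis X. Expanding X_l in the orthonormal basis
  -- f shows that Q inverts the Gram matrix.
  let Q : Matrix m m ℝ := Matrix.of fun i j => ∑ k, X.repr (f k) i * X.repr (f k) j
  have hQA : Q * A = 1 := by
    ext i l
    have h1 : X.repr (X l) i = ∑ k, inner ℝ (f k) (X l) * X.repr (f k) i := by
      conv_lhs => rw [← f.sum_repr' (X l)]
      simp
    have h2 : ∀ k, inner ℝ (f k) (X l) = ∑ j, X.repr (f k) j * inner ℝ (X j) (X l) := by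
      intro k
      conv_lhs => rw [← X.sum_repr (f k), sum_inner]
      simp only [real_inner_smul_left]
    rw [Matrix.mul_apply, Matrix.one_apply]
    have h3 : X.repr (X l) i = if i = l then 1 else 0 := by
      simp [Finsupp.single_apply, eq_comm]
    rw [← h3, h1]
    simp only [Q, A, Matrix.of_apply, h2, Finset.sum_mul]
    rw [Finset.sum_comm]
    refine Finset.sum_congr rfl fun k _ => Finset.sum_congr rfl fun j _ => ?_
    ring
  have hinv : A⁻¹ = Q := Matrix.inv_eq_left_inv hQA
  refine ⟨Matrix.det_ne_zero_of_left_inverse hQA, ?_⟩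
  change _ = ∑ i, ∑ j, A⁻¹ i j • ξ (X i) (X j)
  rw [hinv]
  have h4 : ∀ k, ξ (f k) (f k) = ∑ i, ∑ j, (X.repr (f k) i * X.repr (f k) j) • ξ (X i) (X j) := by
    intro k
    have h5 : ((f k : S.H x) : TangentSpace 𝓘(ℝ, E) x) =
        ∑ i, X.repr (f k) i • (X i : TangentSpace 𝓘(ℝ, E) x) := by
      have h6 := congrArg (S.H x).subtype (X.sum_repr (f k))
      rw [map_sum] at h6
      exact h6.symm
    conv_lhs => rw [h5]
    simp only [map_sum, map_smul, LinearMap.sum_apply, LinearMap.smul_apply, Finset.smul_sum,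
      smul_smul]
    rw [Finset.sum_comm]
    refine Finset.sum_congr rfl fun i _ => Finset.sum_congr rfl fun j _ => ?_
    rw [mul_comm]
  simp only [trace, ← hfi, h4, Q, Matrix.of_apply, Finset.sum_smul]
  rw [Finset.sum_comm]
  refine Finset.sum_congr rfl fun i _ => Finset.sum_comm

/-- A smooth local frame of H has a smooth invertible Gram matrix, and the trace is a contraction
with its inverse; no smooth orthonormal frame is needed. -/
theorem contDiffAt_cometricRow {x₀ y : M} (hy : y ∈ (chartAt E x₀).source)
    (a : Fin (Module.finrank ℝ E)) :
    ContDiffAt ℝ ∞ (S.cometricRow x₀ a) (chartAt E x₀ y) := by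
  obtain ⟨U, hU, hyU, X, hX, hspan⟩ := S.exists_frame y
  let Xb : ∀ z ∈ U, Module.Basis (Fin n) ℝ (S.H z) := fun z hz =>
    Module.Basis.mk (hspan z hz).1 (hspan z hz).2.ge
  have hXb : ∀ z hz i, Xb z hz i = X i z := fun z hz i => by simp [Xb]
  let A : E → Matrix (Fin n) (Fin n) ℝ := fun e => Matrix.of fun i j =>
    (S.metric ((chartAt E x₀).symm e)).inner (X i ((chartAt E x₀).symm e))
      (X j ((chartAt E x₀).symm e))
  have hXs : ∀ i, ContDiffAt ℝ ∞ (fieldInChart x₀ fun z => (X i z : TangentSpace 𝓘(ℝ, E) z))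
      (chartAt E x₀ y) := fun i =>
    (contMDiffAt_field_iff hy _).1 ((hX i y hyU).contMDiffAt (hU.mem_nhds hyU))
  have hA : ∀ i j, ContDiffAt ℝ ∞ (fun e => A e i j) (chartAt E x₀ y) := fun i j =>
    (contMDiffAt_iff_comp_symm (n := ⊤) hy
      (fun z => (S.metric z).inner (X i z) (X j z))).1
      ((S.smooth_metric U hU (X i) (X j) (hX i) (hX j) y hyU).contMDiffAt (hU.mem_nhds hyU))
  have htr : ∀ z (hz : z ∈ U), (Matrix.of fun i j => (S.metric z).inner (X i z) (X j z)).det ≠ 0 ∧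
      S.trace z (fun v w => coordCLM E a (toModel x₀ z v) • toModel x₀ z w) = ∑ i, ∑ j,
        (Matrix.of fun i j => (S.metric z).inner (X i z) (X j z))⁻¹ i j •
          (coordCLM E a (toModel x₀ z (X i z : TangentSpace 𝓘(ℝ, E) z)) •
            toModel x₀ z (X j z : TangentSpace 𝓘(ℝ, E) z)) := by
    intro z hz
    have h := S.trace_eq_sum_gram z ((LinearMap.lsmul ℝ E).compl₁₂
      ((coordCLM E a).toLinearMap ∘ₗ (toModel x₀ z).toLinearMap) (toModel x₀ z).toLinearMap)
      (Xb z hz)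
    simp only [hXb] at h
    exact h
  have hc := (chartAt E x₀).continuousAt_symm ((chartAt E x₀).map_source hy)
  rw [ContinuousAt, (chartAt E x₀).left_inv hy] at hc
  have hdet : (A (chartAt E x₀ y)).det ≠ 0 :=
    (htr _ (by rwa [(chartAt E x₀).left_inv hy])).1
  refine ContDiffAt.congr_of_eventuallyEq (f := fun e => ∑ i, ∑ j, (A e)⁻¹ i j •
    (coordCLM E a (fieldInChart x₀ (fun z => (X i z : TangentSpace 𝓘(ℝ, E) z)) e) •
      fieldInChart x₀ (fun z => (X j z : TangentSpace 𝓘(ℝ, E) z)) e)) ?_ ?_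
  · refine ContDiffAt.sum fun i _ => ContDiffAt.sum fun j _ => ?_
    exact (contDiffAt_matrix_inv hA hdet i j).smul
      (((coordCLM E a).contDiff.contDiffAt.comp _ (hXs i)).smul (hXs j))
  · filter_upwards [hc.eventually (hU.mem_nhds hyU)] with e he
    exact (htr _ he).2

/-- One-forms with constant coefficients in the chart, used to test parallelism. They need no
cutoff, because `IsParallelCometric` asks for smoothness at the given point only. -/
theorem exists_oneForm (x₀ : M) (α : E →L[ℝ] ℝ) : ∃ θ : KForm E M 1,
    (∀ y, ∀ w, covector (θ y) w = α (toModel x₀ y w)) ∧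
    ∀ y ∈ (chartAt E x₀).source, formInChart x₀ θ =ᶠ[𝓝 (chartAt E x₀ y)] fun _ =>
      ContinuousAlternatingMap.ofSubsingleton ℝ E ℝ (0 : Fin 1) α := by
  refine ⟨fun y => (ContinuousAlternatingMap.ofSubsingleton ℝ E ℝ (0 : Fin 1)
    α).compContinuousLinearMap (toModel x₀ y), fun y w => ?_, fun y hy => ?_⟩
  · rw [covector_apply]
    rfl
  · filter_upwards [(chartAt E x₀).open_target.mem_nhds ((chartAt E x₀).map_source hy)] with e he
    ext v
    rw [formInChart_apply]
    change α (toModel x₀ _ (ofModel x₀ _ (v 0))) = α (v 0)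
    rw [toModel_ofModel ((chartAt E x₀).map_target he)]

/-- Test the hypothesis on the coordinate forms e^a and e^c: their product is e^c(G_a), and ∇̂_v e^a
= −e^a(Γ(·)v) because the adjoint symbols are transposed. -/
theorem IsParallelCometric.fderiv_cometricRow {S : SubRiemannian E M n} {cov : Connection E M}
    (hS : S.IsParallelCometric (adjointConnection cov)) {x₀ y : M}
    (hy : y ∈ (chartAt E x₀).source) (a : Fin (Module.finrank ℝ E)) (v : E) :
    fderiv ℝ (S.cometricRow x₀ a) (chartAt E x₀ y) v =
      -chris cov x₀ (chartAt E x₀ y) (S.cometricRow x₀ a (chartAt E x₀ y)) v -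
        ∑ d, coordCLM E a (chris cov x₀ (chartAt E x₀ y) (Module.finBasis ℝ E d) v) •
          S.cometricRow x₀ d (chartAt E x₀ y) := by
  have hG := S.contDiffAt_cometricRow hy a
  refine (Module.finBasis ℝ E).ext_elem fun c => ?_
  change coordCLM E c _ = coordCLM E c _
  obtain ⟨θ, hθ, hθ'⟩ := exists_oneForm x₀ (coordCLM E a)
  obtain ⟨ζ, hζ, hζ'⟩ := exists_oneForm x₀ (coordCLM E c)
  have hδ : ∀ d, coordCLM E a (Module.finBasis ℝ E d) = if d = a then 1 else 0 := fun d => by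
    simp [coordCLM_apply, Finsupp.single_apply]
  have hsm : ∀ {σ : KForm E M 1} {α : E →L[ℝ] ℝ}, (∀ y ∈ (chartAt E x₀).source,
      formInChart x₀ σ =ᶠ[𝓝 (chartAt E x₀ y)] fun _ =>
        ContinuousAlternatingMap.ofSubsingleton ℝ E ℝ (0 : Fin 1) α) → SmoothFormAt σ y :=
    fun h => (smoothFormAt_iff hy).2 (contDiffAt_const.congr_of_eventuallyEq (h y hy))
  have hcv : ∀ {σ : KForm E M 1} {α : E →L[ℝ] ℝ}, (∀ y ∈ (chartAt E x₀).source,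
      formInChart x₀ σ =ᶠ[𝓝 (chartAt E x₀ y)] fun _ =>
        ContinuousAlternatingMap.ofSubsingleton ℝ E ℝ (0 : Fin 1) α) → ∀ w : E,
      covector (covForm (adjointConnection cov) σ y (ofModel x₀ y v)) (ofModel x₀ y w) =
        -α (chris cov x₀ (chartAt E x₀ y) w v) := by
    intro σ α h w
    have h1 := covForm_comp_ofModel (adjointConnection cov) hy (hsm h) (ofModel x₀ y v)
    rw [(h y hy).fderiv_eq, (h y hy).eq_of_nhds, toModel_ofModel hy] at h1
    have h2 := congrArg (fun f => f ![w]) h1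
    rw [covector_apply]
    have h3 : (![ofModel x₀ y w] : Fin 1 → TangentSpace 𝓘(ℝ, E) y) =
        fun i => ofModel x₀ y ((![w] : Fin 1 → E) i) := by
      funext i
      simp
    rw [h3]
    refine Eq.trans h2 ?_
    rw [ContinuousAlternatingMap.sub_apply, endAct_apply, fderiv_const_apply]
    change (0 : ℝ) - _ = _
    rw [zero_sub]
    simp only [Finset.univ_unique, Fin.default_eq_zero, Finset.sum_singleton]
    change -α (Function.update ![w] 0 (chris (adjointConnection cov) x₀ _ v w) 0) = _
    rw [Function.update_self, chris_adjointConnection cov hy]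
  have hpar := hS y θ ζ (hsm hθ') (hsm hζ') (ofModel x₀ y v)
  have hfun : (fun e => S.cometric ((chartAt E x₀).symm e) (covector (θ ((chartAt E x₀).symm e)))
      (covector (ζ ((chartAt E x₀).symm e)))) =ᶠ[𝓝 (chartAt E x₀ y)]
      fun e => coordCLM E c (S.cometricRow x₀ a e) := by
    filter_upwards [(chartAt E x₀).open_target.mem_nhds ((chartAt E x₀).map_source hy)] with e he
    have hz := (chartAt E x₀).map_target he
    rw [S.cometric_eq_sum hz]
    simp only [hθ, hζ, toModel_ofModel hz, hδ, (chartAt E x₀).right_inv he]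
    simp
  have hdiff : DifferentiableAt ℝ (fun e => coordCLM E c (S.cometricRow x₀ a e))
      (chartAt E x₀ y) :=
    (coordCLM E c).differentiableAt.comp _ (hG.differentiableAt (by simp))
  rw [mvfderiv_eq_fderiv hy ((mdifferentiableAt_iff_comp_symm hy (fun z =>
    S.cometric z (covector (θ z)) (covector (ζ z)))).2 (hdiff.congr_of_eventuallyEq hfun)), hfun.fderiv_eq, toModel_ofModel hy,
    S.cometric_eq_sum hy, S.cometric_eq_sum hy] at hpar
  simp only [hcv hθ', hcv hζ', hθ, hζ, toModel_ofModel hy, hδ] at hpar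
  have hL : fderiv ℝ (fun e => coordCLM E c (S.cometricRow x₀ a e)) (chartAt E x₀ y) =
      coordCLM E c ∘L fderiv ℝ (S.cometricRow x₀ a) (chartAt E x₀ y) :=
    ((coordCLM E c).hasFDerivAt.comp _ (hG.differentiableAt (by simp)).hasFDerivAt).fderiv
  rw [hL] at hpar
  refine Eq.trans hpar ?_
  simp only [map_sub, map_neg, map_sum, map_smul, smul_eq_mul, neg_mul, ite_mul, one_mul, zero_mul,
    Finset.sum_ite_eq', Finset.mem_univ, if_true, Finset.sum_neg_distrib]
  ring

end SubRiemannian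

/-! ### Skew-symmetry of the curvature; existence and smoothness of the Ricci fields. -/

section Ricci

open Topology

variable {E : Type*} [NormedAddCommGroup E] [NormedSpace ℝ E]
  {M : Type*} [TopologicalSpace M] [ChartedSpace E M]
  [FiniteDimensional ℝ E] [IsManifold 𝓘(ℝ, E) ∞ M] {n : ℕ} {S : SubRiemannian E M n}

noncomputable instance bilinNormedAddCommGroup : NormedAddCommGroup (E →L[ℝ] E →L[ℝ] E) :=
  ContinuousLinearMap.toNormedAddCommGroup

noncomputable instance bilinNormedSpace : NormedSpace ℝ (E →L[ℝ] E →L[ℝ] E) :=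
  ContinuousLinearMap.toNormedSpace

/-- The coordinate expression of the curvature of the adjoint connection. -/
noncomputable def curvModel (cov : Connection E M) (x₀ : M) (e : E) :
    E →ₗ[ℝ] E →ₗ[ℝ] Module.End ℝ E :=
  LinearMap.mk₂ ℝ (fun u v =>
    { toFun := fun w => curvSymbol cov x₀ e w u v - curvSymbol cov x₀ e w v u
      map_add' := fun w w' => by simp only [curvSymbol, map_add, add_apply]; abel
      map_smul' := fun c w => by
        simp only [curvSymbol, map_smul, smul_apply, ← smul_sub, RingHom.id_apply] })
    (fun u u' v => by ext w; simp [curvSymbol]; abel)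
    (fun c u v => by ext w; simp [curvSymbol, smul_sub])
    (fun u v v' => by ext w; simp [curvSymbol]; abel)
    (fun c u v => by ext w; simp [curvSymbol, smul_sub])

theorem curvModel_apply (cov : Connection E M) (x₀ : M) (e u v w : E) :
    curvModel cov x₀ e u v w = curvSymbol cov x₀ e w u v - curvSymbol cov x₀ e w v u := rfl

theorem curvModel_swap (cov : Connection E M) (x₀ : M) (e u v : E) :
    curvModel cov x₀ e v u = -curvModel cov x₀ e u v := by
  ext w
  rw [LinearMap.neg_apply, curvModel_apply, curvModel_apply, neg_sub]

theorem contDiffAt_curvModel {cov : Connection E M} {x₀ : M} {p : E}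
    (hΓ : ContDiffAt ℝ ∞ (chris cov x₀) p) {u v w : E → E} (hu : ContDiffAt ℝ ∞ u p)
    (hv : ContDiffAt ℝ ∞ v p) (hw : ContDiffAt ℝ ∞ w p) :
    ContDiffAt ℝ ∞ (fun e => curvModel cov x₀ e (u e) (v e) (w e)) p := by
  have hd : ContDiffAt ℝ ∞ (fderiv ℝ (chris cov x₀)) p :=
    hΓ.fderiv_right (by exact_mod_cast le_rfl)
  simp only [curvModel_apply, curvSymbol]
  exact (((hd.clm_apply hu).clm_apply hw).clm_apply hv |>.sub
    ((hΓ.clm_apply ((hΓ.clm_apply hw).clm_apply hu)).clm_apply hv)).sub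
    (((hd.clm_apply hv).clm_apply hw).clm_apply hu |>.sub
    ((hΓ.clm_apply ((hΓ.clm_apply hw).clm_apply hv)).clm_apply hu))

/-- The curvature of the adjoint connection as a trilinear map. -/
noncomputable def curvTensor (cov : Connection E M) {x₀ y : M} (hy : y ∈ (chartAt E x₀).source) :
    TangentSpace 𝓘(ℝ, E) y →ₗ[ℝ] TangentSpace 𝓘(ℝ, E) y →ₗ[ℝ]
      Module.End ℝ (TangentSpace 𝓘(ℝ, E) y) :=
  ((curvModel cov x₀ (chartAt E x₀ y)).compl₁₂ (toModel x₀ y).toLinearMap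
    (toModel x₀ y).toLinearMap).compr₂ (modelEquiv hy).toLinearEquiv.conj.toLinearMap

theorem curvTensor_apply (cov : Connection E M) {x₀ y : M} (hy : y ∈ (chartAt E x₀).source)
    (u v w : TangentSpace 𝓘(ℝ, E) y) : curvTensor cov hy u v w =
      ofModel x₀ y (curvModel cov x₀ (chartAt E x₀ y) (toModel x₀ y u) (toModel x₀ y v)
        (toModel x₀ y w)) := rfl

theorem curvature_eq_curvTensor {cov : Connection E M} {x₀ y : M}
    (hy : y ∈ (chartAt E x₀).source) (hΓ : ContDiffAt ℝ ∞ (chris cov x₀) (chartAt E x₀ y))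
    (u v w : TangentSpace 𝓘(ℝ, E) y) :
    curvature (adjointConnection cov) y u v w = curvTensor cov hy u v w := by
  rw [curvTensor_apply, curvModel_apply, ← toModel_curvature_adjoint cov hy hΓ, ofModel_toModel hy]

/-- The curvature of a metric connection is skew-symmetric. -/
theorem curvModel_cometricRow {cov : Connection E M}
    (hS : S.IsParallelCometric (adjointConnection cov)) {x₀ y : M}
    (hy : y ∈ (chartAt E x₀).source) (hΓ : ContDiffAt ℝ ∞ (chris cov x₀) (chartAt E x₀ y))
    (u v : E) (a : Fin (Module.finrank ℝ E)) :
    curvModel cov x₀ (chartAt E x₀ y) u v (S.cometricRow x₀ a (chartAt E x₀ y)) =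
      -∑ d, coordCLM E a (curvModel cov x₀ (chartAt E x₀ y) u v (Module.finBasis ℝ E d)) •
        S.cometricRow x₀ d (chartAt E x₀ y) := by
  set p := chartAt E x₀ y with hp
  let b := Module.finBasis ℝ E
  let Γ := chris cov x₀
  let G := S.cometricRow x₀
  have hG := fun a => S.contDiffAt_cometricRow hy a
  have hGd : ∀ a, DifferentiableAt ℝ (G a) p := fun a => (hG a).differentiableAt (by simp)
  have hΓd : DifferentiableAt ℝ Γ p := hΓ.differentiableAt (by simp)
  have hD : ∀ v a, (fun e => fderiv ℝ (G a) e v) =ᶠ[𝓝 p] fun e => -Γ e (G a e) v -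
      ∑ d, coordCLM E a (Γ e (b d) v) • G d e := by
    intro v a
    filter_upwards [(chartAt E x₀).open_target.mem_nhds ((chartAt E x₀).map_source hy)] with e he
    have := hS.fderiv_cometricRow ((chartAt E x₀).map_target he) a v
    rwa [(chartAt E x₀).right_inv he] at this
  have hDp : ∀ v a, fderiv ℝ (G a) p v = -Γ p (G a p) v -
      ∑ d, coordCLM E a (Γ p (b d) v) • G d p := fun v a => (hD v a).eq_of_nhds
  -- T collects the products of two symbols standing on opposite sides of the cometric. They enter
  -- the second derivative as T u v + T v u and so cancel on antisymmetrization.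
  let T : E → E → E := fun u v => ∑ d, coordCLM E a (Γ p (b d) u) • Γ p (G d p) v
  -- The parallelism equation holds on a neighbourhood, so it may be differentiated once more. The
  -- result is then inserted into the symmetry of the second derivative of G_a.
  have h2 : ∀ u v, fderiv ℝ (fderiv ℝ (G a)) p u v =
      -curvSymbol cov x₀ p (G a p) u v -
        (∑ d, coordCLM E a (curvSymbol cov x₀ p (b d) u v) • G d p) + (T u v + T v u) := by
    intro u v
    have hdd : DifferentiableAt ℝ (fderiv ℝ (G a)) p :=
      ((hG a).fderiv_right (m := ∞) (by exact_mod_cast le_rfl)).differentiableAt (by simp)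
    have e1 : fderiv ℝ (fderiv ℝ (G a)) p u v = fderiv ℝ (fun e => fderiv ℝ (G a) e v) p u := by
      rw [fderiv_clm_apply hdd (differentiableAt_const v)]
      simp
    have hf1 : HasFDerivAt (fun e => Γ e (G a e) v) _ p :=
      (hΓd.hasFDerivAt.clm_apply (hGd a).hasFDerivAt).clm_apply (hasFDerivAt_const v p)
    have hf2 : ∀ d, HasFDerivAt (fun e => coordCLM E a (Γ e (b d) v) • G d e) _ p := fun d =>
      ((coordCLM E a).hasFDerivAt.comp p ((hΓd.hasFDerivAt.clm_apply
        (hasFDerivAt_const (b d) p)).clm_apply (hasFDerivAt_const v p))).smul (hGd d).hasFDerivAt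
    rw [e1, (hD v a).fderiv_eq, (hf1.fun_neg.fun_sub (HasFDerivAt.fun_sum fun d _ => hf2 d)).fderiv]
    have e2 : ∀ f, coordCLM E a (Γ p (Γ p (b f) u) v) =
        ∑ d, coordCLM E a (Γ p (b d) v) * coordCLM E d (Γ p (b f) u) := by
      intro f
      conv_lhs => rw [← sum_coordCLM_smul (Γ p (b f) u)]
      simp only [map_sum, map_smul, sum_apply, smul_apply, smul_eq_mul, mul_comm, b]
    have e3 : ∑ d, coordCLM E a (Γ p (b d) v) • ∑ f, coordCLM E d (Γ p (b f) u) • G f p =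
        ∑ f, coordCLM E a (Γ p (Γ p (b f) u) v) • G f p := by
      simp only [e2, Finset.sum_smul, Finset.smul_sum, smul_smul]
      exact Finset.sum_comm
    simp [hDp, curvSymbol, T, Finset.sum_add_distrib, Finset.sum_sub_distrib, sub_smul, smul_sub]
    rw [e3]
    change _ = Γ p (Γ p (G a p) u) v - fderiv ℝ Γ p u (G a p) v -
      (∑ d, coordCLM E a (fderiv ℝ Γ p u (b d) v) • G d p -
        ∑ d, coordCLM E a (Γ p (Γ p (b d) u) v) • G d p) +
      ((∑ d, coordCLM E a (Γ p (b d) u) • Γ p (G d p) v) +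
        ∑ d, coordCLM E a (Γ p (b d) v) • Γ p (G d p) u)
    abel
  have hsymm := ((hG a).isSymmSndFDerivAt (by simp; exact ENat.LEInfty.out)).eq u v
  have h3 := (h2 u v).symm.trans (hsymm.trans (h2 v u))
  simp only [curvModel_apply, map_sub, sub_smul, Finset.sum_sub_distrib]
  rw [add_comm (T u v)] at h3
  have h4 := add_right_cancel h3
  change curvSymbol cov x₀ p (G a p) u v - curvSymbol cov x₀ p (G a p) v u = _
  rw [← sub_eq_zero] at h4 ⊢
  rw [← neg_eq_zero, ← h4]
  simp only [b, G]
  abel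

theorem exists_ric_one_one [T2Space M] (S : SubRiemannian E M n) (cov : Connection E M)
    [CovariantDerivative.ContMDiffCovariantDerivative cov ∞] (x : M) :
    ∃ ν : PsiFiber (TangentSpace 𝓘(ℝ, E) x) 1 1, ∀ v α, psiEval ν ![v] ![α] =
      α (-S.trace x fun u u' => curvature (adjointConnection cov) x u v u') := by
  have hx := mem_chart_source E x
  have hΓ := contDiffAt_chris cov hx
  obtain ⟨ν, hν⟩ := exists_psi_one_one (-∑ i, (curvTensor cov hx
    (S.frame x i : TangentSpace 𝓘(ℝ, E) x)).flip (S.frame x i : TangentSpace 𝓘(ℝ, E) x))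
  refine ⟨ν, fun v α => ?_⟩
  rw [hν]
  simp only [SubRiemannian.trace, curvature_eq_curvTensor hx hΓ, LinearMap.neg_apply,
    LinearMap.sum_apply, LinearMap.flip_apply]

/-- The bilinear form `⟨-A^* α, β⟩` on covectors. -/
noncomputable def dualPairing {V ι : Type*} [AddCommGroup V] [Module ℝ V] [Fintype ι]
    (t s : ι → V) : Module.End ℝ V →ₗ[ℝ] Module.Dual ℝ V →ₗ[ℝ] Module.Dual ℝ V →ₗ[ℝ] ℝ where
  toFun A := LinearMap.mk₂ ℝ (fun α β => ∑ a, -α (A (t a)) * β (s a))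
    (fun α α' β => by simp [add_mul, Finset.sum_add_distrib, -neg_add_rev, neg_add])
    (fun c α β => by simp [Finset.mul_sum, mul_assoc])
    (fun α β β' => by simp [mul_add, Finset.sum_add_distrib])
    (fun c α β => by simp [Finset.mul_sum, mul_left_comm])
  map_add' A B := by
    ext α β
    simp [add_mul, Finset.sum_add_distrib, -neg_add_rev, neg_add]
  map_smul' c A := by
    ext α β
    simp [Finset.mul_sum, mul_assoc]

theorem dualPairing_apply {V ι : Type*} [AddCommGroup V] [Module ℝ V] [Fintype ι]
    (t s : ι → V) (A : Module.End ℝ V) (α β : Module.Dual ℝ V) :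
    dualPairing t s A α β = ∑ a, -α (A (t a)) * β (s a) := rfl

theorem cometric_curvature [T2Space M] (S : SubRiemannian E M n) (cov : Connection E M)
    [CovariantDerivative.ContMDiffCovariantDerivative cov ∞] {x₀ y : M}
    (hy : y ∈ (chartAt E x₀).source) (v w : TangentSpace 𝓘(ℝ, E) y)
    (α β : Module.Dual ℝ (TangentSpace 𝓘(ℝ, E) y)) :
    S.cometric y (fun u => -α (curvature (adjointConnection cov) y v w u)) β =
      dualPairing (fun a => ofModel x₀ y (Module.finBasis ℝ E a))
        (fun a => ofModel x₀ y (S.cometricRow x₀ a (chartAt E x₀ y))) (curvTensor cov hy v w) α β := by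
  have h : (fun u => -α (curvature (adjointConnection cov) y v w u)) =
      (-α ∘ₗ curvTensor cov hy v w : Module.Dual ℝ (TangentSpace 𝓘(ℝ, E) y)) := by
    funext u
    rw [curvature_eq_curvTensor hy (contDiffAt_chris cov hy)]
    rfl
  rw [h, S.cometric_eq_sum hy]
  rfl

/-- Skewness in v, w is built into the curvature. Skewness in α, β is metricity, in the form of
`curvModel_cometricRow`. -/
theorem exists_ric_two_two [T2Space M] (cov : Connection E M)
    [CovariantDerivative.ContMDiffCovariantDerivative cov ∞]
    (hS : S.IsParallelCometric (adjointConnection cov)) (x : M) :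
    ∃ ν : PsiFiber (TangentSpace 𝓘(ℝ, E) x) 2 2, ∀ v w α β, psiEval ν ![v, w] ![α, β] =
      2 * S.cometric x (fun u => -α (curvature (adjointConnection cov) x v w u)) β := by
  have hx := mem_chart_source E x
  let p := chartAt E x x
  let b := Module.finBasis ℝ E
  let G := fun a => S.cometricRow x a p
  let B := dualPairing (fun a => ofModel x x (b a)) (fun a => ofModel x x (G a))
  obtain ⟨ν, hν⟩ := exists_psi_two_two ((2 : ℝ) • (curvTensor cov hx).compr₂ B)
    (fun v w α β => by
      have h : curvTensor cov hx v w = -curvTensor cov hx w v := by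
        ext u
        rw [LinearMap.neg_apply, curvTensor_apply, curvTensor_apply, curvModel_swap,
          LinearMap.neg_apply, map_neg]
      simp only [LinearMap.smul_apply, LinearMap.compr₂_apply, h, map_neg, LinearMap.neg_apply,
        smul_neg])
    (fun v w α β => by
      let R := curvModel cov x p (toModel x x v) (toModel x x w)
      have hR : ∀ a, R (G a) = -∑ d, coordCLM E a (R (b d)) • G d := fun a =>
        curvModel_cometricRow hS hx (contDiffAt_chris cov hx) _ _ a
      have hsum : ∀ α β : Module.Dual ℝ (TangentSpace 𝓘(ℝ, E) x), B (curvTensor cov hx v w) α β =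
          ∑ a, -α (ofModel x x (R (b a))) * β (ofModel x x (G a)) := by
        intro α β
        simp only [B, dualPairing_apply, curvTensor_apply, toModel_ofModel hx]
        rfl
      let A : Module.Dual ℝ E := α ∘ₗ (ofModel x x).toLinearMap
      let B' : Module.Dual ℝ E := β ∘ₗ (ofModel x x).toLinearMap
      -- Symmetry of the cometric first moves G_a inside the curvature, where `hskew` can then
      -- transfer R to the other factor with a sign.
      have htrace : ∑ a, A (R (b a)) * B' (G a) = ∑ a, A (R (G a)) * B' (b a) :=
        trace_symm b G (fun a c => S.coord_cometricRow x a c p)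
          ((LinearMap.mul ℝ ℝ).compl₁₂ (A ∘ₗ R) B')
      have hskew : ∑ a, A (R (G a)) * B' (b a) = -∑ d, A (G d) * B' (R (b d)) := by
        have h1 : ∀ d, B' (R (b d)) = ∑ a, coordCLM E a (R (b d)) * B' (b a) := fun d => by
          conv_lhs => rw [← sum_coordCLM_smul (R (b d))]
          simp only [map_sum, map_smul, smul_eq_mul, b]
        simp only [hR, h1, map_neg, map_sum, map_smul, smul_eq_mul, neg_mul, Finset.sum_mul,
          Finset.mul_sum, Finset.sum_neg_distrib]
        rw [Finset.sum_comm]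
        refine congrArg _ (Finset.sum_congr rfl fun d _ => Finset.sum_congr rfl fun a _ => ?_)
        ring
      have h2 : B (curvTensor cov hx v w) α β = -∑ a, A (R (b a)) * B' (G a) := by
        rw [hsum, ← Finset.sum_neg_distrib]
        exact Finset.sum_congr rfl fun a _ => neg_mul _ _
      have h3 : B (curvTensor cov hx v w) β α = -∑ a, A (G a) * B' (R (b a)) := by
        rw [hsum, ← Finset.sum_neg_distrib]
        exact Finset.sum_congr rfl fun a _ => (neg_mul _ _).trans (congrArg _ (mul_comm _ _))
      simp only [LinearMap.smul_apply, LinearMap.compr₂_apply, h2, h3, htrace, hskew, smul_neg])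
  refine ⟨ν, fun v w α β => ?_⟩
  rw [hν, cometric_curvature S cov hx]
  rfl

theorem contDiffAt_covector {x₀ y : M} (hy : y ∈ (chartAt E x₀).source) {θ : KForm E M 1}
    (hθ : SmoothFormAt θ y) {X : E → E} (hX : ContDiffAt ℝ ∞ X (chartAt E x₀ y)) :
    ContDiffAt ℝ ∞ (fun e => covector (θ ((chartAt E x₀).symm e))
      (ofModel x₀ ((chartAt E x₀).symm e) (X e))) (chartAt E x₀ y) := by
  refine (((smoothFormAt_iff hy).1 hθ).form_apply (X := fun _ => X) fun _ => hX).congr_of_eventuallyEq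
    (Filter.Eventually.of_forall fun e => ?_)
  simp only [covector_apply, formInChart_apply]
  congr 1
  funext i
  simp

/-- Near x the pairing is an explicit expression in Γ, ∂Γ, the cometric rows and the components of
the test fields, all taken in the chart at x and all smooth there. -/
theorem smoothPsi_ric_one_one [T2Space M] {cov : Connection E M}
    [CovariantDerivative.ContMDiffCovariantDerivative cov ∞]
    {ρ : Π x : M, PsiFiber (TangentSpace 𝓘(ℝ, E) x) 1 1}
    (hρ : S.IsRic₁₁ (adjointConnection cov) ρ) : SmoothPsi ρ := by
  intro U hU Y θ hY hθ x hxU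
  have hx := mem_chart_source E x
  refine ContMDiffAt.contMDiffWithinAt ((contMDiffAt_iff_comp_symm (n := ⊤) hx _).2 ?_)
  have hYx : ContDiffAt ℝ ∞ (fieldInChart x (Y 0)) (chartAt E x x) :=
    (contMDiffAt_field_iff hx _).1 ((hY 0 x hxU).contMDiffAt (hU.mem_nhds hxU))
  let b := Module.finBasis ℝ E
  refine ContDiffAt.congr_of_eventuallyEq (f := fun e => -∑ a,
    covector (θ 0 ((chartAt E x).symm e)) (ofModel x ((chartAt E x).symm e)
      (curvModel cov x e (b a) (fieldInChart x (Y 0) e) (S.cometricRow x a e)))) ?_ ?_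
  · exact (ContDiffAt.sum fun a _ => contDiffAt_covector hx (hθ 0 x hxU)
      (contDiffAt_curvModel (contDiffAt_chris cov hx) contDiffAt_const hYx
        (S.contDiffAt_cometricRow hx a))).neg
  · filter_upwards [(chartAt E x).open_target.mem_nhds ((chartAt E x).map_source hx)] with e he
    have hz := (chartAt E x).map_target he
    have h := hρ ((chartAt E x).symm e) (Y 0 _) (covector (θ 0 ((chartAt E x).symm e)))
    have e1 : ∀ {A : Type _} (f : Fin 1 → A), f = ![f 0] := fun f => by
      funext i
      rw [Subsingleton.elim i 0]
      rfl
    rw [e1 (fun a => Y a _), e1 (fun b => covector (θ b _)), h]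
    have h2 := S.trace_eq_sum_cometricRow hz ((curvTensor cov hz).flip (Y 0 _))
    simp only [curvature_eq_curvTensor hz (contDiffAt_chris cov hz)]
    refine (congrArg (fun t => covector (θ 0 ((chartAt E x).symm e)) (-t)) h2).trans ?_
    simp only [map_neg, map_sum]
    refine congrArg _ (Finset.sum_congr rfl fun a _ => ?_)
    change covector _ (ofModel x _ (curvModel _ _ _ (toModel x _ (ofModel x _ (b a))) _
      (toModel x _ (ofModel x _ _)))) = _
    rw [toModel_ofModel hz, toModel_ofModel hz, (chartAt E x).right_inv he]
    rfl

theorem smoothPsi_ric_two_two [T2Space M] {cov : Connection E M}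
    [CovariantDerivative.ContMDiffCovariantDerivative cov ∞]
    {ρ : Π x : M, PsiFiber (TangentSpace 𝓘(ℝ, E) x) 2 2}
    (hρ : S.IsRic₂₂ (adjointConnection cov) ρ) : SmoothPsi ρ := by
  intro U hU Y θ hY hθ x hxU
  have hx := mem_chart_source E x
  refine ContMDiffAt.contMDiffWithinAt ((contMDiffAt_iff_comp_symm (n := ⊤) hx _).2 ?_)
  have hYx : ∀ i, ContDiffAt ℝ ∞ (fieldInChart x (Y i)) (chartAt E x x) := fun i =>
    (contMDiffAt_field_iff hx _).1 ((hY i x hxU).contMDiffAt (hU.mem_nhds hxU))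
  let b := Module.finBasis ℝ E
  refine ContDiffAt.congr_of_eventuallyEq (f := fun e => 2 * ∑ a,
    -covector (θ 0 ((chartAt E x).symm e)) (ofModel x ((chartAt E x).symm e)
      (curvModel cov x e (fieldInChart x (Y 0) e) (fieldInChart x (Y 1) e) (b a))) *
    covector (θ 1 ((chartAt E x).symm e)) (ofModel x ((chartAt E x).symm e)
      (S.cometricRow x a e))) ?_ ?_
  · exact contDiffAt_const.mul (ContDiffAt.sum fun a _ => (contDiffAt_covector hx (hθ 0 x hxU)
      (contDiffAt_curvModel (contDiffAt_chris cov hx) (hYx 0) (hYx 1) contDiffAt_const)).neg.mul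
      (contDiffAt_covector hx (hθ 1 x hxU) (S.contDiffAt_cometricRow hx a)))
  · filter_upwards [(chartAt E x).open_target.mem_nhds ((chartAt E x).map_source hx)] with e he
    have hz := (chartAt E x).map_target he
    have h := hρ ((chartAt E x).symm e) (Y 0 _) (Y 1 _) (covector (θ 0 ((chartAt E x).symm e)))
      (covector (θ 1 ((chartAt E x).symm e)))
    have e1 : ∀ {A : Type _} (f : Fin 2 → A), f = ![f 0, f 1] := fun f => by
      funext i
      fin_cases i <;> rfl
    rw [e1 (fun a => Y a _), e1 (fun b => covector (θ b _)), h, cometric_curvature S cov hz,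
      dualPairing_apply]
    simp only [curvTensor_apply, toModel_ofModel hz, (chartAt E x).right_inv he]
    rfl

end Ricci

/-! ### Contraction and derivations as continuous bilinear maps. -/

section FormOperators

variable (E : Type*) [NormedAddCommGroup E] [NormedSpace ℝ E] [FiniteDimensional ℝ E]

/-- `contractForm` as a continuous bilinear map. -/
noncomputable def contractCLM (k : ℕ) :
    E →L[ℝ] (E [⋀^Fin (k + 1)]→L[ℝ] ℝ) →L[ℝ] (E [⋀^Fin k]→L[ℝ] ℝ) :=
  LinearMap.toContinuousBilinearMap (LinearMap.mk₂ ℝ contractForm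
    (fun X Y η => by ext v; exact η.vecCons_add v X Y)
    (fun c X η => by ext v; exact η.vecCons_smul v c X)
    (fun X η θ => by ext v; rfl)
    (fun c X η => by ext v; rfl))

/-- `endAct` as a continuous bilinear map. -/
noncomputable def endActCLM (k : ℕ) :
    (E →L[ℝ] E) →L[ℝ] (E [⋀^Fin k]→L[ℝ] ℝ) →L[ℝ] (E [⋀^Fin k]→L[ℝ] ℝ) :=
  LinearMap.toContinuousBilinearMap (LinearMap.mk₂ ℝ (fun A η => endAct A.toLinearMap η)
    (fun A B η => by ext v; simp [endAct_apply, Finset.sum_add_distrib])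
    (fun c A η => by ext v; simp [endAct_apply, Finset.mul_sum])
    (fun A η θ => by ext v; simp [endAct_apply, Finset.sum_add_distrib])
    (fun c A η => by ext v; simp [endAct_apply, Finset.mul_sum]))

variable {E} {k : ℕ}

theorem alternatizeUncurryFin_eq_sum_wedgeForm {ι : Type*} [Fintype ι] (b : Module.Basis ι ℝ E)
    (L : E →L[ℝ] E [⋀^Fin k]→L[ℝ] ℝ) :
    ContinuousAlternatingMap.alternatizeUncurryFin L = ∑ c, wedgeForm (b.coord c) (L (b c)) := by
  ext v
  rw [ContinuousAlternatingMap.sum_apply]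
  simp only [wedgeForm_apply]
  rw [Finset.sum_comm, ContinuousAlternatingMap.alternatizeUncurryFin_apply]
  refine Finset.sum_congr rfl fun i _ => ?_
  rw [← Finset.smul_sum]
  congr 1
  exact (sum_coord_smul b ((formEval (i.removeNth v)).comp L).toLinearMap (v i)).symm

end FormOperators

/-! ### Mixed forms in a chart, differentiated one degree at a time. -/

section MixedCharts

open Topology

variable {E : Type*} [NormedAddCommGroup E] [NormedSpace ℝ E]
  {M : Type*} [TopologicalSpace M] [ChartedSpace E M]
  [FiniteDimensional ℝ E] [IsManifold 𝓘(ℝ, E) ∞ M] {k : ℕ}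

/-- The expression of a mixed form in the preferred chart at `x₀`. -/
noncomputable def mixedInChart (x₀ : M) (η : DForm E M) (e : E) : MixedForm E :=
  fun k => formInChart x₀ (fun y => η y k) e

/-- The derivative of the chart expression of a mixed form. -/
noncomputable def derivInChart (x₀ : M) (η : DForm E M) (e : E) : E →ₗ[ℝ] MixedForm E :=
  LinearMap.pi fun k => (fderiv ℝ (formInChart x₀ fun y => η y k) e).toLinearMap

/-- The second derivative of the chart expression of a mixed form. -/
noncomputable def secondDerivInChart (x₀ : M) (η : DForm E M) (e : E) :
    E →ₗ[ℝ] E →ₗ[ℝ] MixedForm E :=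
  LinearMap.mk₂ ℝ (fun v w k => fderiv ℝ (fderiv ℝ (formInChart x₀ fun y => η y k)) e v w)
    (fun v v' w => by funext k; simp) (fun c v w => by funext k; simp)
    (fun v w w' => by funext k; simp) (fun c v w => by funext k; simp)

/-- The Christoffel symbols as an algebraic bilinear map. -/
noncomputable def chrisLin (cov : Connection E M) (x₀ : M) (e : E) : E →ₗ[ℝ] E →ₗ[ℝ] E :=
  ContinuousLinearMap.coeLM ℝ ∘ₗ (chris cov x₀ e).toLinearMap

/-- The derivative of the Christoffel symbols as an algebraic trilinear map. -/
noncomputable def chrisDerivLin (cov : Connection E M) (x₀ : M) (e : E) :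
    E →ₗ[ℝ] E →ₗ[ℝ] E →ₗ[ℝ] E :=
  LinearMap.mk₂ ℝ (fun u v => (fderiv ℝ (chris cov x₀) e u v).toLinearMap)
    (fun u u' v => by ext w; simp) (fun c u v => by ext w; simp)
    (fun u v v' => by ext w; simp) (fun c u v => by ext w; simp)

/-- The covariant derivative of a mixed form in the preferred chart at `x₀`. -/
noncomputable def covInChart (cov : Connection E M) (x₀ : M) (η : DForm E M) (e : E) :
    E →ₗ[ℝ] MixedForm E :=
  derivInChart x₀ η e - (endActEnd.flip (mixedInChart x₀ η e)) ∘ₗ chrisLin cov x₀ e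

theorem covInChart_apply (cov : Connection E M) (x₀ : M) (η : DForm E M) (e v : E) :
    covInChart cov x₀ η e v =
      derivInChart x₀ η e v - endActEnd (chrisLin cov x₀ e v) (mixedInChart x₀ η e) := rfl

theorem mixedPull_ofModel {x₀ y : M} (hy : y ∈ (chartAt E x₀).source) (η : DForm E M) :
    mixedPull (ofModel x₀ y) (η y) = mixedInChart x₀ η (chartAt E x₀ y) :=
  funext fun k => (formInChart_chartAt hy fun y => η y k).symm

theorem mixedPull_ofModel_injective {x₀ y : M} (hy : y ∈ (chartAt E x₀).source) :
    Function.Injective (mixedPull (ofModel (E := E) x₀ y)) :=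
  mixedPull_injective (modelEquiv hy)

theorem mixedPull_nabla (cov : Connection E M) {x₀ y : M} (hy : y ∈ (chartAt E x₀).source)
    {η : DForm E M} (hη : ∀ k, SmoothFormAt (fun z => η z k) y) (v : TangentSpace 𝓘(ℝ, E) y) :
    mixedPull (ofModel x₀ y) (nabla cov η y v) =
      covInChart cov x₀ η (chartAt E x₀ y) (toModel x₀ y v) :=
  funext fun k => covForm_comp_ofModel cov hy (hη k) v

theorem mixedInChart_dForm {x₀ y : M} (hy : y ∈ (chartAt E x₀).source)
    {η : DForm E M} (hη : ∀ k, SmoothFormAt (fun z => η z k) y) :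
    mixedInChart x₀ (dForm η) (chartAt E x₀ y) =
      wedgeSum (Module.finBasis ℝ E) (derivInChart x₀ η (chartAt E x₀ y)) := by
  funext k
  rw [wedgeSum_apply, Finset.sum_apply]
  cases k with
  | zero => exact Eq.trans (by rfl) (Finset.sum_const_zero (ι := Fin (Module.finrank ℝ E))).symm
  | succ k =>
    exact (formInChart_extDerivForm hy (hη k)).trans 
      (alternatizeUncurryFin_eq_sum_wedgeForm (Module.finBasis ℝ E) _)

theorem derivInChart_dForm {x₀ y : M} (hy : y ∈ (chartAt E x₀).source) {η : DForm E M}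
    (hη : SmoothForm η) (v : E) : derivInChart x₀ (dForm η) (chartAt E x₀ y) v =
      wedgeSum (Module.finBasis ℝ E) (secondDerivInChart x₀ η (chartAt E x₀ y) v) := by
  funext k
  rw [wedgeSum_apply, Finset.sum_apply]
  cases k with
  | zero =>
    refine Eq.trans ?_ (Finset.sum_const_zero (ι := Fin (Module.finrank ℝ E))).symm
    change fderiv ℝ (fun _ => 0) _ v = 0
    simp
  | succ k =>
    have h := (smoothFormAt_iff hy).1 (hη k y)
    have hdd := ((h.fderiv_right (m := ∞) (by exact_mod_cast le_rfl)).differentiableAt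
      (by simp)).hasFDerivAt
    change fderiv ℝ (formInChart x₀ (extDerivForm fun y => η y k)) _ v = _
    rw [(formInChart_extDerivForm_eventuallyEq hy (Filter.Eventually.of_forall (hη k))).fderiv_eq]
    have h2 := ((ContinuousAlternatingMap.alternatizeUncurryFinCLM ℝ E ℝ).hasFDerivAt.comp _
      hdd).fderiv
    exact (congrArg (fun A => A v) h2).trans (alternatizeUncurryFin_eq_sum_wedgeForm (Module.finBasis ℝ E) _)

end MixedCharts

/-! ### The codifferential and its derivative in a chart. -/

namespace SubRiemannian

open Topology

variable {E : Type*} [NormedAddCommGroup E] [NormedSpace ℝ E]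
  {M : Type*} [TopologicalSpace M] [ChartedSpace E M]
  [FiniteDimensional ℝ E] [IsManifold 𝓘(ℝ, E) ∞ M] {n : ℕ} (S : SubRiemannian E M n)

theorem mixedPull_trace {x₀ y : M}
    (ξ : TangentSpace 𝓘(ℝ, E) y → TangentSpace 𝓘(ℝ, E) y → MixedForm (TangentSpace 𝓘(ℝ, E) y)) :
    mixedPull (ofModel x₀ y) (S.trace y ξ) =
      S.trace y fun v w => mixedPull (ofModel x₀ y) (ξ v w) :=
  map_sum _ _ _

theorem mixedPull_codiff (cov : Connection E M) {x₀ y : M} (hy : y ∈ (chartAt E x₀).source)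
    {η : DForm E M} (hη : ∀ k, SmoothFormAt (fun z => η z k) y) :
    mixedPull (ofModel x₀ y) (S.codiff cov η y) = -∑ a, contractEnd (Module.finBasis ℝ E a)
      (covInChart cov x₀ η (chartAt E x₀ y) (S.cometricRow x₀ a (chartAt E x₀ y))) := by
  -- The trace sees only the diagonal, so the two slots may be exchanged: the contraction receives
  -- the constant vector e_a and the derivative receives G_a. The contraction then commutes with
  -- differentiation in the chart.
  have h := S.trace_eq_sum_cometricRow hy
    (((contractEnd (V := E)).compl₂ (covInChart cov x₀ η (chartAt E x₀ y))).compl₁₂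
      (toModel x₀ y).toLinearMap (toModel x₀ y).toLinearMap)
  have h2 : ∀ v w, mixedPull (ofModel x₀ y) (contractEnd w (nabla cov η y v)) =
      contractEnd (toModel x₀ y w) (covInChart cov x₀ η (chartAt E x₀ y) (toModel x₀ y v)) := by
    intro v w
    rw [← mixedPull_nabla cov hy hη, ← mixedPull_contractEnd, ofModel_toModel hy]
  simp only [LinearMap.compl₁₂_apply, LinearMap.compl₂_apply, ContinuousLinearMap.coe_coe,
    toModel_ofModel hy] at h
  rw [codiff, map_neg, mixedPull_trace, ← h]
  simp only [h2]
  rfl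

/-- An identity of germs rather than of values, since dδ differentiates it. It is phrased with
continuous bilinear maps so that the product rule applies. -/
theorem formInChart_codiff (cov : Connection E M) {x₀ y : M} (hy : y ∈ (chartAt E x₀).source)
    {η : DForm E M} (hη : SmoothForm η) (k : ℕ) :
    formInChart x₀ (fun z => S.codiff cov η z k) =ᶠ[𝓝 (chartAt E x₀ y)] fun e =>
      -∑ a, contractCLM E k (Module.finBasis ℝ E a)
        (fderiv ℝ (formInChart x₀ fun z => η z (k + 1)) e (S.cometricRow x₀ a e) -
          endActCLM E (k + 1) (chris cov x₀ e (S.cometricRow x₀ a e))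
            (formInChart x₀ (fun z => η z (k + 1)) e)) := by
  filter_upwards [(chartAt E x₀).open_target.mem_nhds ((chartAt E x₀).map_source hy)] with e he
  have hz := (chartAt E x₀).map_target he
  have h := congrFun (S.mixedPull_codiff cov hz (fun k => hη k _)) k
  rw [mixedPull_ofModel hz, (chartAt E x₀).right_inv he] at h
  refine h.trans ?_
  rw [Pi.neg_apply, Finset.sum_apply]
  rfl

theorem smoothForm_codiff [T2Space M] (cov : Connection E M)
    [CovariantDerivative.ContMDiffCovariantDerivative cov ∞] {η : DForm E M} (hη : SmoothForm η) :
    SmoothForm (S.codiff cov η) := by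
  intro k x
  have hx := mem_chart_source E x
  refine (smoothFormAt_iff hx).2 (ContDiffAt.congr_of_eventuallyEq ?_
    (S.formInChart_codiff cov hx hη k))
  have hf := (smoothFormAt_iff hx).1 (hη (k + 1) x)
  have hG := S.contDiffAt_cometricRow hx
  exact (ContDiffAt.sum fun a _ => contDiffAt_const.clm_apply
    (((hf.fderiv_right (by exact_mod_cast le_rfl)).clm_apply (hG a)).sub
      ((contDiffAt_const.clm_apply ((contDiffAt_chris cov hx).clm_apply (hG a))).clm_apply hf))).neg

theorem derivInChart_codiff [T2Space M] (cov : Connection E M)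
    [CovariantDerivative.ContMDiffCovariantDerivative cov ∞] {x₀ y : M}
    (hy : y ∈ (chartAt E x₀).source) {η : DForm E M} (hη : SmoothForm η) (v : E) :
    derivInChart x₀ (S.codiff cov η) (chartAt E x₀ y) v =
      -∑ a, contractEnd (Module.finBasis ℝ E a)
        (secondDerivInChart x₀ η (chartAt E x₀ y) v (S.cometricRow x₀ a (chartAt E x₀ y)) +
        derivInChart x₀ η (chartAt E x₀ y)
          (fderiv ℝ (S.cometricRow x₀ a) (chartAt E x₀ y) v) -
        endActEnd (chrisLin cov x₀ (chartAt E x₀ y)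
          (fderiv ℝ (S.cometricRow x₀ a) (chartAt E x₀ y) v)) (mixedInChart x₀ η (chartAt E x₀ y)) -
        endActEnd (chrisDerivLin cov x₀ (chartAt E x₀ y) v (S.cometricRow x₀ a (chartAt E x₀ y)))
          (mixedInChart x₀ η (chartAt E x₀ y)) -
        endActEnd (chrisLin cov x₀ (chartAt E x₀ y) (S.cometricRow x₀ a (chartAt E x₀ y)))
          (derivInChart x₀ η (chartAt E x₀ y) v)) := by
  funext k
  rw [Pi.neg_apply, Finset.sum_apply]
  set p := chartAt E x₀ y
  have hf := (smoothFormAt_iff hy).1 (hη (k + 1) y)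
  have hfd := (hf.differentiableAt (by simp)).hasFDerivAt
  have hfdd := ((hf.fderiv_right (m := ∞) (by exact_mod_cast le_rfl)).differentiableAt
    (by simp)).hasFDerivAt
  have hG : ∀ a, HasFDerivAt (S.cometricRow x₀ a) _ p := fun a =>
    ((S.contDiffAt_cometricRow hy a).differentiableAt (by simp)).hasFDerivAt
  have hΓ := ((contDiffAt_chris cov hy).differentiableAt (by simp)).hasFDerivAt
  have hterm : ∀ a, HasFDerivAt (fun e => contractCLM E k (Module.finBasis ℝ E a)
        (fderiv ℝ (formInChart x₀ fun z => η z (k + 1)) e (S.cometricRow x₀ a e) -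
          endActCLM E (k + 1) (chris cov x₀ e (S.cometricRow x₀ a e))
            (formInChart x₀ (fun z => η z (k + 1)) e))) _ p := fun a =>
    (contractCLM E k (Module.finBasis ℝ E a)).hasFDerivAt.comp p
      ((hfdd.clm_apply (hG a)).fun_sub
      ((endActCLM E (k + 1)).hasFDerivAt_of_bilinear (hΓ.clm_apply (hG a)) hfd))
  change fderiv ℝ (formInChart x₀ fun z => S.codiff cov η z k) p v = _
  rw [(S.formInChart_codiff cov hy hη k).fderiv_eq,
    (HasFDerivAt.fun_sum fun a (_ : a ∈ Finset.univ) => hterm a).fun_neg.fderiv]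
  rw [neg_apply, sum_apply]
  refine congrArg _ (Finset.sum_congr rfl fun a _ => ?_)
  rw [ContinuousLinearMap.comp_apply]
  change contractCLM E k _ _ = contractCLM E k _ _
  refine congrArg _ ?_
  let f := formInChart x₀ fun z => η z (k + 1)
  let g := S.cometricRow x₀ a
  let Γ := chris cov x₀
  change fderiv ℝ f p (fderiv ℝ g p v) + fderiv ℝ (fderiv ℝ f) p v (g p) -
      (endActCLM E (k + 1) (Γ p (g p)) (fderiv ℝ f p v) +
        endActCLM E (k + 1) (Γ p (fderiv ℝ g p v) + fderiv ℝ Γ p v (g p)) (f p)) =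
    fderiv ℝ (fderiv ℝ f) p v (g p) + fderiv ℝ f p (fderiv ℝ g p v) -
      endActCLM E (k + 1) (Γ p (fderiv ℝ g p v)) (f p) -
      endActCLM E (k + 1) (fderiv ℝ Γ p v (g p)) (f p) -
      endActCLM E (k + 1) (Γ p (g p)) (fderiv ℝ f p v)
  rw [map_add, add_apply]
  abel

end SubRiemannian

/-! ### The Hessian in a chart. -/

section HessianCharts

open Topology

variable {E : Type*} [NormedAddCommGroup E] [NormedSpace ℝ E]
  {M : Type*} [TopologicalSpace M] [ChartedSpace E M]
  [FiniteDimensional ℝ E] [IsManifold 𝓘(ℝ, E) ∞ M]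

/-- The Hessian of a mixed form in the preferred chart at `x₀`. -/
noncomputable def hessInChart (cov : Connection E M) (x₀ : M) (η : DForm E M) (e : E) :
    E →ₗ[ℝ] E →ₗ[ℝ] MixedForm E :=
  LinearMap.mk₂ ℝ (fun v w => secondDerivInChart x₀ η e v w -
      endActEnd (chrisDerivLin cov x₀ e v w) (mixedInChart x₀ η e) -
      endActEnd (chrisLin cov x₀ e w) (derivInChart x₀ η e v) -
      endActEnd (chrisLin cov x₀ e v) (covInChart cov x₀ η e w) -
      covInChart cov x₀ η e (chrisLin cov x₀ e v w))
    (fun v v' w => by simp only [map_add, LinearMap.add_apply]; abel)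
    (fun c v w => by simp only [map_smul, LinearMap.smul_apply, smul_sub])
    (fun v w w' => by simp only [map_add, LinearMap.add_apply]; abel)
    (fun c v w => by simp only [map_smul, LinearMap.smul_apply, smul_sub])

theorem toModel_cov_extend (cov : Connection E M) (x : M) (v w : TangentSpace 𝓘(ℝ, E) x) :
    toModel x x (cov (FiberBundle.extend E w) x v) =
      chrisLin cov x (chartAt E x x) (toModel x x v) (toModel x x w) := by
  have hx := mem_chart_source E x
  have h := toModel_cov cov hx ((contMDiffAt_extend w).mdifferentiableAt (by simp)) v
  have h2 : fieldInChart x (FiberBundle.extend E w) =ᶠ[𝓝 (chartAt E x x)]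
      fun _ => toModel x x w := by
    filter_upwards [(chartAt E x).open_target.mem_nhds ((chartAt E x).map_source hx)] with e he
    have hz := (chartAt E x).map_target he
    rw [fieldInChart, extend_eq_coordField hz, coordField, toModel_ofModel hz]
  rw [h, h2.fderiv_eq, FiberBundle.extend_apply_self]
  simp
  rfl

section

variable [T2Space M] (cov : Connection E M)
  [CovariantDerivative.ContMDiffCovariantDerivative cov ∞] {η : DForm E M}

theorem formInChart_nabla_extend (hη : SmoothForm η) (x : M) (w : TangentSpace 𝓘(ℝ, E) x) (k : ℕ) :
    formInChart x (fun y => nabla cov η y (FiberBundle.extend E w y) k) =ᶠ[𝓝 (chartAt E x x)]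
      fun e => fderiv ℝ (formInChart x fun y => η y k) e (toModel x x w) -
        endActCLM E k (chris cov x e (toModel x x w)) (formInChart x (fun y => η y k) e) := by
  have hx := mem_chart_source E x
  filter_upwards [(chartAt E x).open_target.mem_nhds ((chartAt E x).map_source hx)] with e he
  have hz := (chartAt E x).map_target he
  have h := congrFun (mixedPull_nabla cov hz (fun k => hη k _)
    (FiberBundle.extend E w ((chartAt E x).symm e))) k
  rw [extend_eq_coordField hz, coordField, toModel_ofModel hz, (chartAt E x).right_inv he] at h
  refine Eq.trans ?_ h
  rw [← coordField, ← extend_eq_coordField hz]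
  rfl

theorem smoothFormAt_nabla_extend (hη : SmoothForm η) (x : M) (w : TangentSpace 𝓘(ℝ, E) x) (k : ℕ) :
    SmoothFormAt (fun y => nabla cov η y (FiberBundle.extend E w y) k) x := by
  have hx := mem_chart_source E x
  refine (smoothFormAt_iff hx).2 (ContDiffAt.congr_of_eventuallyEq ?_
    (formInChart_nabla_extend cov hη x w k))
  have hf := (smoothFormAt_iff hx).1 (hη k x)
  exact ((hf.fderiv_right (by exact_mod_cast le_rfl)).clm_apply contDiffAt_const).sub
    ((contDiffAt_const.clm_apply ((contDiffAt_chris cov hx).clm_apply contDiffAt_const)).clm_apply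
      hf)

theorem derivInChart_nabla_extend (hη : SmoothForm η) (x : M) (w : TangentSpace 𝓘(ℝ, E) x) (v : E) :
    derivInChart x (fun y => nabla cov η y (FiberBundle.extend E w y)) (chartAt E x x) v =
      secondDerivInChart x η (chartAt E x x) v (toModel x x w) -
      endActEnd (chrisDerivLin cov x (chartAt E x x) v (toModel x x w))
        (mixedInChart x η (chartAt E x x)) -
      endActEnd (chrisLin cov x (chartAt E x x) (toModel x x w))
        (derivInChart x η (chartAt E x x) v) := by
  funext k
  have hx := mem_chart_source E x
  have hf := (smoothFormAt_iff hx).1 (hη k x)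
  have hfd := (hf.differentiableAt (by simp)).hasFDerivAt
  have hfdd := ((hf.fderiv_right (m := ∞) (by exact_mod_cast le_rfl)).differentiableAt
    (by simp)).hasFDerivAt
  have hΓ := ((contDiffAt_chris cov hx).differentiableAt (by simp)).hasFDerivAt
  have hw := hasFDerivAt_const (𝕜 := ℝ) (E := E) (toModel x x w) (chartAt E x x)
  change fderiv ℝ (formInChart x fun y => nabla cov η y (FiberBundle.extend E w y) k) _ v = _
  rw [(formInChart_nabla_extend cov hη x w k).fderiv_eq, ((hfdd.clm_apply hw).fun_sub
    ((endActCLM E k).hasFDerivAt_of_bilinear (hΓ.clm_apply hw) hfd)).fderiv]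
  let f := formInChart x fun z => η z k
  let Γ := chris cov x
  let p := chartAt E x x
  change fderiv ℝ f p 0 + fderiv ℝ (fderiv ℝ f) p v (toModel x x w) -
      (endActCLM E k (Γ p (toModel x x w)) (fderiv ℝ f p v) +
        endActCLM E k (Γ p 0 + fderiv ℝ Γ p v (toModel x x w)) (f p)) =
    fderiv ℝ (fderiv ℝ f) p v (toModel x x w) -
      endActCLM E k (fderiv ℝ Γ p v (toModel x x w)) (f p) -
      endActCLM E k (Γ p (toModel x x w)) (fderiv ℝ f p v)
  rw [map_zero, map_zero, zero_add, zero_add]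
  abel

/-- The extension of w has constant coordinates in the chart at x, so differentiating the form ∇_W η
meets only η and the symbols, and ∇_v W is Γ(v)w. -/
theorem mixedPull_hessian (hη : SmoothForm η) (x : M) (v w : TangentSpace 𝓘(ℝ, E) x) :
    mixedPull (ofModel x x) (hessian cov η x v w) =
      hessInChart cov x η (chartAt E x x) (toModel x x v) (toModel x x w) := by
  have hx := mem_chart_source E x
  have h : mixedInChart x (fun y => nabla cov η y (FiberBundle.extend E w y)) (chartAt E x x) =
      covInChart cov x η (chartAt E x x) (toModel x x w) := by
    rw [← mixedPull_ofModel hx, FiberBundle.extend_apply_self,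
      mixedPull_nabla cov hx (fun k => hη k x)]
  rw [hessian, map_sub, mixedPull_nabla cov hx (fun k => smoothFormAt_nabla_extend cov hη x w k),
    mixedPull_nabla cov hx (fun k => hη k x), toModel_cov_extend, covInChart_apply,
    derivInChart_nabla_extend cov hη, h]
  rfl

end

end HessianCharts

/-! ### The two Laplacians in a chart. -/

namespace SubRiemannian

variable {E : Type*} [NormedAddCommGroup E] [NormedSpace ℝ E]
  {M : Type*} [TopologicalSpace M] [ChartedSpace E M]
  [FiniteDimensional ℝ E] [IsManifold 𝓘(ℝ, E) ∞ M] {n : ℕ} (S : SubRiemannian E M n)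

section

variable [T2Space M] (cov : Connection E M)
  [CovariantDerivative.ContMDiffCovariantDerivative cov ∞] {η : DForm E M}

theorem mixedPull_horizontalLaplacian (hη : SmoothForm η) (x : M) :
    mixedPull (ofModel x x) (S.horizontalLaplacian cov η x) =
      ∑ a, hessInChart cov x η (chartAt E x x) (Module.finBasis ℝ E a)
        (S.cometricRow x a (chartAt E x x)) := by
  have hx := mem_chart_source E x
  have h := S.trace_eq_sum_cometricRow hx ((hessInChart cov x η (chartAt E x x)).compl₁₂
      (toModel x x).toLinearMap (toModel x x).toLinearMap)
  simp only [LinearMap.compl₁₂_apply, ContinuousLinearMap.coe_coe, toModel_ofModel hx] at h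
  rw [horizontalLaplacian, mixedPull_trace, ← h]
  simp only [mixedPull_hessian cov hη]

/-- The Weitzenböck identity in a chart. -/
theorem mixedPull_formLaplacian (hS : S.IsParallelCometric (adjointConnection cov))
    (hη : SmoothForm η) (x : M) :
    mixedPull (ofModel x x) (S.formLaplacian cov η x) =
      mixedPull (ofModel x x) (S.horizontalLaplacian cov η x) +
      ∑ a, contractEnd (Module.finBasis ℝ E a) (∑ c, wedgeEnd ((Module.finBasis ℝ E).coord c)
        (endActEnd (((chrisDerivLin cov x (chartAt E x x)).flip
            (S.cometricRow x a (chartAt E x x)) - chrisLin cov x (chartAt E x x) ∘ₗ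
            chrisLin cov x (chartAt E x x) (S.cometricRow x a (chartAt E x x)))
            (Module.finBasis ℝ E c))
          (mixedInChart x η (chartAt E x x)))) := by
  have hx := mem_chart_source E x
  let p := chartAt E x x
  let G := fun a => S.cometricRow x a p
  have hδ := S.smoothForm_codiff cov hη
  have hsymm : ∀ v w, secondDerivInChart x η p v w = secondDerivInChart x η p w v := fun v w =>
    funext fun k => (((smoothFormAt_iff hx).1 (hη k x)).isSymmSndFDerivAt
      (by simp; exact ENat.LEInfty.out)).eq v w
  -- Smoothness of η enters through the symmetry of its second derivatives, and the hypothesis on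
  -- the connection through the derivative of the cometric rows.
  have key := weitzenboeck_pointwise (Module.finBasis ℝ E) G
    (fun a c => S.coord_cometricRow x a c p) (chrisLin cov x p) (chrisDerivLin cov x p)
    (fun a => (fderiv ℝ (S.cometricRow x a) p).toLinearMap)
    (fun a v => hS.fderiv_cometricRow hx a v) (mixedInChart x η p) (derivInChart x η p)
    (secondDerivInChart x η p) hsymm
  rw [mixedPull_horizontalLaplacian S cov hη]
  refine Eq.trans ?_ key
  have h1 : mixedPull (ofModel x x) (dForm (S.codiff cov η) x) =
      wedgeSum (Module.finBasis ℝ E) (derivInChart x (S.codiff cov η) p) := by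
    rw [mixedPull_ofModel hx, mixedInChart_dForm hx fun k => hδ k x]
  change mixedPull (ofModel x x) (-dForm (S.codiff cov η) x - S.codiff cov (dForm η) x) = _
  rw [map_sub, map_neg, h1, S.mixedPull_codiff cov hx fun k => hη.dForm k x, wedgeSum_apply,
    sub_neg_eq_add]
  congr 1
  · rw [← Finset.sum_neg_distrib]
    refine Finset.sum_congr rfl fun c _ => ?_
    rw [S.derivInChart_codiff cov hx hη, map_neg, neg_neg]
    rfl
  · refine Finset.sum_congr rfl fun a _ => ?_
    rw [covInChart_apply, derivInChart_dForm hx hη, mixedInChart_dForm hx fun k => hη k x]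
    rfl

end

end SubRiemannian

theorem mixedForm_sum_smul {V ι : Type*} [AddCommGroup V] [Module ℝ V] [TopologicalSpace V]
    [Fintype ι] (r : ι → ℝ) (η : MixedForm V) : (∑ a, r a) • η = ∑ a, r a • η :=
  Finset.sum_smul

theorem bilinear_eq_sum_coord {V N ι : Type*} [AddCommGroup V] [Module ℝ V] [AddCommGroup N]
    [Module ℝ N] [Fintype ι] (b : Module.Basis ι ℝ V) (P : V →ₗ[ℝ] V →ₗ[ℝ] N) (X Y : V) :
    P X Y = ∑ h, ∑ l, (b.coord h X * b.coord l Y) • P (b h) (b l) := by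
  conv_lhs => rw [← b.sum_repr X, ← b.sum_repr Y]
  simp only [map_sum, map_smul, LinearMap.sum_apply, LinearMap.smul_apply, Finset.smul_sum,
    smul_smul, Module.Basis.coord_apply]
  rw [Finset.sum_comm]
  simp only [mul_comm]

/-! ### Additivity of d on smooth forms, functions, and zero-order operators in a chart. -/

section SmoothFormOperations

variable {E : Type*} [NormedAddCommGroup E] [NormedSpace ℝ E]
  {M : Type*} [TopologicalSpace M] [ChartedSpace E M]
  [FiniteDimensional ℝ E] [IsManifold 𝓘(ℝ, E) ∞ M]

theorem SmoothForm.neg {η : DForm E M} (hη : SmoothForm η) : SmoothForm (-η) := fun k x =>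
  (smoothFormAt_iff (mem_chart_source E x)).2
    ((smoothFormAt_iff (mem_chart_source E x)).1 (hη k x)).neg

theorem SmoothForm.sub {η θ : DForm E M} (hη : SmoothForm η) (hθ : SmoothForm θ) :
    SmoothForm (η - θ) := fun k x =>
  (smoothFormAt_iff (mem_chart_source E x)).2
    (((smoothFormAt_iff (mem_chart_source E x)).1 (hη k x)).sub
      ((smoothFormAt_iff (mem_chart_source E x)).1 (hθ k x)))

theorem dForm_neg {η : DForm E M} (hη : SmoothForm η) : dForm (-η) = -dForm η := by
  funext x
  have hx := mem_chart_source E x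
  refine mixedPull_ofModel_injective hx ?_
  rw [Pi.neg_apply, map_neg, mixedPull_ofModel hx, mixedPull_ofModel hx,
    mixedInChart_dForm hx fun k => hη.neg k x, mixedInChart_dForm hx fun k => hη k x, ← map_neg]
  refine congrArg _ (LinearMap.ext fun v => funext fun k => ?_)
  exact congrArg (fun A => A v) (fderiv_neg (𝕜 := ℝ) (E := E) (f := formInChart x fun y => η y k))

theorem dForm_sub {η θ : DForm E M} (hη : SmoothForm η) (hθ : SmoothForm θ) :
    dForm (η - θ) = dForm η - dForm θ := by
  funext x
  have hx := mem_chart_source E x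
  refine mixedPull_ofModel_injective hx ?_
  rw [Pi.sub_apply, map_sub, mixedPull_ofModel hx, mixedPull_ofModel hx, mixedPull_ofModel hx,
    mixedInChart_dForm hx fun k => (hη.sub hθ) k x, mixedInChart_dForm hx fun k => hη k x,
    mixedInChart_dForm hx fun k => hθ k x, ← map_sub]
  refine congrArg _ (LinearMap.ext fun v => funext fun k => ?_)
  exact congrArg (fun A => A v) (fderiv_sub
    (((smoothFormAt_iff hx).1 (hη k x)).differentiableAt (by simp))
    (((smoothFormAt_iff hx).1 (hθ k x)).differentiableAt (by simp)))

theorem smoothForm_ofFun {f : M → ℝ} (hf : CMDiff ∞ f) : SmoothForm (ofFun f : DForm E M) := by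
  intro k x
  have hx := mem_chart_source E x
  refine (smoothFormAt_iff hx).2 (contDiffAt_form_iff.2 fun v => ?_)
  cases k with
  | zero => exact (contMDiffAt_iff_comp_symm (n := ⊤) hx f).1 (hf x)
  | succ k => exact contDiffAt_const (c := (0 : ℝ))

theorem contractEnd_ofFun (f : M → ℝ) (x : M) (X : TangentSpace 𝓘(ℝ, E) x) :
    contractEnd X (ofFun f x) = 0 := rfl

/-- Each summand of either operator applies a contraction first. -/
theorem fermion_ofFun (f : M → ℝ) (x : M) (ν : PsiFiber (TangentSpace 𝓘(ℝ, E) x) 1 1)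
    (μ : PsiFiber (TangentSpace 𝓘(ℝ, E) x) 2 2) :
    fermion (psiIncl ν + psiIncl μ) (ofFun f x) = 0 := by
  rw [map_add, LinearMap.add_apply,
    fermion_psiIncl_one_one (Module.finBasis ℝ (TangentSpace 𝓘(ℝ, E) x)),
    fermion_psiIncl_two_two (Module.finBasis ℝ (TangentSpace 𝓘(ℝ, E) x))]
  simp only [contractEnd_ofFun, map_zero, smul_zero, Finset.sum_const_zero, add_zero]

section

variable {x y : M}
  (η : MixedForm (TangentSpace 𝓘(ℝ, E) y))

theorem mixedPull_coord_wedgeEnd (hy : y ∈ (chartAt E x).source)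
    (α : Module.Dual ℝ E) :
    mixedPull (ofModel x y) (wedgeEnd (α ∘ₗ (toModel x y).toLinearMap) η) =
      wedgeEnd α (mixedPull (ofModel x y) η) := by
  rw [mixedPull_wedgeEnd]
  congr 2
  exact LinearMap.ext fun w => congrArg α (toModel_ofModel hy w)

theorem mixedPull_fermion_one_one (hy : y ∈ (chartAt E x).source)
    (ν : PsiFiber (TangentSpace 𝓘(ℝ, E) y) 1 1) :
    mixedPull (ofModel x y) (fermion (psiIncl ν) η) = ∑ c, ∑ h,
      psiEval ν ![ofModel x y (Module.finBasis ℝ E c)]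
        ![(Module.finBasis ℝ E).coord h ∘ₗ (toModel x y).toLinearMap] •
      wedgeEnd ((Module.finBasis ℝ E).coord c)
        (contractEnd (Module.finBasis ℝ E h) (mixedPull (ofModel x y) η)) := by
  let B := (Module.finBasis ℝ E).map (modelEquiv hy).toLinearEquiv
  have hB : ∀ c, B c = ofModel x y (Module.finBasis ℝ E c) := fun c => rfl
  have hBc : ∀ c, B.coord c = (Module.finBasis ℝ E).coord c ∘ₗ (toModel x y).toLinearMap :=
    fun c => rfl
  rw [fermion_psiIncl_one_one B]
  simp only [map_sum, map_smul, hB, hBc, mixedPull_coord_wedgeEnd _ hy, mixedPull_contractEnd]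

theorem mixedPull_fermion_two_two (hy : y ∈ (chartAt E x).source)
    (ν : PsiFiber (TangentSpace 𝓘(ℝ, E) y) 2 2) :
    mixedPull (ofModel x y) (fermion (psiIncl ν) η) = (4⁻¹ : ℝ) • ∑ c, ∑ f, ∑ h, ∑ l,
      psiEval ν ![ofModel x y (Module.finBasis ℝ E c), ofModel x y (Module.finBasis ℝ E f)]
        ![(Module.finBasis ℝ E).coord h ∘ₗ (toModel x y).toLinearMap,
          (Module.finBasis ℝ E).coord l ∘ₗ (toModel x y).toLinearMap] •
      wedgeEnd ((Module.finBasis ℝ E).coord c) (wedgeEnd ((Module.finBasis ℝ E).coord f)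
        (contractEnd (Module.finBasis ℝ E l) (contractEnd (Module.finBasis ℝ E h)
          (mixedPull (ofModel x y) η)))) := by
  let B := (Module.finBasis ℝ E).map (modelEquiv hy).toLinearEquiv
  have hB : ∀ c, B c = ofModel x y (Module.finBasis ℝ E c) := fun c => rfl
  have hBc : ∀ c, B.coord c = (Module.finBasis ℝ E).coord c ∘ₗ (toModel x y).toLinearMap :=
    fun c => rfl
  rw [fermion_psiIncl_two_two B]
  simp only [map_sum, map_smul, hB, hBc, mixedPull_coord_wedgeEnd _ hy, mixedPull_contractEnd]

end

end SmoothFormOperations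

/-! ### Commutation with d and the Weitzenböck identity. -/

namespace SubRiemannian

variable {E : Type*} [NormedAddCommGroup E] [NormedSpace ℝ E]
  {M : Type*} [TopologicalSpace M] [ChartedSpace E M]
  [FiniteDimensional ℝ E] [IsManifold 𝓘(ℝ, E) ∞ M] {n : ℕ} (S : SubRiemannian E M n)
  [T2Space M] (cov : Connection E M) [CovariantDerivative.ContMDiffCovariantDerivative cov ∞]
  {η : DForm E M}

theorem smoothForm_formLaplacian (hη : SmoothForm η) : SmoothForm (S.formLaplacian cov η) :=
  (S.smoothForm_codiff cov hη).dForm.neg.sub (S.smoothForm_codiff cov hη.dForm)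

theorem codiff_zero : S.codiff cov (0 : DForm E M) = 0 := by
  have h0 : SmoothForm (0 : DForm E M) := fun k x =>
    (smoothFormAt_iff (mem_chart_source E x)).2 (contDiffAt_form_iff.2 fun _ =>
      contDiffAt_const (c := (0 : ℝ)))
  funext x
  have hx := mem_chart_source E x
  refine mixedPull_ofModel_injective hx ?_
  rw [S.mixedPull_codiff cov hx fun k => h0 k x, Pi.zero_apply, map_zero]
  have h : covInChart cov x (0 : DForm E M) (chartAt E x x) = 0 := by
    refine LinearMap.ext fun v => ?_
    have h1 : mixedInChart x (0 : DForm E M) (chartAt E x x) = 0 := rfl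
    have h2 : derivInChart x (0 : DForm E M) (chartAt E x x) = 0 := by
      refine LinearMap.ext fun v => funext fun k => ?_
      change fderiv ℝ (fun _ => 0) _ v = 0
      simp
    rw [covInChart_apply, h1, h2, map_zero, sub_zero]
  simp only [h, LinearMap.zero_apply, map_zero, Finset.sum_const_zero, neg_zero]

/-- By d² = 0 both sides reduce to −dδdη. -/
theorem formLaplacian_dForm (hη : SmoothForm η) :
    S.formLaplacian cov (dForm η) = dForm (S.formLaplacian cov η) := by
  have h1 := S.smoothForm_codiff cov hη
  have h2 := S.smoothForm_codiff cov hη.dForm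
  rw [formLaplacian, formLaplacian, dForm_sub h1.dForm.neg h2, dForm_neg h1.dForm, dForm_dForm h1,
    dForm_dForm hη, codiff_zero, sub_zero, neg_zero, zero_sub]

variable {S cov}

theorem mixedPull_fermion_ric_one_one {ρ : Π x : M, PsiFiber (TangentSpace 𝓘(ℝ, E) x) 1 1}
    (hρ : S.IsRic₁₁ (adjointConnection cov) ρ) (x : M) :
    mixedPull (ofModel x x) (fermion (psiIncl (ρ x)) (η x)) =
      -∑ a, ∑ c, ∑ h, (Module.finBasis ℝ E).coord h (curvModel cov x (chartAt E x x)
          (Module.finBasis ℝ E a) (Module.finBasis ℝ E c) (S.cometricRow x a (chartAt E x x))) •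
        wedgeEnd ((Module.finBasis ℝ E).coord c)
          (contractEnd (Module.finBasis ℝ E h) (mixedInChart x η (chartAt E x x))) := by
  have hx := mem_chart_source E x
  let b := Module.finBasis ℝ E
  have hψ : ∀ c h, psiEval (ρ x) ![ofModel x x (b c)]
      ![b.coord h ∘ₗ (toModel x x).toLinearMap] = -∑ a, b.coord h
        (curvModel cov x (chartAt E x x) (b a) (b c) (S.cometricRow x a (chartAt E x x))) := by
    intro c h
    have h2 := S.trace_eq_sum_cometricRow hx ((curvTensor cov hx).flip (ofModel x x (b c)))
    simp only [LinearMap.flip_apply, curvTensor_apply, toModel_ofModel hx] at h2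
    rw [hρ]
    simp only [curvature_eq_curvTensor hx (contDiffAt_chris cov hx), curvTensor_apply,
      toModel_ofModel hx]
    rw [h2, map_neg, map_sum]
    simp only [LinearMap.comp_apply, ContinuousLinearMap.coe_coe, toModel_ofModel hx, b]
  rw [mixedPull_fermion_one_one _ hx, mixedPull_ofModel hx]
  simp only [b] at hψ
  simp only [hψ, mixedForm_neg_smul, mixedForm_sum_smul, Finset.sum_neg_distrib]
  rw [Finset.sum_comm (s := Finset.univ) (t := Finset.univ)
    (f := fun a c => ∑ h, (Module.finBasis ℝ E).coord h (curvModel cov x (chartAt E x x)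
      (Module.finBasis ℝ E a) (Module.finBasis ℝ E c) (S.cometricRow x a (chartAt E x x))) •
        wedgeEnd ((Module.finBasis ℝ E).coord c)
          (contractEnd (Module.finBasis ℝ E h) (mixedInChart x η (chartAt E x x))))]
  exact congrArg _ (Finset.sum_congr rfl fun c _ => Finset.sum_comm)

/-- By definition the coefficients apply R̂ to e_a and pair the second covector with G_a. Symmetry
of the cometric exchanges the roles, so that R̂ acts on G_a, as in the remainder of the chart
computation. -/
theorem mixedPull_fermion_ric_two_two {ρ : Π x : M, PsiFiber (TangentSpace 𝓘(ℝ, E) x) 2 2}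
    (hρ : S.IsRic₂₂ (adjointConnection cov) ρ) (x : M) :
    mixedPull (ofModel x x) (fermion (psiIncl (ρ x)) (η x)) =
      -∑ a, (2⁻¹ : ℝ) • ∑ c, ∑ f, ∑ h, (Module.finBasis ℝ E).coord h (curvModel cov x
          (chartAt E x x) (Module.finBasis ℝ E c) (Module.finBasis ℝ E f)
          (S.cometricRow x a (chartAt E x x))) •
        wedgeEnd ((Module.finBasis ℝ E).coord c) (wedgeEnd ((Module.finBasis ℝ E).coord f)
          (contractEnd (Module.finBasis ℝ E a) (contractEnd (Module.finBasis ℝ E h)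
            (mixedInChart x η (chartAt E x x))))) := by
  have hx := mem_chart_source E x
  let b := Module.finBasis ℝ E
  let p := chartAt E x x
  let G := fun a => S.cometricRow x a p
  let R := curvModel cov x p
  let F := mixedInChart x η p
  let P : Fin (Module.finrank ℝ E) → Fin (Module.finrank ℝ E) → E →ₗ[ℝ] E →ₗ[ℝ] MixedForm E :=
    fun c f => ((contractEnd (V := E)).compl₂ ((contractEnd (V := E)).flip F)).flip.compr₂
      (wedgeEnd (b.coord c) ∘ₗ wedgeEnd (b.coord f))
  have hP : ∀ c f u v, P c f u v =
      wedgeEnd (b.coord c) (wedgeEnd (b.coord f) (contractEnd v (contractEnd u F))) :=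
    fun _ _ _ _ => rfl
  have hψ : ∀ c f h l, psiEval (ρ x) ![ofModel x x (b c), ofModel x x (b f)]
      ![b.coord h ∘ₗ (toModel x x).toLinearMap, b.coord l ∘ₗ (toModel x x).toLinearMap] =
        ∑ a, -2 * (b.coord h (R (b c) (b f) (b a)) * b.coord l (G a)) := by
    intro c f h l
    rw [hρ, cometric_curvature S cov hx, dualPairing_apply, Finset.mul_sum]
    refine Finset.sum_congr rfl fun a _ => ?_
    simp only [curvTensor_apply, LinearMap.comp_apply, ContinuousLinearMap.coe_coe,
      toModel_ofModel hx, b, R, G, p]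
    ring
  have hcf : ∀ c f, ∑ h, ∑ l, (∑ a, -2 * (b.coord h (R (b c) (b f) (b a)) * b.coord l (G a))) •
      P c f (b h) (b l) = (-2 : ℝ) • ∑ a, ∑ h, b.coord h (R (b c) (b f) (G a)) •
        P c f (b h) (b a) := by
    intro c f
    have h1 : ∑ a, P c f (R (b c) (b f) (b a)) (G a) = ∑ a, P c f (R (b c) (b f) (G a)) (b a) :=
      trace_symm b G (fun a c => S.coord_cometricRow x a c p) (P c f ∘ₗ R (b c) (b f))
    have h2 : ∀ a, ∑ h, b.coord h (R (b c) (b f) (G a)) • P c f (b h) (b a) =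
        P c f (R (b c) (b f) (G a)) (b a) := fun a =>
      sum_coord_smul b ((P c f).flip (b a)) _
    simp only [h2, ← h1]
    simp only [bilinear_eq_sum_coord b (P c f) (R (b c) (b f) (b _)), Finset.smul_sum, smul_smul,
      mixedForm_sum_smul]
    rw [Finset.sum_comm (s := Finset.univ) (t := Finset.univ)
      (f := fun a h => ∑ l, (-2 * (b.coord h (R (b c) (b f) (b a)) * b.coord l (G a))) •
        P c f (b h) (b l))]
    exact Finset.sum_congr rfl fun h _ => Finset.sum_comm
  rw [mixedPull_fermion_two_two _ hx, mixedPull_ofModel hx]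
  simp only [b] at hψ
  simp only [hψ]
  refine Eq.trans (congrArg _ (Finset.sum_congr rfl fun c _ => Finset.sum_congr rfl fun f _ =>
    hcf c f)) ?_
  -- Here 1/4 comes from the double count of both pairs, 2 from the definition of Ric_{2,2}, and the
  -- sign from the action of the curvature on covectors.
  have h3 : (4⁻¹ : ℝ) * -2 = -2⁻¹ := by norm_num
  simp only [← Finset.smul_sum, smul_smul, h3]
  rw [mixedForm_neg_smul]
  refine congrArg _ (congrArg _ ?_)
  refine Eq.trans ?_ (Finset.sum_comm (s := Finset.univ) (t := Finset.univ)
    (f := fun c a => ∑ f, ∑ h, b.coord h (R (b c) (b f) (G a)) • P c f (b h) (b a)))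
  exact Finset.sum_congr rfl fun c _ => Finset.sum_comm

/-- The Weitzenböck identity. -/
theorem formLaplacian_eq (hS : S.IsParallelCometric (adjointConnection cov))
    {ρ₁ : Π x : M, PsiFiber (TangentSpace 𝓘(ℝ, E) x) 1 1}
    {ρ₂ : Π x : M, PsiFiber (TangentSpace 𝓘(ℝ, E) x) 2 2}
    (h₁ : S.IsRic₁₁ (adjointConnection cov) ρ₁) (h₂ : S.IsRic₂₂ (adjointConnection cov) ρ₂)
    (hη : SmoothForm η) (x : M) :
    S.formLaplacian cov η x =
      S.horizontalLaplacian cov η x - fermion (psiIncl (ρ₁ x) + psiIncl (ρ₂ x)) (η x) := by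
  refine mixedPull_ofModel_injective (mem_chart_source E x) ?_
  rw [S.mixedPull_formLaplacian cov hS hη, map_sub, map_add fermion, LinearMap.add_apply,
    map_add (mixedPull (ofModel x x)), mixedPull_fermion_ric_one_one h₁,
    mixedPull_fermion_ric_two_two h₂, sub_eq_add_neg, ← neg_add, neg_neg,
    ← Finset.sum_add_distrib]
  refine congrArg _ (Finset.sum_congr rfl fun a _ => ?_)
  -- For this K the difference K(u)v − K(v)u is by definition `curvModel` of u and v applied to G_a,
  -- so the two sums match the two Ricci operators.
  rw [contractEnd_wedgeSum_endActEnd]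
  rfl

end SubRiemannian

theorem mainTheorem4 {E : Type*} [NormedAddCommGroup E] [NormedSpace ℝ E] [FiniteDimensional ℝ E]
    {M : Type*} [TopologicalSpace M] [T2Space M] [ChartedSpace E M] [IsManifold 𝓘(ℝ, E) ∞ M]
    {n : ℕ} (S : SubRiemannian E M n)
    (cov : Connection E M) [CovariantDerivative.ContMDiffCovariantDerivative cov ∞]
    (hcov : S.IsParallelCometric (adjointConnection cov)) :
    (∀ η : DForm E M, SmoothForm η →
      SmoothForm (S.codiff cov η) ∧ SmoothForm (S.formLaplacian cov η)) ∧
    (∀ f : M → ℝ, CMDiff ∞ f →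
      S.formLaplacian cov (ofFun f) = S.horizontalLaplacian cov (ofFun f)) ∧
    (∀ η : DForm E M, SmoothForm η →
      S.formLaplacian cov (dForm η) = dForm (S.formLaplacian cov η)) ∧
    (∃! ρ : Π x : M, PsiFiber (TangentSpace 𝓘(ℝ, E) x) 1 1,
      SmoothPsi ρ ∧ S.IsRic₁₁ (adjointConnection cov) ρ) ∧
    (∃! ρ : Π x : M, PsiFiber (TangentSpace 𝓘(ℝ, E) x) 2 2,
      SmoothPsi ρ ∧ S.IsRic₂₂ (adjointConnection cov) ρ) ∧
    ∀ (ρ₁ : Π x : M, PsiFiber (TangentSpace 𝓘(ℝ, E) x) 1 1)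
      (ρ₂ : Π x : M, PsiFiber (TangentSpace 𝓘(ℝ, E) x) 2 2),
      S.IsRic₁₁ (adjointConnection cov) ρ₁ → S.IsRic₂₂ (adjointConnection cov) ρ₂ →
      ∀ η : DForm E M, SmoothForm η → ∀ x : M,
        S.formLaplacian cov η x =
          S.horizontalLaplacian cov η x - fermion (psiIncl (ρ₁ x) + psiIncl (ρ₂ x)) (η x) := by
  choose ρ₁ hρ₁ using exists_ric_one_one S cov
  choose ρ₂ hρ₂ using exists_ric_two_two cov hcov
  have h₁ : S.IsRic₁₁ (adjointConnection cov) ρ₁ := hρ₁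
  have h₂ : S.IsRic₂₂ (adjointConnection cov) ρ₂ := hρ₂
  refine ⟨fun η hη => ⟨S.smoothForm_codiff cov hη, S.smoothForm_formLaplacian cov hη⟩,
    fun f hf => funext fun x => ?_, fun η hη => S.formLaplacian_dForm cov hη,
    ⟨ρ₁, ⟨smoothPsi_ric_one_one h₁, h₁⟩, fun ρ hρ => funext fun x => psi_one_one_ext fun v α => ?_⟩,
    ⟨ρ₂, ⟨smoothPsi_ric_two_two h₂, h₂⟩,
      fun ρ hρ => funext fun x => psi_two_two_ext fun v w α β => ?_⟩,
    fun ρ₁ ρ₂ h₁ h₂ η hη x => S.formLaplacian_eq hcov h₁ h₂ hη x⟩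
  -- On functions the Ricci term vanishes, so part (I) is a case of the Weitzenböck identity.
  · rw [SubRiemannian.formLaplacian_eq hcov h₁ h₂ (smoothForm_ofFun hf), fermion_ofFun, sub_zero]
  · rw [hρ.2, h₁]
  · rw [hρ.2, h₂]
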